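/- **Setting.** For each $n$ let $(\mathbf D^-_n,\mathbf D^+_n)$, $\mathbf D_n^\pm=(D_1^\pm,\dots,D_n^\pm)$, be a (possibly random) pair of sequences of non-negative integers with $L_n=\sum_r D_r^-=\sum_r D_r^+$ (in- and out-degrees). Put $$g_n^\pm(t)=\frac1n\sum_{r=1}^n 1(D_r^\pm=t),\qquad f_n^\pm(t)=\frac1{L_n}\sum_{r=1}^n 1(D_r^\pm=t)\,D_r^\mp .$$ Let $\mathscr F_n=\sigma(\mathbf D_n^-,\mathbf D_n^+)$ and $\mathbb P_n=P(\,\cdot\mid\mathscr F_n)$. The sign $\pm$ is replaced consistently by $+$ or by $-$ (and $\mp$ by the opposite sign); everything holds for both choices. **Assumption 1.** Let $g^\pm,f^\pm$ be probability mass functions on $\{0,1,2,\dots\}$, where $g^+,g^-$ have the common mean $\nu<\infty$ and $f^+,f^-$ have the common mean $\mu\in(1,\infty)$; let $\varepsilon>0$, $0<\kappa\le1$, $K_\kappa<\infty$. The bi-degree sequence satisfies $$\sum_{k\ge0}\Big|\sum_{i=0}^k(g_n^\pm(i)-g^\pm(i))\Big|\le n^{-\varepsilon},\quad \sum_{k\ge0}\Big|\sum_{i=0}^k(f_n^\pm(i)-f^\pm(i))\Big|\le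 n^{-\varepsilon},\quad \sum_{r=1}^n\big((D_r^-)^\kappa+(D_r^+)^\kappa\big)D_r^+D_r^-\le K_\kappa n .$$ **Coupling.** Let $\{U_{\mathbf i}\}$, $\mathbf i\in\bigcup_{k\ge0}\mathbb N_+^k$, be i.i.d. uniform on $(0,1)$, independent of the bi-degree sequence, and write $F^{-1}(u)=\inf\{x:F(x)\ge u\}$. Let $G^\pm,F^\pm,G_n^\pm$ be the distribution functions of $g^\pm,f^\pm,g_n^\pm$. *Tree.* Individual $\mathbf i$ has $\hat\chi^\pm_{\mathbf i}=(F^\pm)^{-1}(U_{\mathbf i})$ offspring $(\mathbf i,1),\dots,(\mathbf i,\hat\chi^\pm_{\mathbf i})$ if $\mathbf i\ne\emptyset$, and the root $\emptyset$ has $\hat\chi^\pm_\emptyset=(G^\pm)^{-1}(U_\emptyset)$. Let $\hat A_m^\pm$ be the set of individuals of generation $m$ and $\hat Z_m^\pm=|\hat A_m^\pm|$. *Graph.* In the directed configuration model with degrees $(\mathbf D_n^-,\mathbf D_n^+)$, explore the outbound stubs (sign $+$) or inbound stubs (sign $-$) breadth-first. All nodes are initially inactive. Step 1 puts $\chi_\emptyset^\pm=(G_n^\pm)^{-1}(U_\emptyset)$,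 activates a uniformly chosen node with $D^\pm=\chi_\emptyset^\pm$, and labels its stubs $1,\dots,\chi_\emptyset^\pm$. Each later step traverses all the stubs labelled in the previous step, in lexicographic order. When stub $\mathbf i$ is about to be traversed, let $T^\pm_{\mathbf i}$ be the number of stubs traversed before (not counting $\emptyset$), let $\mathcal I_r=1$ if node $r$ is inactive at that moment and $\mathcal I_r=0$ otherwise, let $V_{\mathbf i}^\mp=L_n-\sum_r D_r^\mp\mathcal I_r-T_{\mathbf i}^\pm$, and $$h^\pm_{\mathbf i}(t)=\frac1{L_n-T^\pm_{\mathbf i}}\Big\{\sum_{r=1}^n1(D_r^\pm=t)D_r^\mp\mathcal I_r+1(t=0)V^\mp_{\mathbf i}\Big\},\qquad \chi^\pm_{\mathbf i}=(H^\pm_{\mathbf i})^{-1}(U_{\mathbf i}),$$ with $H^\pm_{\mathbf i}$ the distribution function of $h^\pm_{\mathbf i}$. Stub $\mathbf i$ is then paired with a uniformly chosen unpaired stub of the opposite kind among those of inactive nodes with $D^\pm=\chi^\pm_{\mathbf i}$ and, if $\chi_{\mathbf i}^\pm=0$, also those of active nodes. The node that is reached becomes active, and the new stubs are labelled $(\mathbf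 i,1),\dots,(\mathbf i,\chi^\pm_{\mathbf i})$. The uniform choices use randomness independent of the $U_{\mathbf i}$ and of the bi-degree sequence. Let $A_m^\pm$ be the set of labels created in step $m$. **Theorem 4.1.** Let $g^\pm,f^\pm,\varepsilon,\kappa,K_\kappa$ be as in Assumption 1, and let $0<\delta<1$ and $0<\gamma<\min\{\delta\kappa,\varepsilon\}$. There exist finite constants $K,a>0$, depending only on these data and not on $n$ or the bi-degree sequence, such that almost surely, whenever the bi-degree sequence $(\mathbf D_n^-,\mathbf D_n^+)$ satisfies Assumption 1, we have for all integers $1\le k\le(1-\delta)\log_\mu n$ $$\mathbb P_n\Big(\bigcap_{m=1}^k\Big\{\big|\hat A^\pm_m\cap(A^\pm_m)^c\big|\le\hat Z^\pm_m n^{-\gamma},\ \big|A^\pm_m\cap(\hat A^\pm_m)^c\big|\le\hat Z^\pm_m n^{-\gamma}\Big\}\Big)\ge1-Kn^{-a}.$$ -/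

import Mathlib

open MeasureTheory ProbabilityTheory

noncomputable section

namespace DCM

/-! ### Distribution functions on the non-negative integers -/

/-- The pseudo-inverse `u ↦ inf {x : F x ≥ u}` of the distribution function
`F k = p 0 + ⋯ + p k` of a mass function `p` on the non-negative integers. For `0 < u < 1` the
infimum over the reals is attained at a non-negative integer, so it is taken over `ℕ`. -/
def pseudoInverse (p : ℕ → ℝ) (u : ℝ) : ℕ :=
  sInf {k : ℕ | u ≤ ∑ i ∈ Finset.range (k + 1), p i}

/-- The Kantorovich-Rubinstein distance `∑ₖ |∑_{i ≤ k} (p i - q i)|` (possibly infinite) between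
two mass functions on the non-negative integers. -/
def dist1 (p q : ℕ → ℝ) : ENNReal :=
  ∑' k : ℕ, ENNReal.ofReal |∑ i ∈ Finset.range (k + 1), (p i - q i)|

/-! ### Empirical degree distributions and the regularity assumption

Everything is written for a pair `own`, `opp` of degree sequences. Outbound stubs are explored with
`own` the out-degrees and `opp` the in-degrees, inbound stubs with the roles exchanged. -/

variable {n : ℕ}

/-- Empirical distribution of the degrees (`gₙ⁺` or `gₙ⁻`). -/
def empirical (own : Fin n → ℕ) (t : ℕ) : ℝ :=
  (1 / (n : ℝ)) * ∑ r : Fin n, if own r = t then (1 : ℝ) else 0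

/-- Size-biased empirical distribution of the degrees (`fₙ⁺` or `fₙ⁻`). -/
def sizeBiased (own opp : Fin n → ℕ) (t : ℕ) : ℝ :=
  (1 / ((∑ r : Fin n, opp r : ℕ) : ℝ)) * ∑ r : Fin n, if own r = t then (opp r : ℝ) else 0

/-- The limiting mass functions `g⁺, g⁻` have the common finite mean `ν`, and `f⁺, f⁻` have the
common finite mean `μ > 1`. -/
structure IsLimit (gOut gIn fOut fIn : PMF ℕ) (ν μ : ℝ) : Prop where
  mean_gOut : HasSum (fun j : ℕ => (j : ℝ) * (gOut j).toReal) ν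
  mean_gIn : HasSum (fun j : ℕ => (j : ℝ) * (gIn j).toReal) ν
  mean_fOut : HasSum (fun j : ℕ => (j : ℝ) * (fOut j).toReal) μ
  mean_fIn : HasSum (fun j : ℕ => (j : ℝ) * (fIn j).toReal) μ
  one_lt : 1 < μ

/-- The bi-degree sequence `(dIn, dOut)` on `n` nodes is regular: its empirical and size-biased
empirical distributions are within Kantorovich-Rubinstein distance `n ^ (-ε)` of the given limits,
and it satisfies the moment bound with exponent `κ` and constant `C`. -/
structure IsRegular (gOut gIn fOut fIn : PMF ℕ) (ε κ C : ℝ) (dIn dOut : Fin n → ℕ) : Prop where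
  dist_gOut : dist1 (empirical dOut) (fun i => (gOut i).toReal) ≤ ENNReal.ofReal ((n : ℝ) ^ (-ε))
  dist_gIn : dist1 (empirical dIn) (fun i => (gIn i).toReal) ≤ ENNReal.ofReal ((n : ℝ) ^ (-ε))
  dist_fOut : dist1 (sizeBiased dOut dIn) (fun i => (fOut i).toReal) ≤
    ENNReal.ofReal ((n : ℝ) ^ (-ε))
  dist_fIn : dist1 (sizeBiased dIn dOut) (fun i => (fIn i).toReal) ≤
    ENNReal.ofReal ((n : ℝ) ^ (-ε))
  moment : ∑ r : Fin n, ((dIn r : ℝ) ^ κ + (dOut r : ℝ) ^ κ) * (dOut r : ℝ) * (dIn r : ℝ) ≤ C * n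

/-! ### The delayed branching process

Individuals are labelled by finite sequences of positive integers; `[]` is the root, and the
children of `i` are `i ++ [1], i ++ [2], …`. The family `u` holds one number of `(0, 1)` per
label. -/

/-- Number of offspring of the individual `i`: distribution `g` for the root, `f` for the rest. -/
def treeOffspring (g f : PMF ℕ) (u : List ℕ → ℝ) (i : List ℕ) : ℕ :=
  if i = [] then pseudoInverse (fun t => (g t).toReal) (u i)
  else pseudoInverse (fun t => (f t).toReal) (u i)

/-- The set of individuals of the tree at distance `m` from the root. -/
def treeGen (g f : PMF ℕ) (u : List ℕ → ℝ) : ℕ → Finset (List ℕ)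
  | 0 => {[]}
  | m + 1 => (treeGen g f u m).biUnion fun i =>
      (Finset.Icc 1 (treeOffspring g f u i)).image fun j => i ++ [j]

/-! ### The breadth-first exploration of the graph -/

/-- State of the exploration: the set of active nodes, and the set of those `opp`-stubs that already
belong to an edge. The `opp`-stubs of node `r` are the pairs `⟨r, j⟩` with `j < opp r`. Every
traversed `own`-stub is paired with exactly one `opp`-stub, so the cardinality of `paired` is also
the number of `own`-stubs traversed so far. -/
structure State (n : ℕ) where
  active : Finset (Fin n)
  paired : Finset (Σ _ : Fin n, ℕ)

/-- All `opp`-stubs. -/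
def allStubs (opp : Fin n → ℕ) : Finset (Σ _ : Fin n, ℕ) :=
  Finset.univ.sigma fun r => Finset.range (opp r)

/-- Number of unpaired `opp`-stubs that belong to active nodes, computed as
`L - ∑ (opp-stubs of inactive nodes) - T`. -/
def activeUnpaired (opp : Fin n → ℕ) (s : State n) : ℝ :=
  ((∑ r : Fin n, opp r : ℕ) : ℝ) - (∑ r : Fin n, if r ∈ s.active then (0 : ℝ) else (opp r : ℝ))
    - (s.paired.card : ℝ)

/-- The distribution (`h⁺` or `h⁻`), given the state, of the number of new `own`-stubs discovered
when the next `own`-stub is traversed. -/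
def nextPmf (own opp : Fin n → ℕ) (s : State n) (t : ℕ) : ℝ :=
  (1 / (((∑ r : Fin n, opp r : ℕ) : ℝ) - (s.paired.card : ℝ))) *
    ((∑ r : Fin n, if own r = t ∧ r ∉ s.active then (opp r : ℝ) else 0) +
      if t = 0 then activeUnpaired opp s else 0)

/-- The `opp`-stubs among which the partner is chosen, given that `t` new `own`-stubs are
discovered: the unpaired `opp`-stubs of inactive nodes with exactly `t` `own`-stubs and, if `t = 0`,
also those of active nodes. -/
def candidates (own opp : Fin n → ℕ) (s : State n) (t : ℕ) : Finset (Σ _ : Fin n, ℕ) :=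
  (allStubs opp).filter fun x =>
    x ∉ s.paired ∧ ((x.1 ∉ s.active ∧ own x.1 = t) ∨ (x.1 ∈ s.active ∧ t = 0))

/-- The element of `S` selected by the number `v`: if `v` is uniform on `(0, 1)` and `S` is not
empty, then the selected element is uniform on `S`. -/
def pick {α : Type*} (S : Finset α) (v : ℝ) : Option α :=
  S.toList[⌊v * (S.card : ℝ)⌋₊]?

/-- The state after pairing an `own`-stub with the `opp`-stub `x`; the node of `x` becomes active.
(With probability one the case `none` never occurs.) -/
def State.update (s : State n) : Option (Σ _ : Fin n, ℕ) → State n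
  | none => s
  | some x => ⟨insert x.1 s.active, insert x s.paired⟩

/-- Labels of the `c` stubs discovered by traversing the stub `i`, in increasing order. -/
def children (i : List ℕ) (c : ℕ) : List (List ℕ) :=
  (List.range c).map fun j => i ++ [j + 1]

/-- Traverse the `own`-stubs of a list one after the other, starting from the state `s`; return the
labels of the newly discovered stubs, and the final state. The stub `i` discovers
`H⁻¹ (u i)` new stubs, `H` being the distribution function of `nextPmf` at the moment when `i` is
about to be traversed, and `v i` selects its partner. If the input list is in lexicographic order,
with all labels of the same length, then so is the output list. -/
def traverse (own opp : Fin n → ℕ) (u v : List ℕ → ℝ) :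
    List (List ℕ) → State n → List (List ℕ) × State n
  | [], s => ([], s)
  | i :: l, s =>
    let c := pseudoInverse (nextPmf own opp s) (u i)
    let rest := traverse own opp u v l (s.update (pick (candidates own opp s c) (v i)))
    (children i c ++ rest.1, rest.2)

/-- Number of `own`-stubs of the node where the exploration starts. -/
def rootDegree (own : Fin n → ℕ) (u : List ℕ → ℝ) : ℕ :=
  pseudoInverse (empirical own) (u [])

/-- The state after the first node was selected, uniformly among the nodes with `rootDegree`
`own`-stubs; it is active, and no stub has been traversed. -/
def startState (own : Fin n → ℕ) (u v : List ℕ → ℝ) : State n :=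
  ⟨(pick (Finset.univ.filter fun r => own r = rootDegree own u) (v [])).toFinset, ∅⟩

/-- The exploration at the end of step `m`: the list, in lexicographic order, of the labels of the
`own`-stubs discovered in step `m`, and the state. Step `0` is the fictional stub `[]`, step `1`
selects the first node, and step `m + 2` traverses all stubs that were discovered in step
`m + 1`. -/
def explore (own opp : Fin n → ℕ) (u v : List ℕ → ℝ) : ℕ → List (List ℕ) × State n
  | 0 => ([[]], ⟨∅, ∅⟩)
  | 1 => (children [] (rootDegree own u), startState own u v)
  | m + 2 => traverse own opp u v (explore own opp u v (m + 1)).1 (explore own opp u v (m + 1)).2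

/-- The set of `own`-stubs discovered in step `m` of the exploration. -/
def graphGen (own opp : Fin n → ℕ) (u v : List ℕ → ℝ) (m : ℕ) : Finset (List ℕ) :=
  (explore own opp u v m).1.toFinset

/-! ### The coupling event and its randomness -/

/-- In each of the generations `1, …, k`, both differences of the sets of graph and tree individuals
have at most `Ẑₘ n ^ (-γ)` elements, where `Ẑₘ` is the size of generation `m` of the tree. -/
def IsClose (own opp : Fin n → ℕ) (g f : PMF ℕ) (γ : ℝ) (k : ℕ) (u v : List ℕ → ℝ) : Prop :=
  ∀ m ∈ Finset.Icc 1 k,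
    ((treeGen g f u m \ graphGen own opp u v m).card : ℝ) ≤
        ((treeGen g f u m).card : ℝ) * (n : ℝ) ^ (-γ) ∧
      ((graphGen own opp u v m \ treeGen g f u m).card : ℝ) ≤
        ((treeGen g f u m).card : ℝ) * (n : ℝ) ^ (-γ)

/-- The randomness on a probability space `(Ω, P)`: a random bi-degree sequence `(DIn, DOut)` on `n`
nodes and, independent of it, i.i.d. random variables `U i`, `V i`, uniform on `(0, 1)`, indexed by
the labels. The `U i` determine the numbers of offspring in the tree and in the graph, the `V i`
only select the partner stubs. -/
structure IsInput {Ω : Type*} [MeasurableSpace Ω] (P : Measure Ω)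
    (DIn DOut : Ω → Fin n → ℕ) (U V : List ℕ → Ω → ℝ) : Prop where
  measurable_in : Measurable DIn
  measurable_out : Measurable DOut
  sum_eq : ∀ ω, ∑ r : Fin n, DIn ω r = ∑ r : Fin n, DOut ω r
  measurable_U : ∀ i, Measurable (U i)
  measurable_V : ∀ i, Measurable (V i)
  uniform_U : ∀ i, pdf.IsUniform (U i) (Set.Ioo 0 1) P volume
  uniform_V : ∀ i, pdf.IsUniform (V i) (Set.Ioo 0 1) P volume
  iIndep : iIndepFun (Sum.elim U V) P
  indep : IndepFun (fun ω => (DIn ω, DOut ω))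
    (fun ω (j : List ℕ ⊕ List ℕ) => Sum.elim U V j ω) P

/-- The sigma-algebra generated by the bi-degree sequence. -/
abbrev degreeSigma {Ω : Type*} (DIn DOut : Ω → Fin n → ℕ) : MeasurableSpace Ω :=
  MeasurableSpace.comap (fun ω => (DIn ω, DOut ω)) inferInstance

end DCM

end

open MeasureTheory ProbabilityTheory

noncomputable section

namespace DCM

section

/-! ### The space of labels with independent uniform numbers -/

/-- The uniform distribution on `(0, 1)`. -/
def unif : Measure ℝ := volume.restrict (Set.Ioo 0 1)

instance : IsProbabilityMeasure unif := ⟨by simp [unif]⟩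

/-- Two families of numbers, indexed by the labels. -/
abbrev Input : Type := List ℕ ⊕ List ℕ → ℝ

/-- The law of independent uniform numbers. -/
def inputLaw : Measure Input := Measure.infinitePi fun _ => unif

instance : IsProbabilityMeasure inputLaw := by unfold inputLaw; infer_instance

lemma map_update_inputLaw (j : List ℕ ⊕ List ℕ) :
    (inputLaw.prod unif).map (fun z => Function.update z.1 j z.2) = inputLaw := by
  have hm : Measurable (fun z : Input × ℝ => Function.update z.1 j z.2) := by
    rw [measurable_pi_iff]
    intro i
    by_cases h : i = j
    · subst h; simpa using measurable_snd
    · simp only [Function.update_of_ne h]; fun_prop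
  refine Measure.eq_infinitePi _ ?_
  intro s t ht
  have hpre : (fun z : Input × ℝ => Function.update z.1 j z.2) ⁻¹' (Set.pi s t) =
      (Set.pi (s.erase j : Finset _) t) ×ˢ (if j ∈ s then t j else Set.univ) := by
    ext ⟨x, a⟩
    simp only [Set.mem_preimage, Set.mem_pi, Finset.mem_coe, Set.mem_prod, Finset.mem_erase]
    constructor
    · intro h
      refine ⟨fun i hi => by simpa [Function.update_of_ne hi.1] using h i hi.2, ?_⟩
      split_ifs with hj
      · simpa using h j hj
      · trivial
    · rintro ⟨h1, h2⟩ i hi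
      by_cases h : i = j
      · subst h; simpa [hi] using h2
      · simpa [Function.update_of_ne h] using h1 i ⟨h, hi⟩
  rw [Measure.map_apply hm (MeasurableSet.pi (Finset.countable_toSet s) fun i _ => ht i), hpre,
    Measure.prod_prod, inputLaw, Measure.infinitePi_pi _ (fun i _ => ht i)]
  by_cases hj : j ∈ s
  · simp only [hj, if_true]
    rw [mul_comm, Finset.mul_prod_erase s (fun i => unif (t i)) hj]
  · simp [hj]

lemma lintegral_resample (j : List ℕ ⊕ List ℕ) {Φ : Input → ENNReal} (hΦ : Measurable Φ) :
    ∫⁻ x, Φ x ∂inputLaw = ∫⁻ x, ∫⁻ a, Φ (Function.update x j a) ∂unif ∂inputLaw := by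
  have hm : Measurable (fun z : Input × ℝ => Function.update z.1 j z.2) := by
    rw [measurable_pi_iff]
    intro i
    by_cases h : i = j
    · subst h; simpa using measurable_snd
    · simp only [Function.update_of_ne h]; fun_prop
  conv_lhs => rw [← map_update_inputLaw j]
  rw [lintegral_map hΦ hm]
  exact lintegral_prod (fun z : Input × ℝ => Φ (Function.update z.1 j z.2))
    (hΦ.comp hm).aemeasurable

/-- The function `S` of the input ignores the numbers of the label `i`. -/
def Ignores {σ : Type*} (S : Input → σ) (i : List ℕ) : Prop :=
  ∀ x a b, S (Function.update (Function.update x (Sum.inl i) a) (Sum.inr i) b) = S x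

lemma lintegral_ignores {σ : Type*} [MeasurableSpace σ] [Countable σ]
    [MeasurableSingletonClass σ] {S : Input → σ} (hS : Measurable S) {i : List ℕ}
    (hi : Ignores S i) {φ : σ → ℝ → ℝ → ENNReal}
    (hφ : ∀ s, Measurable fun z : ℝ × ℝ => φ s z.1 z.2) :
    ∫⁻ x, φ (S x) (x (Sum.inl i)) (x (Sum.inr i)) ∂inputLaw =
      ∫⁻ x, ∫⁻ a, ∫⁻ b, φ (S x) a b ∂unif ∂unif ∂inputLaw := by
  have hφ' : Measurable fun z : σ × (ℝ × ℝ) => φ z.1 z.2.1 z.2.2 :=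
    measurable_from_prod_countable_right hφ
  have hm : Measurable fun x : Input => φ (S x) (x (Sum.inl i)) (x (Sum.inr i)) :=
    hφ'.comp (g := fun z : σ × (ℝ × ℝ) => φ z.1 z.2.1 z.2.2)
      (f := fun x : Input => (S x, (x (Sum.inl i), x (Sum.inr i))))
      (hS.prodMk (by fun_prop))
  have hm2 : Measurable fun x : Input =>
      ∫⁻ b, φ (S (Function.update x (Sum.inr i) b)) (x (Sum.inl i)) b ∂unif := by
    have : Measurable fun z : Input × ℝ =>
        φ (S (Function.update z.1 (Sum.inr i) z.2)) (z.1 (Sum.inl i)) z.2 := by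
      have hu : Measurable (fun z : Input × ℝ => Function.update z.1 (Sum.inr i) z.2) := by
        rw [measurable_pi_iff]
        intro j
        by_cases h : j = Sum.inr i
        · subst h; simpa using measurable_snd
        · simp only [Function.update_of_ne h]; fun_prop
      exact hφ'.comp (g := fun z : σ × (ℝ × ℝ) => φ z.1 z.2.1 z.2.2)
        (f := fun z : Input × ℝ => (S (Function.update z.1 (Sum.inr i) z.2),
          (z.1 (Sum.inl i), z.2))) ((hS.comp hu).prodMk (by fun_prop))
    exact this.lintegral_prod_right'
  rw [lintegral_resample (Sum.inr i) hm]
  simp only [Function.update_self, ne_eq, reduceCtorEq, not_false_eq_true, Function.update_of_ne]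
  rw [lintegral_resample (Sum.inl i) hm2]
  simp only [Function.update_self]
  have hi' : ∀ x a b, S (Function.update (Function.update x (Sum.inl i) a) (Sum.inr i) b) = S x := hi
  simp only [hi']

lemma lintegral_sum_ignores {σ : Type*} [MeasurableSpace σ] [Countable σ]
    [MeasurableSingletonClass σ] {Q : Input → Finset (List ℕ)} (S : List ℕ → Input → σ)
    (hQ : ∀ i, MeasurableSet {x | i ∈ Q x}) (hS : ∀ i, Measurable (S i))
    (hQi : ∀ i, Ignores (fun x => i ∈ Q x) i) (hSi : ∀ i, (∃ x, i ∈ Q x) → Ignores (S i) i)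
    {φ : List ℕ → σ → ℝ → ℝ → ENNReal} (hφ : ∀ i s, Measurable fun z : ℝ × ℝ => φ i s z.1 z.2) :
    ∫⁻ x, ∑ i ∈ Q x, φ i (S i x) (x (Sum.inl i)) (x (Sum.inr i)) ∂inputLaw =
      ∫⁻ x, ∑ i ∈ Q x, ∫⁻ a, ∫⁻ b, φ i (S i x) a b ∂unif ∂unif ∂inputLaw := by
  classical
  have key : ∀ (F : List ℕ → ENNReal) (q : Finset (List ℕ)),
      ∑ i ∈ q, F i = ∑' i, if i ∈ q then F i else 0 := by
    intro F q
    rw [tsum_eq_sum (s := q) (fun i hi => by simp [hi])]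
    exact Finset.sum_congr rfl fun i hi => by simp [hi]
  simp_rw [key]
  have hφ' : ∀ i, Measurable fun z : σ × (ℝ × ℝ) => φ i z.1 z.2.1 z.2.2 :=
    fun i => measurable_from_prod_countable_right (hφ i)
  rw [lintegral_tsum, lintegral_tsum]
  · refine tsum_congr fun i => ?_
    by_cases hex : ∃ x, i ∈ Q x
    swap
    · push Not at hex
      simp [hex]
    have := lintegral_ignores (S := fun x => (S i x, decide (i ∈ Q x))) (i := i)
      ((hS i).prodMk (measurable_to_bool (by
        have : (fun x => decide (i ∈ Q x)) ⁻¹' {true} = {x | i ∈ Q x} := by ext; simp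
        rw [this]; exact hQ i)))
      (fun x a b => Prod.ext (hSi i hex x a b) (by
        have := hQi i x a b
        simp only [eq_iff_iff] at this
        simp [this]))
      (φ := fun z a b => if z.2 = true then φ i z.1 a b else 0)
      (fun s => by
        by_cases h : s.2 = true
        · simp only [h, if_true]; exact hφ i s.1
        · simp [h])
    simp only [decide_eq_true_eq] at this
    rw [this]
    refine lintegral_congr fun x => ?_
    by_cases h : i ∈ Q x <;> simp [h]
  · intro i
    have h1 : Measurable fun z : σ => ∫⁻ a, ∫⁻ b, φ i z a b ∂unif ∂unif := measurable_of_countable _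
    exact (Measurable.ite (hQ i) (h1.comp (hS i)) measurable_const).aemeasurable
  · intro i
    exact (Measurable.ite (hQ i) ((hφ' i).comp (g := fun z : σ × (ℝ × ℝ) => φ i z.1 z.2.1 z.2.2)
      (f := fun x : Input => (S i x, (x (Sum.inl i), x (Sum.inr i))))
      ((hS i).prodMk (by fun_prop))) measurable_const).aemeasurable

/-- The product of independent factors, over a random set of labels that ignores the numbers of its
elements. -/
lemma lintegral_mul_prod {X : Input → ENNReal} (hX : Measurable X) (q : Finset (List ℕ))
    (hXi : ∀ i ∈ q, Ignores X i) {ψ : ℝ → ENNReal} (hψ : Measurable ψ) :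
    ∫⁻ x, X x * ∏ i ∈ q, ψ (x (Sum.inl i)) ∂inputLaw =
      (∫⁻ x, X x ∂inputLaw) * (∫⁻ a, ψ a ∂unif) ^ q.card := by
  classical
  induction q using Finset.induction_on with
  | empty => simp
  | insert i q hi ih =>
    have hm : Measurable fun x : Input => X x * ∏ j ∈ insert i q, ψ (x (Sum.inl j)) :=
      hX.mul (Finset.measurable_prod _ fun j _ => hψ.comp (measurable_pi_apply _))
    have hXl : ∀ x a, X (Function.update x (Sum.inl i) a) = X x := by
      intro x a
      have := hXi i (Finset.mem_insert_self _ _) x a (x (Sum.inr i))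
      rwa [show x (Sum.inr i) = Function.update x (Sum.inl i) a (Sum.inr i) by simp,
        Function.update_eq_self] at this
    rw [lintegral_resample (Sum.inl i) hm]
    have : ∀ (x : Input) (a : ℝ), X (Function.update x (Sum.inl i) a) *
        ∏ j ∈ insert i q, ψ (Function.update x (Sum.inl i) a (Sum.inl j)) =
        (X x * ∏ j ∈ q, ψ (x (Sum.inl j))) * ψ a := by
      intro x a
      rw [hXl, Finset.prod_insert hi, Function.update_self]
      have : ∏ j ∈ q, ψ (Function.update x (Sum.inl i) a (Sum.inl j)) =
          ∏ j ∈ q, ψ (x (Sum.inl j)) := by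
        refine Finset.prod_congr rfl fun j hj => ?_
        rw [Function.update_of_ne]
        intro h
        exact hi (Sum.inl_injective h ▸ hj)
      rw [this]; ring
    simp_rw [this]
    simp_rw [lintegral_const_mul _ hψ]
    have hm3 : Measurable fun x : Input => X x * ∏ j ∈ q, ψ (x (Sum.inl j)) :=
      hX.mul (Finset.measurable_prod _ fun j _ => hψ.comp (measurable_pi_apply _))
    rw [lintegral_mul_const _ hm3, ih fun j hj => hXi j (Finset.mem_insert_of_mem hj),
      Finset.card_insert_of_notMem hi]
    ring

end

section

/-! ### Quantile transforms -/

/-- A probability mass function on the non-negative integers, with real values. -/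
structure IsMass (p : ℕ → ℝ) : Prop where
  nonneg : ∀ k, 0 ≤ p k
  hasSum : HasSum p 1

/-- The distribution function of a mass function. -/
def cum (p : ℕ → ℝ) (k : ℕ) : ℝ := ∑ i ∈ Finset.range (k + 1), p i

lemma isMass_toReal (f : PMF ℕ) : IsMass fun t => (f t).toReal := by
  refine ⟨fun k => ENNReal.toReal_nonneg, ?_⟩
  have h := ENNReal.hasSum_toReal (f := fun t => f t) (by rw [f.tsum_coe]; simp)
  rwa [← ENNReal.tsum_toReal_eq (fun a => f.apply_ne_top a), f.tsum_coe, ENNReal.toReal_one] at h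

lemma IsMass.cum_mono {p : ℕ → ℝ} (hp : IsMass p) : Monotone (cum p) := by
  intro a b h
  exact Finset.sum_le_sum_of_subset_of_nonneg
    (Finset.range_mono (by lia)) fun i _ _ => hp.nonneg i

lemma IsMass.cum_le_one {p : ℕ → ℝ} (hp : IsMass p) (k : ℕ) : cum p k ≤ 1 :=
  sum_le_hasSum _ (fun i _ => hp.nonneg i) hp.hasSum

lemma IsMass.cum_nonneg {p : ℕ → ℝ} (hp : IsMass p) (k : ℕ) : 0 ≤ cum p k :=
  Finset.sum_nonneg fun i _ => hp.nonneg i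

lemma IsMass.lt_pseudoInverse_iff {p : ℕ → ℝ} (hp : IsMass p) {u : ℝ} (hu : u < 1) (k : ℕ) :
    k < pseudoInverse p u ↔ cum p k < u := by
  have hne : {k : ℕ | u ≤ ∑ i ∈ Finset.range (k + 1), p i}.Nonempty := by
    have h := (hp.hasSum.tendsto_sum_nat.comp (Filter.tendsto_add_atTop_nat 1)).eventually
      (lt_mem_nhds hu)
    obtain ⟨k, hk⟩ := h.exists
    exact ⟨k, le_of_lt hk⟩
  constructor
  · intro h
    have := Nat.notMem_of_lt_sInf h
    simpa [cum] using this
  · intro h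
    by_contra hcon
    push Not at hcon
    have h1 : u ≤ cum p (pseudoInverse p u) := Nat.sInf_mem hne
    have h2 := hp.cum_mono hcon
    linarith

lemma ae_unif : ∀ᵐ u ∂unif, u ∈ Set.Ioo (0 : ℝ) 1 := ae_restrict_mem measurableSet_Ioo

lemma unif_Ioi {c : ℝ} (hc : 0 ≤ c) : unif (Set.Ioi c) = ENNReal.ofReal (1 - c) := by
  rw [unif, Measure.restrict_apply measurableSet_Ioi, Set.inter_comm, Set.Ioo_inter_Ioi,
    max_eq_right hc, Real.volume_Ioo]

lemma measurable_pseudoInverse (p : ℕ → ℝ) : Measurable (pseudoInverse p) := by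
  refine measurable_of_Iic fun c => ?_
  have : pseudoInverse p ⁻¹' Set.Iic c =
      (⋃ j ∈ Set.Iic c, Set.Iic (cum p j)) ∪ (⋂ j, (Set.Iic (cum p j))ᶜ) := by
    ext u
    simp only [Set.mem_preimage, Set.mem_Iic, Set.mem_union, Set.mem_iUnion, Set.mem_iInter,
      Set.mem_compl_iff, exists_prop, pseudoInverse]
    by_cases hne : {k : ℕ | u ≤ ∑ i ∈ Finset.range (k + 1), p i}.Nonempty
    · constructor
      · intro h
        exact Or.inl ⟨_, h, Nat.sInf_mem hne⟩
      · rintro (⟨j, hj, hu⟩ | h)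
        · exact (Nat.sInf_le hu).trans hj
        · obtain ⟨k, hk⟩ := hne
          exact absurd hk (h k)
    · rw [Set.not_nonempty_iff_eq_empty] at hne
      rw [hne]
      simp only [Nat.sInf_empty, zero_le, true_iff]
      refine Or.inr fun j hj => ?_
      have : j ∈ {k : ℕ | u ≤ ∑ i ∈ Finset.range (k + 1), p i} := hj
      rw [hne] at this
      exact this
  rw [this]
  exact (MeasurableSet.biUnion (Set.to_countable _) fun j _ => measurableSet_Iic).union
    (MeasurableSet.iInter fun j => measurableSet_Iic.compl)

lemma natCast_eq_tsum (m : ℕ) : (m : ENNReal) = ∑' k : ℕ, if k < m then 1 else 0 := by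
  rw [tsum_eq_sum (s := Finset.range m) (by intro k hk; simpa using hk)]
  rw [Finset.sum_congr rfl (g := fun _ => (1 : ENNReal)) fun k hk => by
    simp [Finset.mem_range.1 hk]]
  simp

lemma lintegral_pseudoInverse {p : ℕ → ℝ} (hp : IsMass p) :
    ∫⁻ a, (pseudoInverse p a : ENNReal) ∂unif = ∑' k, ENNReal.ofReal (1 - cum p k) := by
  have : ∫⁻ a, (pseudoInverse p a : ENNReal) ∂unif =
      ∫⁻ a, ∑' k, (Set.Ioi (cum p k)).indicator (fun _ => (1 : ENNReal)) a ∂unif := by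
    refine lintegral_congr_ae (ae_unif.mono fun a ha => ?_)
    dsimp only
    rw [natCast_eq_tsum]
    refine tsum_congr fun k => ?_
    simp only [hp.lt_pseudoInverse_iff ha.2, Set.indicator, Set.mem_Ioi]
  rw [this, lintegral_tsum fun k => (measurable_const.indicator measurableSet_Ioi).aemeasurable]
  refine tsum_congr fun k => ?_
  rw [lintegral_indicator measurableSet_Ioi, lintegral_one, Measure.restrict_apply_univ,
    unif_Ioi (hp.cum_nonneg k)]

lemma dist1_eq (p q : ℕ → ℝ) : dist1 p q = ∑' k, ENNReal.ofReal |cum p k - cum q k| := by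
  simp [dist1, cum, Finset.sum_sub_distrib]

lemma dist1_comm (p q : ℕ → ℝ) : dist1 p q = dist1 q p := by
  simp_rw [dist1_eq, abs_sub_comm]

lemma dist1_triangle (p q r : ℕ → ℝ) : dist1 p r ≤ dist1 p q + dist1 q r := by
  simp_rw [dist1_eq]
  rw [← ENNReal.tsum_add]
  refine ENNReal.tsum_le_tsum fun k => ?_
  rw [← ENNReal.ofReal_add (abs_nonneg _) (abs_nonneg _)]
  exact ENNReal.ofReal_le_ofReal (abs_sub_le _ _ _)

lemma lintegral_pseudoInverse_sub {p q : ℕ → ℝ} (hp : IsMass p) (hq : IsMass q) :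
    ∫⁻ a, ((pseudoInverse p a - pseudoInverse q a : ℕ) : ENNReal) ∂unif ≤ dist1 p q := by
  have : ∫⁻ a, ((pseudoInverse p a - pseudoInverse q a : ℕ) : ENNReal) ∂unif ≤
      ∫⁻ a, ∑' k, (Set.Ioc (cum p k) (cum q k)).indicator (fun _ => (1 : ENNReal)) a ∂unif := by
    refine lintegral_mono_ae (ae_unif.mono fun a ha => ?_)
    rw [ENNReal.natCast_sub]
    refine tsub_le_iff_right.2 ?_
    rw [natCast_eq_tsum, natCast_eq_tsum (pseudoInverse q a), ← ENNReal.tsum_add]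
    refine ENNReal.tsum_le_tsum fun k => ?_
    simp only [hp.lt_pseudoInverse_iff ha.2, hq.lt_pseudoInverse_iff ha.2, Set.indicator,
      Set.mem_Ioc]
    by_cases h1 : cum p k < a <;> by_cases h2 : cum q k < a <;> simp [h1, h2, not_lt.1]
  refine this.trans ?_
  rw [lintegral_tsum fun k => (measurable_const.indicator measurableSet_Ioc).aemeasurable, dist1_eq]
  refine ENNReal.tsum_le_tsum fun k => ?_
  rw [lintegral_indicator measurableSet_Ioc, lintegral_one, Measure.restrict_apply_univ]
  calc unif (Set.Ioc (cum p k) (cum q k)) ≤ volume (Set.Ioc (cum p k) (cum q k)) :=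
        Measure.restrict_apply_le _ _
    _ ≤ _ := by
      rw [Real.volume_Ioc]
      refine ENNReal.ofReal_le_ofReal ?_
      rw [abs_sub_comm]
      exact le_abs_self _

lemma unif_pseudoInverse_eq {p : ℕ → ℝ} (hp : IsMass p) (c : ℕ) :
    unif (pseudoInverse p ⁻¹' {c}) = ENNReal.ofReal (p c) := by
  have hle : cum p c = (if c = 0 then 0 else cum p (c - 1)) + p c := by
    rcases c with _ | c
    · simp [cum]
    · simp [cum, Finset.sum_range_succ _ (c + 1)]
  set l : ℝ := if c = 0 then 0 else cum p (c - 1) with hl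
  have hl0 : 0 ≤ l := by rw [hl]; split_ifs; exacts [le_rfl, hp.cum_nonneg _]
  have hae : pseudoInverse p ⁻¹' {c} =ᵐ[unif] Set.Ioc l (cum p c) := by
    refine ae_unif.mono fun a ha => ?_
    refine propext ?_
    change pseudoInverse p a = c ↔ l < a ∧ a ≤ cum p c
    rw [← not_lt (a := cum p c), ← hp.lt_pseudoInverse_iff ha.2, hl]
    split_ifs with h0
    · subst h0; simp [ha.1]
    · rw [← hp.lt_pseudoInverse_iff ha.2]; lia
  rw [measure_congr hae, unif, Measure.restrict_apply measurableSet_Ioc]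
  refine le_antisymm ?_ ?_
  · refine (measure_mono Set.inter_subset_left).trans ?_
    rw [Real.volume_Ioc, hle]; simp
  · have : Set.Ioo l (cum p c) ⊆ Set.Ioc l (cum p c) ∩ Set.Ioo 0 1 := fun a ha =>
      ⟨⟨ha.1, ha.2.le⟩, hl0.trans_lt ha.1, ha.2.trans_le (hp.cum_le_one c)⟩
    refine le_trans ?_ (measure_mono this)
    rw [Real.volume_Ioo, hle]; simp

lemma lintegral_comp_pseudoInverse {p : ℕ → ℝ} (hp : IsMass p) (φ : ℕ → ENNReal) :
    ∫⁻ a, φ (pseudoInverse p a) ∂unif = ∑' c, φ c * ENNReal.ofReal (p c) := by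
  rw [← lintegral_map (μ := unif) (f := φ) (measurable_of_countable _) (measurable_pseudoInverse p),
    lintegral_countable']
  refine tsum_congr fun c => ?_
  rw [Measure.map_apply (measurable_pseudoInverse p) (measurableSet_singleton c),
    unif_pseudoInverse_eq hp]

/-! ### The uniform choice of an element -/

lemma pick_mem {α : Type*} {S : Finset α} {v : ℝ} {x : α} (h : pick S v = some x) : x ∈ S := by
  unfold pick at h
  exact Finset.mem_toList.1 (List.mem_of_getElem? h)

lemma lintegral_pick_le {α : Type*} {S : Finset α} (hS : S.Nonempty) (φ : Option α → ENNReal) :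
    ∫⁻ b, φ (pick S b) ∂unif ≤ (∑ z ∈ S, φ (some z)) * ENNReal.ofReal (1 / S.card) := by
  have hc : (0 : ℝ) < S.card := by exact_mod_cast hS.card_pos
  have hpt : ∀ᵐ b ∂unif, φ (pick S b) ≤ ∑ k ∈ Finset.range S.card,
      (Set.Ico ((k : ℝ) / S.card) ((k + 1) / S.card)).indicator
        (fun _ => φ (S.toList[k]?)) b := by
    refine ae_unif.mono fun b hb => ?_
    have h0 : 0 ≤ b * S.card := mul_nonneg hb.1.le hc.le
    have hlt : ⌊b * (S.card : ℝ)⌋₊ < S.card := by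
      rw [Nat.floor_lt h0]
      nlinarith [hb.2]
    refine le_trans ?_ (Finset.single_le_sum (fun _ _ => zero_le)
      (Finset.mem_range.2 hlt))
    rw [Set.indicator_of_mem]
    · rfl
    · exact ⟨(div_le_iff₀ hc).2 (Nat.floor_le h0), (lt_div_iff₀ hc).2 (Nat.lt_floor_add_one _)⟩
  refine (lintegral_mono_ae hpt).trans ?_
  rw [lintegral_finsetSum _ fun k _ => measurable_const.indicator measurableSet_Ico]
  have hk : ∀ k ∈ Finset.range S.card, ∫⁻ b, (Set.Ico ((k : ℝ) / S.card)
      ((k + 1) / S.card)).indicator (fun _ => φ (S.toList[k]?)) b ∂unif ≤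
      φ (S.toList[k]?) * ENNReal.ofReal (1 / S.card) := by
    intro k _
    rw [lintegral_indicator measurableSet_Ico, setLIntegral_const]
    refine mul_le_mul_right ?_ _
    refine (Measure.restrict_apply_le _ _).trans ?_
    rw [Real.volume_Ico]
    refine ENNReal.ofReal_le_ofReal (le_of_eq ?_)
    field_simp
    ring
  refine (Finset.sum_le_sum hk).trans ?_
  rw [← Finset.sum_mul]
  refine mul_le_mul_left (le_of_eq ?_) _
  have h1 : ∑ z ∈ S, φ (some z) = (S.toList.map fun z => φ (some z)).sum :=
    (Finset.sum_map_toList S fun z => φ (some z)).symm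
  rw [h1, ← Finset.length_toList S, Finset.sum_range, ← Fin.sum_univ_fun_getElem]
  exact Finset.sum_congr rfl fun k _ => by rw [List.getElem?_eq_getElem k.2]

end

section

variable {n : ℕ}

/-! ### Structure of the exploration -/

lemma children_nodup (i : List ℕ) (c : ℕ) : (children i c).Nodup := by
  refine List.Nodup.map ?_ List.nodup_range
  intro a b h
  simpa using h

lemma mem_children {i x : List ℕ} {c : ℕ} :
    x ∈ children i c ↔ ∃ j ∈ Finset.Icc 1 c, x = i ++ [j] := by
  simp only [children, List.mem_map, List.mem_range, Finset.mem_Icc]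
  constructor
  · rintro ⟨j, hj, rfl⟩
    exact ⟨j + 1, by lia, rfl⟩
  · rintro ⟨j, hj, rfl⟩
    exact ⟨j - 1, by lia, by rw [Nat.sub_add_cancel hj.1]⟩

/-- Number of stubs discovered by traversing a stub with number `a` in the state `s`. -/
def found (own opp : Fin n → ℕ) (s : State n) (a : ℝ) : ℕ := pseudoInverse (nextPmf own opp s) a

/-- The partner of a stub that is traversed in the state `s`. -/
def partner (own opp : Fin n → ℕ) (s : State n) (a b : ℝ) : Option (Σ _ : Fin n, ℕ) :=
  pick (candidates own opp s (found own opp s a)) b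

/-- The state before the stub `i` of the list is traversed. -/
def before (own opp : Fin n → ℕ) (u v : List ℕ → ℝ) : List (List ℕ) → State n → List ℕ → State n
  | [], s, _ => s
  | j :: l, s, i =>
    if i = j then s else before own opp u v l (s.update (partner own opp s (u j) (v j))) i

section
variable (own opp : Fin n → ℕ) (u v : List ℕ → ℝ)

lemma traverse_nil (s : State n) : traverse own opp u v [] s = ([], s) := rfl

lemma traverse_cons (i : List ℕ) (l : List (List ℕ)) (s : State n) :
    traverse own opp u v (i :: l) s =
      (children i (found own opp s (u i)) ++
        (traverse own opp u v l (s.update (partner own opp s (u i) (v i)))).1,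
      (traverse own opp u v l (s.update (partner own opp s (u i) (v i)))).2) := rfl

variable {own opp u v}

lemma traverse_congr {u' v' : List ℕ → ℝ} {l : List (List ℕ)}
    (h : ∀ i ∈ l, u i = u' i ∧ v i = v' i) (s : State n) :
    traverse own opp u v l s = traverse own opp u' v' l s := by
  induction l generalizing s with
  | nil => rfl
  | cons j l ih =>
    have hj := h j (List.mem_cons_self ..)
    rw [traverse_cons, traverse_cons, hj.1, hj.2, ih fun i hi => h i (List.mem_cons_of_mem _ hi)]

lemma before_congr {u' v' : List ℕ → ℝ} {l : List (List ℕ)} {i : List ℕ}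
    (h : ∀ j ∈ l, j ≠ i → u j = u' j ∧ v j = v' j) (s : State n) :
    before own opp u v l s i = before own opp u' v' l s i := by
  induction l generalizing s with
  | nil => rfl
  | cons j l ih =>
    unfold before
    split_ifs with hij
    · rfl
    · have hj := h j (List.mem_cons_self ..) (Ne.symm hij)
      rw [hj.1, hj.2, ih fun k hk => h k (List.mem_cons_of_mem _ hk)]

lemma before_cons_of_ne {i j : List ℕ} (h : i ≠ j) (l : List (List ℕ)) (s : State n) :
    before own opp u v (j :: l) s i =
      before own opp u v l (s.update (partner own opp s (u j) (v j))) i := by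
  rw [before, if_neg h]

lemma before_cons_self (i : List ℕ) (l : List (List ℕ)) (s : State n) :
    before own opp u v (i :: l) s i = s := by
  rw [before, if_pos rfl]

lemma mem_traverse {l : List (List ℕ)} (hl : l.Nodup) {s : State n} {x : List ℕ} :
    x ∈ (traverse own opp u v l s).1 ↔
      ∃ i ∈ l, x ∈ children i (found own opp (before own opp u v l s i) (u i)) := by
  induction l generalizing s with
  | nil => simp [traverse_nil]
  | cons j l ih =>
    rw [List.nodup_cons] at hl
    rw [traverse_cons]
    simp only [List.mem_append, List.mem_cons, exists_eq_or_imp, before_cons_self]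
    rw [ih hl.2]
    refine or_congr Iff.rfl (exists_congr fun i => and_congr_right fun hi => ?_)
    rw [before_cons_of_ne (fun h : i = j => hl.1 (h ▸ hi))]

lemma nodup_traverse {l : List (List ℕ)} (hl : l.Nodup) (s : State n) :
    (traverse own opp u v l s).1.Nodup := by
  induction l generalizing s with
  | nil => simp [traverse_nil]
  | cons j l ih =>
    rw [List.nodup_cons] at hl
    rw [traverse_cons]
    refine List.Nodup.append (children_nodup _ _) (ih hl.2 _) ?_
    intro x hx hx'
    obtain ⟨i, hi, hx'⟩ := (mem_traverse hl.2).1 hx'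
    obtain ⟨a, -, rfl⟩ := mem_children.1 hx
    obtain ⟨b, -, hb⟩ := mem_children.1 hx'
    have : j = i := (List.append_inj hb (by
      have := congrArg List.length hb; simpa using this)).1
    exact hl.1 (this ▸ hi)

/-- Inclusion of states. -/
def State.Le (s t : State n) : Prop := s.active ⊆ t.active ∧ s.paired ⊆ t.paired

lemma State.Le.refl (s : State n) : s.Le s := ⟨subset_rfl, subset_rfl⟩

lemma State.Le.trans {s t r : State n} (h : s.Le t) (h' : t.Le r) : s.Le r :=
  ⟨h.1.trans h'.1, h.2.trans h'.2⟩

lemma State.le_update (s : State n) (o : Option (Σ _ : Fin n, ℕ)) : s.Le (s.update o) := by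
  cases o with
  | none => exact .refl s
  | some x => exact ⟨Finset.subset_insert _ _, Finset.subset_insert _ _⟩

lemma le_traverse (l : List (List ℕ)) (s : State n) : s.Le (traverse own opp u v l s).2 := by
  induction l generalizing s with
  | nil => exact .refl s
  | cons j l ih => exact (s.le_update _).trans (ih _)

lemma le_before (l : List (List ℕ)) (s : State n) (i : List ℕ) :
    s.Le (before own opp u v l s i) := by
  induction l generalizing s with
  | nil => exact .refl s
  | cons j l ih =>
    unfold before
    split_ifs
    · exact .refl s
    · exact (s.le_update _).trans (ih _)

lemma before_le_traverse (l : List (List ℕ)) (s : State n) (i : List ℕ) :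
    (before own opp u v l s i).Le (traverse own opp u v l s).2 := by
  induction l generalizing s with
  | nil => exact .refl s
  | cons j l ih =>
    unfold before
    split_ifs
    · exact le_traverse _ _
    · exact ih _

/-- A property of states that is kept when a stub is traversed. -/
lemma before_induction {p : State n → Prop}
    (hp : ∀ s a b, p s → p (s.update (partner own opp s a b))) (l : List (List ℕ)) {s : State n}
    (hs : p s) (i : List ℕ) : p (before own opp u v l s i) := by
  induction l generalizing s with
  | nil => exact hs
  | cons j l ih =>
    unfold before
    split_ifs
    · exact hs
    · exact ih (hp _ _ _ hs)

lemma traverse_induction {p : State n → Prop}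
    (hp : ∀ s a b, p s → p (s.update (partner own opp s a b))) (l : List (List ℕ)) {s : State n}
    (hs : p s) : p (traverse own opp u v l s).2 := by
  induction l generalizing s with
  | nil => exact hs
  | cons j l ih => exact ih (hp _ _ _ hs)

lemma traverse_potential {Y : State n → ENNReal} {w : State n → Option (Σ _ : Fin n, ℕ) → ENNReal}
    (hY : ∀ s o, Y (s.update o) ≤ Y s + w s o) {l : List (List ℕ)} (hl : l.Nodup) (s : State n) :
    Y (traverse own opp u v l s).2 ≤ Y s + ∑ i ∈ l.toFinset,
      w (before own opp u v l s i)
        (partner own opp (before own opp u v l s i) (u i) (v i)) := by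
  induction l generalizing s with
  | nil => simp [traverse_nil]
  | cons j l ih =>
    rw [List.nodup_cons] at hl
    rw [traverse_cons, List.toFinset_cons, Finset.sum_insert (by simpa using hl.1),
      before_cons_self, ← add_assoc]
    refine (ih hl.2 _).trans (add_le_add (hY _ _) (le_of_eq ?_))
    refine Finset.sum_congr rfl fun i hi => ?_
    rw [before_cons_of_ne]
    rintro rfl
    exact hl.1 (by simpa using hi)

/-! ### Generations -/

lemma explore_succ_succ (m : ℕ) : explore own opp u v (m + 2) =
    traverse own opp u v (explore own opp u v (m + 1)).1 (explore own opp u v (m + 1)).2 := rfl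

lemma nodup_explore (m : ℕ) : (explore own opp u v m).1.Nodup := by
  induction m with
  | zero => simp [explore]
  | succ m ih =>
    cases m with
    | zero => exact children_nodup _ _
    | succ m => exact nodup_traverse ih _

lemma length_of_mem_explore {m : ℕ} {i : List ℕ} (hi : i ∈ (explore own opp u v m).1) :
    i.length = m := by
  induction m generalizing i with
  | zero => simp [explore] at hi; simp [hi]
  | succ m ih =>
    cases m with
    | zero =>
      obtain ⟨j, -, rfl⟩ := mem_children.1 hi
      simp
    | succ m =>
      obtain ⟨k, hk, hi⟩ := (mem_traverse (nodup_explore (m + 1))).1 hi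
      obtain ⟨j, -, rfl⟩ := mem_children.1 hi
      simp [ih hk]

lemma mem_graphGen {m : ℕ} {i : List ℕ} :
    i ∈ graphGen own opp u v m ↔ i ∈ (explore own opp u v m).1 := by simp [graphGen]

lemma explore_congr {u' v' : List ℕ → ℝ} {m : ℕ}
    (h : ∀ i : List ℕ, i.length < m → u i = u' i ∧ v i = v' i) :
    explore own opp u v m = explore own opp u' v' m := by
  induction m with
  | zero => rfl
  | succ m ih =>
    cases m with
    | zero =>
      have := h [] (by simp)
      have hr : rootDegree own u = rootDegree own u' := by rw [rootDegree, rootDegree, this.1]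
      simp only [explore, startState]
      rw [hr, this.2]
    | succ m =>
      rw [explore_succ_succ, explore_succ_succ, ih fun i hi => h i (by lia)]
      exact traverse_congr (fun i hi => h i (by rw [length_of_mem_explore hi]; lia)) _

/-- The state of the exploration before the stub `i` of generation `m` is traversed. -/
def stateAt (own opp : Fin n → ℕ) (u v : List ℕ → ℝ) (m : ℕ) (i : List ℕ) : State n :=
  before own opp u v (explore own opp u v m).1 (explore own opp u v m).2 i

lemma stateAt_congr {u' v' : List ℕ → ℝ} {m : ℕ} {i : List ℕ} (hi : i.length = m)
    (h : ∀ j : List ℕ, j ≠ i → u j = u' j ∧ v j = v' j) :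
    stateAt own opp u v m i = stateAt own opp u' v' m i := by
  unfold stateAt
  rw [explore_congr (m := m) fun j hj => h j fun e => by rw [e] at hj; lia]
  exact before_congr (fun j _ hj => h j hj) _

lemma mem_graphGen_succ_succ {m : ℕ} {x : List ℕ} :
    x ∈ graphGen own opp u v (m + 2) ↔ ∃ i ∈ graphGen own opp u v (m + 1),
      x ∈ children i (found own opp (stateAt own opp u v (m + 1) i) (u i)) := by
  rw [mem_graphGen, explore_succ_succ, mem_traverse (nodup_explore _)]
  simp only [mem_graphGen, stateAt]

lemma graphGen_one : graphGen own opp u v 1 = (children [] (rootDegree own u)).toFinset := rfl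

variable {g f : PMF ℕ}

lemma mem_treeGen_succ {m : ℕ} {x : List ℕ} :
    x ∈ treeGen g f u (m + 1) ↔
      ∃ i ∈ treeGen g f u m, x ∈ children i (treeOffspring g f u i) := by
  simp only [treeGen, Finset.mem_biUnion, Finset.mem_image, mem_children, eq_comm]

lemma length_of_mem_treeGen {m : ℕ} {i : List ℕ} (hi : i ∈ treeGen g f u m) : i.length = m := by
  induction m generalizing i with
  | zero => simp [treeGen] at hi; simp [hi]
  | succ m ih =>
    obtain ⟨k, hk, hi⟩ := mem_treeGen_succ.1 hi
    obtain ⟨j, -, rfl⟩ := mem_children.1 hi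
    simp [ih hk]

lemma treeGen_congr {u' : List ℕ → ℝ} {m : ℕ} (h : ∀ i : List ℕ, i.length < m → u i = u' i) :
    treeGen g f u m = treeGen g f u' m := by
  induction m with
  | zero => rfl
  | succ m ih =>
    ext x
    rw [mem_treeGen_succ, mem_treeGen_succ, ih fun i hi => h i (by lia)]
    refine exists_congr fun i => and_congr_right fun hi => ?_
    rw [treeOffspring, treeOffspring, h i (by rw [length_of_mem_treeGen hi]; lia)]

lemma card_children (i : List ℕ) (c : ℕ) : (children i c).toFinset.card = c := by
  rw [List.toFinset_card_of_nodup (children_nodup i c)]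
  simp [children]

/-- Children of different stubs are different. -/
lemma eq_of_mem_children {i j x : List ℕ} {a b : ℕ} (hi : x ∈ children i a)
    (hj : x ∈ children j b) : i = j := by
  obtain ⟨c, -, rfl⟩ := mem_children.1 hi
  obtain ⟨d, -, hb⟩ := mem_children.1 hj
  exact (List.append_inj hb (by have := congrArg List.length hb; simpa using this)).1

lemma card_sdiff_le {A B A' B' : Finset (List ℕ)} {p q : List ℕ → ℕ}
    (hA : ∀ x, x ∈ A' ↔ ∃ i ∈ A, x ∈ children i (p i))
    (hB : ∀ x, x ∈ B' ↔ ∃ i ∈ B, x ∈ children i (q i)) :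
    (A' \ B').card ≤ ∑ i ∈ A \ B, p i + ∑ i ∈ A ∩ B, (p i - q i) := by
  have hsub : A' \ B' ⊆ ((A \ B).biUnion fun i => (children i (p i)).toFinset) ∪
      ((A ∩ B).biUnion fun i => (children i (p i)).toFinset \ (children i (q i)).toFinset) := by
    intro x hx
    rw [Finset.mem_sdiff, hA, hB] at hx
    obtain ⟨⟨i, hi, hxi⟩, hx2⟩ := hx
    push Not at hx2
    rw [Finset.mem_union, Finset.mem_biUnion, Finset.mem_biUnion]
    by_cases hiB : i ∈ B
    · exact Or.inr ⟨i, Finset.mem_inter.2 ⟨hi, hiB⟩, by simpa [hxi] using hx2 i hiB⟩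
    · exact Or.inl ⟨i, Finset.mem_sdiff.2 ⟨hi, hiB⟩, by simpa using hxi⟩
  refine (Finset.card_le_card hsub).trans ((Finset.card_union_le _ _).trans ?_)
  refine add_le_add (Finset.card_biUnion_le.trans ?_) (Finset.card_biUnion_le.trans ?_)
  · exact Finset.sum_le_sum fun i _ => (card_children _ _).le
  · refine Finset.sum_le_sum fun i _ => ?_
    have : (children i (p i)).toFinset \ (children i (q i)).toFinset ⊆
        (Finset.Ioc (q i) (p i)).image fun j => i ++ [j] := by
      intro x hx
      simp only [Finset.mem_sdiff, List.mem_toFinset, mem_children, Finset.mem_Icc] at hx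
      obtain ⟨⟨j, hj, rfl⟩, h2⟩ := hx
      refine Finset.mem_image.2 ⟨j, Finset.mem_Ioc.2 ⟨?_, hj.2⟩, rfl⟩
      by_contra hcon
      exact h2 ⟨j, ⟨hj.1, by lia⟩, rfl⟩
    refine (Finset.card_le_card this).trans (Finset.card_image_le.trans ?_)
    simp

lemma card_le_of_children {A A' : Finset (List ℕ)} {p : List ℕ → ℕ}
    (hA : ∀ x, x ∈ A' ↔ ∃ i ∈ A, x ∈ children i (p i)) : A'.card = ∑ i ∈ A, p i := by
  have : A' = A.biUnion fun i => (children i (p i)).toFinset := by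
    ext x; simp [hA]
  rw [this, Finset.card_biUnion]
  · exact Finset.sum_congr rfl fun i _ => card_children _ _
  · intro i _ j _ hij
    rw [Function.onFun, Finset.disjoint_left]
    intro x hx hx'
    exact hij (eq_of_mem_children (by simpa using hx) (by simpa using hx'))

end

/-! ### Measurability -/

instance : MeasurableSpace (State n) := ⊤
instance : MeasurableSpace (List (List ℕ)) := ⊤
instance : MeasurableSpace (Finset (List ℕ)) := ⊤
instance : MeasurableSpace (Option (Σ _ : Fin n, ℕ)) := ⊤
instance : DiscreteMeasurableSpace (State n) := ⟨fun _ => trivial⟩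
instance : DiscreteMeasurableSpace (List (List ℕ)) := ⟨fun _ => trivial⟩
instance : DiscreteMeasurableSpace (Finset (List ℕ)) := ⟨fun _ => trivial⟩
instance : DiscreteMeasurableSpace (Option (Σ _ : Fin n, ℕ)) := ⟨fun _ => trivial⟩
instance : Countable (State n) :=
  Function.Injective.countable (f := fun s : State n => (s.active, s.paired)) (by
    rintro ⟨a, b⟩ ⟨c, d⟩ h; simpa using h)

lemma measurable_pick {α : Type*} [MeasurableSpace (Option α)] (S : Finset α) :
    Measurable (pick S) := by
  unfold pick
  have h : Measurable fun v : ℝ => ⌊v * (S.card : ℝ)⌋₊ :=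
    Nat.measurable_floor.comp (measurable_id.mul_const _)
  exact (measurable_of_countable fun k : ℕ => S.toList[k]?).comp h

variable (own opp : Fin n → ℕ)

lemma measurable_found (s : State n) : Measurable (found own opp s) :=
  measurable_pseudoInverse _

lemma measurable_partner (s : State n) :
    Measurable fun z : ℝ × ℝ => partner own opp s z.1 z.2 := by
  have h : Measurable fun y : ℕ × ℝ => pick (candidates own opp s y.1) y.2 :=
    measurable_from_prod_countable_right fun c => measurable_pick (candidates own opp s c)
  exact h.comp (((measurable_found own opp s).comp measurable_fst).prodMk measurable_snd)

lemma measurable_of_countable_param {α β γ : Type*} [MeasurableSpace α] [MeasurableSpace β]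
    [MeasurableSpace γ] [Countable β] [MeasurableSingletonClass β] {F : α → β → γ} {h : α → β}
    (hF : ∀ b, Measurable fun x => F x b) (hh : Measurable h) : Measurable fun x => F x (h x) :=
  (measurable_from_prod_countable_left (f := fun z : α × β => F z.1 z.2) hF).comp
    (measurable_id.prodMk hh)

lemma measurable_step (i : List ℕ) (s : State n) : Measurable fun x : Input =>
    s.update (partner own opp s (x (Sum.inl i)) (x (Sum.inr i))) :=
  (measurable_of_countable s.update).comp ((measurable_partner own opp s).comp
    (f := fun x : Input => (x (Sum.inl i), x (Sum.inr i))) (by fun_prop))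

lemma measurable_traverse (l : List (List ℕ)) (s : State n) : Measurable fun x : Input =>
    traverse own opp (fun i => x (Sum.inl i)) (fun i => x (Sum.inr i)) l s := by
  induction l generalizing s with
  | nil => exact measurable_const
  | cons j l ih =>
    have h1 := measurable_of_countable_param ih (measurable_step own opp j s)
    have h2 : Measurable fun x : Input => children j (found own opp s (x (Sum.inl j))) :=
      (measurable_of_countable (children j)).comp
        ((measurable_found own opp s).comp (measurable_pi_apply _))
    exact (measurable_of_countable
      fun z : List (List ℕ) × (List (List ℕ) × State n) => (z.1 ++ z.2.1, z.2.2)).comp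
      (h2.prodMk h1)

lemma measurable_before (l : List (List ℕ)) (s : State n) (i : List ℕ) :
    Measurable fun x : Input =>
      before own opp (fun i => x (Sum.inl i)) (fun i => x (Sum.inr i)) l s i := by
  induction l generalizing s with
  | nil => exact measurable_const
  | cons j l ih =>
    unfold before
    split_ifs
    · exact measurable_const
    · exact measurable_of_countable_param (F := fun (x : Input) (t : State n) =>
        before own opp (fun i => x (Sum.inl i)) (fun i => x (Sum.inr i)) l t i) ih
        (measurable_step own opp j s)

lemma measurable_explore (m : ℕ) : Measurable fun x : Input =>
    explore own opp (fun i => x (Sum.inl i)) (fun i => x (Sum.inr i)) m := by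
  induction m with
  | zero => exact measurable_const
  | succ m ih =>
    cases m with
    | zero =>
      have h : Measurable fun x : Input => rootDegree own (fun i => x (Sum.inl i)) :=
        (measurable_pseudoInverse _).comp (measurable_pi_apply _)
      have h2 : Measurable fun x : Input =>
          startState own (fun i => x (Sum.inl i)) (fun i => x (Sum.inr i)) := by
        let _ : MeasurableSpace (Option (Fin n)) := ⊤
        have _ : DiscreteMeasurableSpace (Option (Fin n)) := ⟨fun _ => trivial⟩
        have h3 : Measurable fun x : Input =>
            pick (Finset.univ.filter fun r => own r = rootDegree own (fun i => x (Sum.inl i)))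
              (x (Sum.inr [])) :=
          measurable_of_countable_param
            (F := fun (x : Input) c => pick (Finset.univ.filter fun r => own r = c) (x (Sum.inr [])))
            (fun c => (measurable_pick _).comp (measurable_pi_apply _)) h
        exact (measurable_of_countable fun o : Option (Fin n) =>
          (⟨o.toFinset, ∅⟩ : State n)).comp h3
      exact ((measurable_of_countable (children [])).comp h).prodMk h2
    | succ m =>
      exact measurable_of_countable_param (F := fun (x : Input) (z : List (List ℕ) × State n) =>
        traverse own opp (fun i => x (Sum.inl i)) (fun i => x (Sum.inr i)) z.1 z.2)
        (fun z => measurable_traverse own opp z.1 z.2) ih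

lemma measurable_graphGen (m : ℕ) : Measurable fun x : Input =>
    graphGen own opp (fun i => x (Sum.inl i)) (fun i => x (Sum.inr i)) m :=
  (measurable_of_countable fun z : List (List ℕ) × State n => z.1.toFinset).comp
    (measurable_explore own opp m)

lemma measurable_stateAt (m : ℕ) (i : List ℕ) : Measurable fun x : Input =>
    stateAt own opp (fun i => x (Sum.inl i)) (fun i => x (Sum.inr i)) m i :=
  measurable_of_countable_param (F := fun (x : Input) (z : List (List ℕ) × State n) =>
    before own opp (fun i => x (Sum.inl i)) (fun i => x (Sum.inr i)) z.1 z.2 i)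
    (fun z => measurable_before own opp z.1 z.2 i) (measurable_explore own opp m)

lemma measurable_treeOffspring (g f : PMF ℕ) (i : List ℕ) :
    Measurable fun x : Input => treeOffspring g f (fun i => x (Sum.inl i)) i := by
  unfold treeOffspring
  split_ifs
  · exact (measurable_pseudoInverse _).comp (measurable_pi_apply _)
  · exact (measurable_pseudoInverse _).comp (measurable_pi_apply _)

lemma measurable_treeGen (g f : PMF ℕ) (m : ℕ) :
    Measurable fun x : Input => treeGen g f (fun i => x (Sum.inl i)) m := by
  induction m with
  | zero => exact measurable_const
  | succ m ih =>
    refine measurable_of_countable_param (F := fun (x : Input) (A : Finset (List ℕ)) =>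
      A.biUnion fun i => (Finset.Icc 1 (treeOffspring g f (fun i => x (Sum.inl i)) i)).image
        fun j => i ++ [j]) (fun A => ?_) ih
    induction A using Finset.induction_on with
    | empty => simp
    | insert i A hi ih =>
      simp only [Finset.biUnion_insert]
      have h2 : Measurable fun x : Input =>
          (Finset.Icc 1 (treeOffspring g f (fun i => x (Sum.inl i)) i)).image fun j => i ++ [j] :=
        (measurable_of_countable fun c : ℕ => (Finset.Icc 1 c).image fun j => i ++ [j]).comp
          (measurable_treeOffspring g f i)
      exact (measurable_of_countable
        fun z : Finset (List ℕ) × Finset (List ℕ) => z.1 ∪ z.2).comp (h2.prodMk ih)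

lemma measurableSet_isClose (g f : PMF ℕ) (γ : ℝ) (k : ℕ) :
    MeasurableSet {x : Input |
      IsClose own opp g f γ k (fun i => x (Sum.inl i)) (fun i => x (Sum.inr i))} := by
  simp only [IsClose, Set.ofPred_forall]
  refine MeasurableSet.biInter (Set.to_countable _) fun m _ => ?_
  exact ((measurable_treeGen g f m).prodMk (measurable_graphGen own opp m))
    (.of_discrete (s := {z : Finset (List ℕ) × Finset (List ℕ) |
      ((z.1 \ z.2).card : ℝ) ≤ (z.1.card : ℝ) * (n : ℝ) ^ (-γ) ∧
      ((z.2 \ z.1).card : ℝ) ≤ (z.1.card : ℝ) * (n : ℝ) ^ (-γ)}))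

end

section

variable {n : ℕ}

/-! ### One step of the exploration -/

/-- Total number of stubs. -/
def total (opp : Fin n → ℕ) : ℝ := ((∑ r : Fin n, opp r : ℕ) : ℝ)

/-- Every paired stub belongs to an active node. -/
def State.Valid (opp : Fin n → ℕ) (s : State n) : Prop :=
  ∀ x ∈ s.paired, x.1 ∈ s.active ∧ x.2 < opp x.1

variable (own opp : Fin n → ℕ)

lemma valid_update {s : State n} (hs : s.Valid opp) (a b : ℝ) :
    (s.update (partner own opp s a b)).Valid opp := by
  cases h : partner own opp s a b with
  | none => exact hs
  | some x =>
    have hx := pick_mem h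
    simp only [candidates, allStubs, Finset.mem_filter, Finset.mem_sigma, Finset.mem_univ,
      true_and, Finset.mem_range] at hx
    intro y hy
    simp only [State.update, Finset.mem_insert] at hy ⊢
    rcases hy with rfl | hy
    · exact ⟨Or.inl rfl, hx.1⟩
    · exact ⟨Or.inr (hs y hy).1, (hs y hy).2⟩

variable {own opp}

lemma State.Valid.card_paired_le {s : State n} (hs : s.Valid opp) :
    (s.paired.card : ℝ) ≤ ∑ r, if r ∈ s.active then (opp r : ℝ) else 0 := by
  have : s.paired ⊆ s.active.sigma fun r => Finset.range (opp r) := by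
    intro x hx
    simpa using hs x hx
  have h := Finset.card_le_card this
  rw [Finset.card_sigma] at h
  rw [← Finset.sum_filter]
  simp only [Finset.card_range] at h
  simpa using (by exact_mod_cast h : (s.paired.card : ℝ) ≤ ∑ r ∈ s.active, (opp r : ℝ))

lemma State.Valid.activeUnpaired_nonneg {s : State n} (hs : s.Valid opp) :
    0 ≤ activeUnpaired opp s := by
  have h := hs.card_paired_le
  have h2 : ((∑ r : Fin n, opp r : ℕ) : ℝ) = (∑ r, if r ∈ s.active then (opp r : ℝ) else 0) +
      ∑ r, if r ∈ s.active then (0 : ℝ) else (opp r : ℝ) := by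
    rw [← Finset.sum_add_distrib]
    push_cast
    exact Finset.sum_congr rfl fun r _ => by split_ifs <;> simp
  unfold activeUnpaired
  linarith

/-- Probability that more than `k` stubs are discovered. -/
def tail (own opp : Fin n → ℕ) (s : State n) (k : ℕ) : ℝ :=
  ∑ r, if k < own r then (1 / (total opp - s.paired.card)) *
    (if r ∈ s.active then 0 else (opp r : ℝ)) else 0

lemma one_sub_cum_nextPmf {s : State n} (hT : (s.paired.card : ℝ) < total opp) (k : ℕ) :
    1 - cum (nextPmf own opp s) k = tail own opp s k := by
  have hpos : 0 < total opp - s.paired.card := by linarith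
  have h1 : ∑ t ∈ Finset.range (k + 1), (∑ r : Fin n,
      if own r = t ∧ r ∉ s.active then (opp r : ℝ) else 0) =
      ∑ r : Fin n, if k < own r then 0 else (if r ∈ s.active then 0 else (opp r : ℝ)) := by
    rw [Finset.sum_comm]
    refine Finset.sum_congr rfl fun r _ => ?_
    by_cases hr : r ∈ s.active
    · simp [hr]
    · by_cases hk : k < own r
      · simp only [hr, not_false_eq_true, and_true, hk, if_true]
        refine Finset.sum_eq_zero fun t ht => if_neg fun h => ?_
        have := Finset.mem_range.1 ht
        lia
      · simp only [hr, not_false_eq_true, and_true, hk, if_false]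
        rw [Finset.sum_ite_eq]
        simp; lia
  have h2 : ∑ t ∈ Finset.range (k + 1), (if t = 0 then activeUnpaired opp s else 0) =
      activeUnpaired opp s := by
    rw [Finset.sum_ite_eq']; simp
  have h3 : (∑ r, if k < own r then (if r ∈ s.active then 0 else (opp r : ℝ)) else 0) +
      (∑ r : Fin n, if k < own r then 0 else (if r ∈ s.active then 0 else (opp r : ℝ))) =
      ∑ r : Fin n, (if r ∈ s.active then 0 else (opp r : ℝ)) := by
    rw [← Finset.sum_add_distrib]
    exact Finset.sum_congr rfl fun r _ => by split_ifs <;> simp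
  have h4 : tail own opp s k = (1 / (total opp - s.paired.card)) *
      ∑ r, if k < own r then (if r ∈ s.active then 0 else (opp r : ℝ)) else 0 := by
    rw [tail, Finset.mul_sum]
    exact Finset.sum_congr rfl fun r _ => by split_ifs <;> simp
  rw [h4]
  unfold cum nextPmf
  rw [← Finset.mul_sum, Finset.sum_add_distrib, h1, h2]
  change 1 - 1 / (total opp - s.paired.card) * _ = _
  rw [activeUnpaired]
  change 1 - 1 / (total opp - s.paired.card) * (_ + (total opp - _ - _)) = _
  rw [← h3]
  field_simp
  ring

lemma isMass_nextPmf {s : State n} (hs : s.Valid opp) (hT : (s.paired.card : ℝ) < total opp) :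
    IsMass (nextPmf own opp s) := by
  have hpos : 0 < total opp - s.paired.card := by linarith
  have hnn : ∀ t, 0 ≤ nextPmf own opp s t := by
    intro t
    refine mul_nonneg (one_div_nonneg.2 hpos.le) (add_nonneg (Finset.sum_nonneg fun r _ => ?_) ?_)
    · split_ifs <;> positivity
    · split_ifs
      · exact hs.activeUnpaired_nonneg
      · exact le_rfl
  refine ⟨hnn, (hasSum_iff_tendsto_nat_of_nonneg hnn 1).2 ?_⟩
  rw [← Filter.tendsto_add_atTop_iff_nat 1]
  refine tendsto_const_nhds.congr' ?_
  filter_upwards [Filter.eventually_ge_atTop (∑ r, own r)] with k hk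
  have h := one_sub_cum_nextPmf (own := own) hT k
  have h0 : tail own opp s k = 0 := by
    refine Finset.sum_eq_zero fun r hr => if_neg fun h => ?_
    have := Finset.single_le_sum (f := own) (fun _ _ => Nat.zero_le _) hr
    lia
  rw [h0] at h
  change 1 = cum (nextPmf own opp s) k
  linarith

lemma tsum_tail (own : Fin n → ℕ) {c : Fin n → ℝ} (hc : ∀ r, 0 ≤ c r) :
    ∑' k, ENNReal.ofReal (∑ r, if k < own r then c r else 0) =
      ENNReal.ofReal (∑ r, own r * c r) := by
  have h1 : ∀ k, ENNReal.ofReal (∑ r, if k < own r then c r else 0) =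
      ∑ r, (if k < own r then 1 else 0) * ENNReal.ofReal (c r) := by
    intro k
    rw [ENNReal.ofReal_sum_of_nonneg fun r _ => by split_ifs; exacts [hc r, le_rfl]]
    exact Finset.sum_congr rfl fun r _ => by split_ifs <;> simp
  simp_rw [h1]
  rw [Summable.tsum_finsetSum fun _ _ => ENNReal.summable,
    ENNReal.ofReal_sum_of_nonneg fun r _ => mul_nonneg (Nat.cast_nonneg _) (hc r)]
  refine Finset.sum_congr rfl fun r _ => ?_
  rw [ENNReal.tsum_mul_right, ← natCast_eq_tsum, ENNReal.ofReal_mul (Nat.cast_nonneg _)]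
  simp

lemma sum_own_mul_le {s : State n} (hT : (s.paired.card : ℝ) < total opp) :
    ∑ r, (own r : ℝ) * ((1 / (total opp - s.paired.card)) *
      (if r ∈ s.active then 0 else (opp r : ℝ))) ≤
      (1 / (total opp - s.paired.card)) * ∑ r, (own r : ℝ) * opp r := by
  have hpos : 0 < total opp - s.paired.card := by linarith
  rw [Finset.mul_sum]
  refine Finset.sum_le_sum fun r _ => ?_
  rw [mul_left_comm]
  refine mul_le_mul_of_nonneg_left (mul_le_mul_of_nonneg_left ?_ (Nat.cast_nonneg _))
    (one_div_nonneg.2 hpos.le)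
  split_ifs <;> simp

lemma lintegral_found_le {s : State n} (hs : s.Valid opp)
    (hT : (s.paired.card : ℝ) < total opp) :
    ∫⁻ a, (found own opp s a : ENNReal) ∂unif ≤
      ENNReal.ofReal ((1 / (total opp - s.paired.card)) * ∑ r, (own r : ℝ) * opp r) := by
  have hpos : 0 < total opp - s.paired.card := by linarith
  unfold found
  rw [lintegral_pseudoInverse (isMass_nextPmf hs hT)]
  simp_rw [one_sub_cum_nextPmf hT, tail]
  rw [tsum_tail own fun r => ?_]
  · exact ENNReal.ofReal_le_ofReal (sum_own_mul_le hT)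
  · refine mul_nonneg (one_div_nonneg.2 hpos.le) ?_
    split_ifs <;> positivity

lemma sizeBiased_eq (own opp : Fin n → ℕ) : sizeBiased own opp = nextPmf own opp ⟨∅, ∅⟩ := by
  funext t
  simp [sizeBiased, nextPmf, activeUnpaired]

lemma empirical_eq (own : Fin n → ℕ) : empirical own = sizeBiased own fun _ => 1 := by
  funext t
  simp [sizeBiased, empirical]

lemma valid_empty : State.Valid opp (⟨∅, ∅⟩ : State n) := by
  intro x hx; simp at hx

lemma isMass_sizeBiased (h : 0 < total opp) : IsMass (sizeBiased own opp) := by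
  rw [sizeBiased_eq]
  exact isMass_nextPmf valid_empty (by simpa using h)

lemma isMass_empirical (h : 0 < n) : IsMass (empirical own) := by
  rw [empirical_eq]
  exact isMass_sizeBiased (by simpa [total] using h)

lemma one_sub_cum_sizeBiased (h : 0 < total opp) (k : ℕ) :
    1 - cum (sizeBiased own opp) k = ∑ r, if k < own r then (1 / total opp) * opp r else 0 := by
  rw [sizeBiased_eq, one_sub_cum_nextPmf (by simpa using h), tail]
  simp

lemma tsum_one_sub_cum_sizeBiased (h : 0 < total opp) :
    ∑' k, ENNReal.ofReal (1 - cum (sizeBiased own opp) k) =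
      ENNReal.ofReal ((1 / total opp) * ∑ r, (own r : ℝ) * opp r) := by
  simp_rw [one_sub_cum_sizeBiased h]
  rw [tsum_tail own fun r => by positivity, Finset.mul_sum]
  congr 1
  exact Finset.sum_congr rfl fun r _ => by ring

lemma tsum_one_sub_cum_empirical (h : 0 < n) :
    ∑' k, ENNReal.ofReal (1 - cum (empirical own) k) = ENNReal.ofReal (total own / n) := by
  rw [empirical_eq, tsum_one_sub_cum_sizeBiased (by simpa [total] using h)]
  congr 1
  simp [total]
  ring

lemma dist1_nextPmf_sizeBiased {s : State n} (hT : (s.paired.card : ℝ) < total opp) :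
    dist1 (nextPmf own opp s) (sizeBiased own opp) ≤
      ENNReal.ofReal ((s.paired.card / (total opp - s.paired.card)) *
          ((1 / total opp) * ∑ r, (own r : ℝ) * opp r) +
        (1 / total opp) * ∑ r, if r ∈ s.active then (own r : ℝ) * opp r else 0) := by
  have hpos : 0 < total opp - s.paired.card := by linarith
  have hT0 : (0 : ℝ) ≤ s.paired.card := Nat.cast_nonneg _
  have hL : 0 < total opp := by linarith
  set T : ℝ := (s.paired.card : ℝ) with hTdef
  set L := total opp with hLdef
  have hTL : 0 ≤ T / (L - T) * (1 / L) := by positivity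
  set c : Fin n → ℝ := fun r => T / (L - T) * (1 / L) * opp r +
    (1 / L) * (if r ∈ s.active then (opp r : ℝ) else 0) with hc
  have hc0 : ∀ r, 0 ≤ c r := by
    intro r
    simp only [hc]
    refine add_nonneg (mul_nonneg hTL (Nat.cast_nonneg _)) (mul_nonneg (by positivity) ?_)
    split_ifs <;> positivity
  rw [dist1_eq]
  have hk : ∀ k, ENNReal.ofReal |cum (nextPmf own opp s) k - cum (sizeBiased own opp) k| ≤
      ENNReal.ofReal (∑ r, if k < own r then c r else 0) := by
    intro k
    refine ENNReal.ofReal_le_ofReal ?_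
    have h1 := one_sub_cum_nextPmf (own := own) hT k
    have h2 := one_sub_cum_sizeBiased (own := own) hL k
    have : cum (nextPmf own opp s) k - cum (sizeBiased own opp) k =
        ∑ r, if k < own r then (1 / L) * (opp r : ℝ) - 1 / (L - T) *
          (if r ∈ s.active then 0 else (opp r : ℝ)) else 0 := by
      rw [show cum (nextPmf own opp s) k - cum (sizeBiased own opp) k =
        (1 - cum (sizeBiased own opp) k) - (1 - cum (nextPmf own opp s) k) by ring, h1, h2, tail,
        ← Finset.sum_sub_distrib]
      exact Finset.sum_congr rfl fun r _ => by split_ifs <;> simp [hLdef, hTdef]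
    rw [this]
    refine (Finset.abs_sum_le_sum_abs _ _).trans (Finset.sum_le_sum fun r _ => ?_)
    have hid : T / (L - T) * (1 / L) = 1 / (L - T) - 1 / L := by field_simp; ring
    have ho : (0 : ℝ) ≤ opp r := Nat.cast_nonneg _
    by_cases hkr : k < own r
    · by_cases hr : r ∈ s.active
      · simp only [hkr, hr, if_true, mul_zero, sub_zero, hc]
        rw [abs_of_nonneg (by positivity)]
        nlinarith [mul_nonneg hTL ho]
      · simp only [hkr, hr, if_true, if_false, mul_zero, add_zero, hc]
        rw [← sub_mul, abs_mul, abs_of_nonneg ho, abs_sub_comm, ← hid, abs_of_nonneg hTL]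
    · simp [hkr]
  refine (ENNReal.tsum_le_tsum hk).trans ?_
  rw [tsum_tail own hc0]
  refine ENNReal.ofReal_le_ofReal (le_of_eq ?_)
  simp only [hc]
  rw [Finset.mul_sum, Finset.mul_sum, Finset.mul_sum, ← Finset.sum_add_distrib]
  refine Finset.sum_congr rfl fun r _ => ?_
  split_ifs <;> ring

/-! ### Weights of the active nodes -/

/-- Total weight of the active nodes. -/
def weight (w : Fin n → ℝ) (s : State n) : ENNReal := ∑ r ∈ s.active, ENNReal.ofReal (w r)

/-- Weight of the node of a stub, if it is inactive. -/
def newWeight (w : Fin n → ℝ) (s : State n) : Option (Σ _ : Fin n, ℕ) → ENNReal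
  | none => 0
  | some x => if x.1 ∈ s.active then 0 else ENNReal.ofReal (w x.1)

lemma weight_update_le (w : Fin n → ℝ) (s : State n) (o : Option (Σ _ : Fin n, ℕ)) :
    weight w (s.update o) ≤ weight w s + newWeight w s o := by
  cases o with
  | none => simp [State.update, newWeight]
  | some x =>
    simp only [weight, State.update, newWeight]
    by_cases hx : x.1 ∈ s.active
    · simp [hx]
    · rw [Finset.sum_insert hx, if_neg hx, add_comm]

lemma candidates_subset {s : State n} {c : ℕ} (hc : c ≠ 0) : candidates own opp s c ⊆
    (Finset.univ.filter fun r => own r = c).sigma fun r => Finset.range (opp r) := by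
  intro x hx
  simp only [candidates, allStubs, Finset.mem_filter, Finset.mem_sigma, Finset.mem_univ,
    true_and, hc, and_false, or_false] at hx ⊢
  exact ⟨hx.2.2.2, hx.1⟩

lemma nextPmf_le_card {s : State n} (hs : s.Valid opp)
    (hT : (s.paired.card : ℝ) < total opp) {c : ℕ} (hc : c ≠ 0) :
    nextPmf own opp s c ≤ (1 / (total opp - s.paired.card)) * (candidates own opp s c).card := by
  have hpos : 0 < total opp - s.paired.card := by linarith
  unfold nextPmf
  rw [if_neg hc, add_zero]
  refine mul_le_mul_of_nonneg_left ?_ (one_div_nonneg.2 hpos.le)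
  rw [← Finset.sum_filter]
  have hsub : ((Finset.univ.filter fun r => own r = c ∧ r ∉ s.active).sigma
      fun r => Finset.range (opp r)) ⊆ candidates own opp s c := by
    intro x hx
    simp only [candidates, allStubs, Finset.mem_filter, Finset.mem_sigma, Finset.mem_univ,
      true_and, hc, and_false, or_false] at hx ⊢
    exact ⟨hx.2, fun h => hx.1.2 (hs x h).1, hx.1.2, hx.1.1⟩
  have h := Finset.card_le_card hsub
  rw [Finset.card_sigma] at h
  simp only [Finset.card_range] at h
  exact_mod_cast h

lemma lintegral_newWeight_le {s : State n} (hs : s.Valid opp)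
    (hT : (s.paired.card : ℝ) < total opp) {w : Fin n → ℝ} (hw : ∀ r, 0 ≤ w r)
    (hw0 : ∀ r, own r = 0 → w r = 0) :
    ∫⁻ a, ∫⁻ b, newWeight w s (partner own opp s a b) ∂unif ∂unif ≤
      ENNReal.ofReal ((1 / (total opp - s.paired.card)) * ∑ r, (opp r : ℝ) * w r) := by
  have hpos : 0 < total opp - s.paired.card := by linarith
  have hinv : 0 ≤ 1 / (total opp - s.paired.card) := one_div_nonneg.2 hpos.le
  set G : ℕ → ENNReal := fun c => ∫⁻ b, newWeight w s (pick (candidates own opp s c) b) ∂unif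
    with hG
  have h1 : ∫⁻ a, ∫⁻ b, newWeight w s (partner own opp s a b) ∂unif ∂unif =
      ∫⁻ a, G (pseudoInverse (nextPmf own opp s) a) ∂unif := rfl
  rw [h1, lintegral_comp_pseudoInverse (isMass_nextPmf hs hT)]
  have h2 : ∀ c, G c * ENNReal.ofReal (nextPmf own opp s c) ≤
      ∑ r, if own r = c then ENNReal.ofReal ((1 / (total opp - s.paired.card)) *
        ((opp r : ℝ) * w r)) else 0 := by
    intro c
    by_cases hc : c = 0
    · have : G c = 0 := by
        rw [hG]
        simp only
        rw [← lintegral_zero (μ := unif)]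
        refine lintegral_congr fun b => ?_
        cases h : pick (candidates own opp s c) b with
        | none => rfl
        | some x =>
          have hx := pick_mem h
          simp only [candidates, Finset.mem_filter] at hx
          simp only [newWeight]
          split_ifs with hx1
          · rfl
          · rcases hx.2.2 with h' | h'
            · simp [hw0 _ (h'.2.trans hc)]
            · exact absurd h'.1 hx1
      rw [this, zero_mul]
      exact zero_le
    by_cases hne : (candidates own opp s c).Nonempty
    · have hcard : (0 : ℝ) < (candidates own opp s c).card := by exact_mod_cast hne.card_pos
      calc G c * ENNReal.ofReal (nextPmf own opp s c)
          ≤ ((∑ z ∈ candidates own opp s c, newWeight w s (some z)) *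
            ENNReal.ofReal (1 / (candidates own opp s c).card)) *
            ENNReal.ofReal (nextPmf own opp s c) :=
            mul_le_mul_left (lintegral_pick_le hne _) _
        _ = (∑ z ∈ candidates own opp s c, newWeight w s (some z)) *
            ENNReal.ofReal (1 / (candidates own opp s c).card * nextPmf own opp s c) := by
            rw [mul_assoc, ← ENNReal.ofReal_mul (by positivity)]
        _ ≤ (∑ z ∈ (Finset.univ.filter fun r => own r = c).sigma fun r => Finset.range (opp r),
            ENNReal.ofReal (w z.1)) * ENNReal.ofReal (1 / (total opp - s.paired.card)) := by
            refine mul_le_mul' ?_ (ENNReal.ofReal_le_ofReal ?_)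
            · refine (Finset.sum_le_sum fun z _ => ?_).trans
                (Finset.sum_le_sum_of_subset (candidates_subset hc))
              simp only [newWeight]
              split_ifs <;> simp
            · have := nextPmf_le_card (own := own) hs hT hc
              calc _ ≤ 1 / ((candidates own opp s c).card : ℝ) *
                    ((1 / (total opp - s.paired.card)) * (candidates own opp s c).card) :=
                    mul_le_mul_of_nonneg_left this (by positivity)
                _ = _ := by field_simp
        _ = _ := by
            rw [Finset.sum_sigma]
            simp only [Finset.sum_const, Finset.card_range]
            rw [Finset.sum_mul, Finset.sum_filter]
            refine Finset.sum_congr rfl fun r _ => ?_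
            congr 1
            rw [ENNReal.ofReal_mul hinv, ENNReal.ofReal_mul (Nat.cast_nonneg _), nsmul_eq_mul,
              mul_comm, ENNReal.ofReal_natCast]
    · rw [Finset.not_nonempty_iff_eq_empty] at hne
      have : G c = 0 := by
        rw [hG]
        simp [hne, pick, newWeight]
      rw [this, zero_mul]
      exact zero_le
  refine (ENNReal.tsum_le_tsum h2).trans ?_
  rw [Summable.tsum_finsetSum fun _ _ => ENNReal.summable, Finset.mul_sum,
    ENNReal.ofReal_sum_of_nonneg fun r _ => mul_nonneg hinv (mul_nonneg (Nat.cast_nonneg _) (hw r))]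
  refine Finset.sum_le_sum fun r _ => ?_
  simp_rw [eq_comm (a := own r)]
  rw [tsum_ite_eq]

/-- The state after the first node was selected with the numbers `a` and `b`. -/
def rootState (own : Fin n → ℕ) (a b : ℝ) : State n :=
  ⟨(pick (Finset.univ.filter fun r => own r = pseudoInverse (empirical own) a) b).toFinset, ∅⟩

lemma measurable_rootState (own : Fin n → ℕ) :
    Measurable fun z : ℝ × ℝ => rootState own z.1 z.2 := by
  let _ : MeasurableSpace (Option (Fin n)) := ⊤
  have _ : DiscreteMeasurableSpace (Option (Fin n)) := ⟨fun _ => trivial⟩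
  have h : Measurable fun z : ℝ × ℝ =>
      pick (Finset.univ.filter fun r => own r = pseudoInverse (empirical own) z.1) z.2 :=
    measurable_of_countable_param
      (F := fun (z : ℝ × ℝ) (c : ℕ) => pick (Finset.univ.filter fun r => own r = c) z.2)
      (fun c => (measurable_pick _).comp measurable_snd)
      ((measurable_pseudoInverse (empirical own)).comp measurable_fst)
  exact (measurable_of_countable fun o : Option (Fin n) => (⟨o.toFinset, ∅⟩ : State n)).comp h

lemma lintegral_weight_root_le (hn : 0 < n) {w : Fin n → ℝ} (hw : ∀ r, 0 ≤ w r) :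
    ∫⁻ a, ∫⁻ b, weight w (rootState own a b) ∂unif ∂unif ≤
      ENNReal.ofReal ((1 / (n : ℝ)) * ∑ r, w r) := by
  have hn' : (0 : ℝ) < n := by exact_mod_cast hn
  set G : ℕ → ENNReal := fun c => ∫⁻ b, weight w (⟨(pick (Finset.univ.filter
    fun r => own r = c) b).toFinset, ∅⟩ : State n) ∂unif with hG
  change ∫⁻ a, G (pseudoInverse (empirical own) a) ∂unif ≤ _
  rw [lintegral_comp_pseudoInverse (isMass_empirical hn)]
  have h2 : ∀ c, G c * ENNReal.ofReal (empirical own c) ≤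
      ∑ r, if own r = c then ENNReal.ofReal ((1 / (n : ℝ)) * w r) else 0 := by
    intro c
    by_cases hne : (Finset.univ.filter fun r => own r = c).Nonempty
    · have hcard : (0 : ℝ) < (Finset.univ.filter fun r => own r = c).card := by
        exact_mod_cast hne.card_pos
      have h := lintegral_pick_le hne fun o => weight w (⟨o.toFinset, ∅⟩ : State n)
      refine (mul_le_mul_left h _).trans (le_of_eq ?_)
      rw [mul_assoc, ← ENNReal.ofReal_mul (by positivity), empirical, ← Finset.sum_filter,
        ← Finset.sum_filter, Finset.sum_mul]
      refine Finset.sum_congr rfl fun r _ => ?_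
      rw [weight]
      simp only [Option.toFinset_some, Finset.sum_singleton]
      rw [← ENNReal.ofReal_mul (hw r)]
      congr 1
      simp only [Finset.sum_const, nsmul_eq_mul, mul_one]
      field_simp
    · rw [Finset.not_nonempty_iff_eq_empty] at hne
      have : G c = 0 := by
        rw [hG]
        simp [hne, pick, weight]
      rw [this, zero_mul]
      exact zero_le
  refine (ENNReal.tsum_le_tsum h2).trans ?_
  rw [Summable.tsum_finsetSum fun _ _ => ENNReal.summable, Finset.mul_sum,
    ENNReal.ofReal_sum_of_nonneg fun r _ => mul_nonneg (by positivity) (hw r)]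
  refine Finset.sum_le_sum fun r _ => ?_
  simp_rw [eq_comm (a := own r)]
  rw [tsum_ite_eq]

end

section

variable {n : ℕ}

/-! ### Expected sizes of the generations -/

/-- Stubs of generation `m` of the graph. -/
def graphAt (own opp : Fin n → ℕ) (m : ℕ) (x : Input) : Finset (List ℕ) :=
  graphGen own opp (fun i => x (Sum.inl i)) (fun i => x (Sum.inr i)) m

/-- Individuals of generation `m` of the tree. -/
def treeAt (g f : PMF ℕ) (m : ℕ) (x : Input) : Finset (List ℕ) :=
  treeGen g f (fun i => x (Sum.inl i)) m

/-- The state at the end of step `m`. -/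
def stateEnd (own opp : Fin n → ℕ) (m : ℕ) (x : Input) : State n :=
  (explore own opp (fun i => x (Sum.inl i)) (fun i => x (Sum.inr i)) m).2

/-- The state before the stub `i` of generation `m` is traversed. -/
def stateBefore (own opp : Fin n → ℕ) (m : ℕ) (i : List ℕ) (x : Input) : State n :=
  stateAt own opp (fun i => x (Sum.inl i)) (fun i => x (Sum.inr i)) m i

/-- A random set of labels of length `m` that depends on the numbers of shorter labels only. -/
structure Predictable (m : ℕ) (Q : Input → Finset (List ℕ)) : Prop where
  measurable : Measurable Q
  length : ∀ x, ∀ i ∈ Q x, i.length = m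
  congr : ∀ x y : Input, (∀ i : List ℕ, i.length < m → x (Sum.inl i) = y (Sum.inl i) ∧
    x (Sum.inr i) = y (Sum.inr i)) → Q x = Q y

variable {own opp : Fin n → ℕ} {g f : PMF ℕ}

lemma predictable_graphAt (m : ℕ) : Predictable m (graphAt own opp m) where
  measurable := measurable_graphGen own opp m
  length x i hi := length_of_mem_explore (mem_graphGen.1 hi)
  congr x y h := by
    simp only [graphAt, graphGen]
    rw [explore_congr (m := m) fun i hi => h i hi]

lemma predictable_treeAt (m : ℕ) : Predictable m (treeAt g f m) where
  measurable := measurable_treeGen g f m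
  length _ _ hi := length_of_mem_treeGen hi
  congr _ _ h := treeGen_congr fun i hi => (h i hi).1

lemma Predictable.sdiff {m : ℕ} {Q R : Input → Finset (List ℕ)} (hQ : Predictable m Q)
    (hR : Predictable m R) : Predictable m fun x => Q x \ R x where
  measurable := (measurable_of_countable
    fun z : Finset (List ℕ) × Finset (List ℕ) => z.1 \ z.2).comp (hQ.measurable.prodMk hR.measurable)
  length x i hi := hQ.length x i (Finset.mem_sdiff.1 hi).1
  congr x y h := by rw [hQ.congr x y h, hR.congr x y h]

lemma Predictable.inter {m : ℕ} {Q R : Input → Finset (List ℕ)} (hQ : Predictable m Q)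
    (hR : Predictable m R) : Predictable m fun x => Q x ∩ R x where
  measurable := (measurable_of_countable
    fun z : Finset (List ℕ) × Finset (List ℕ) => z.1 ∩ z.2).comp (hQ.measurable.prodMk hR.measurable)
  length x i hi := hQ.length x i (Finset.mem_inter.1 hi).1
  congr x y h := by rw [hQ.congr x y h, hR.congr x y h]

lemma update_update_of_ne (x : Input) {i j : List ℕ} (h : j ≠ i) (a b : ℝ) :
    Function.update (Function.update x (Sum.inl i) a) (Sum.inr i) b (Sum.inl j) = x (Sum.inl j) ∧
    Function.update (Function.update x (Sum.inl i) a) (Sum.inr i) b (Sum.inr j) =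
      x (Sum.inr j) := by
  constructor <;> simp [h]

lemma Predictable.ignores {m : ℕ} {Q : Input → Finset (List ℕ)} (hQ : Predictable m Q)
    {i : List ℕ} (hi : m ≤ i.length) : Ignores Q i := by
  intro x a b
  refine hQ.congr _ _ fun j hj => update_update_of_ne x ?_ a b
  rintro rfl
  lia

lemma ignores_stateBefore (m : ℕ) {i : List ℕ} (hi : i.length = m) :
    Ignores (stateBefore own opp m i) i := fun x a b =>
  stateAt_congr hi fun _ hj => update_update_of_ne x hj a b

lemma measurable_stateEnd (m : ℕ) : Measurable (stateEnd own opp m) :=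
  (measurable_explore own opp m).snd

lemma valid_stateEnd (m : ℕ) (x : Input) : (stateEnd own opp m x).Valid opp := by
  induction m with
  | zero => exact valid_empty
  | succ m ih =>
    cases m with
    | zero =>
      intro y hy
      simp [stateEnd, explore, startState] at hy
    | succ m =>
      exact traverse_induction (p := fun s => s.Valid opp)
        (fun _ a b hs => valid_update own opp hs a b) _ ih

lemma valid_stateBefore (m : ℕ) (i : List ℕ) (x : Input) :
    (stateBefore own opp m i x).Valid opp :=
  before_induction (p := fun s => s.Valid opp) (fun _ a b hs => valid_update own opp hs a b) _
    (valid_stateEnd m x) i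

lemma stateEnd_le_stateBefore (m : ℕ) (i : List ℕ) (x : Input) :
    (stateEnd own opp m x).Le (stateBefore own opp m i x) := le_before _ _ _

lemma stateBefore_le_stateEnd (m : ℕ) (i : List ℕ) (x : Input) :
    (stateBefore own opp (m + 1) i x).Le (stateEnd own opp (m + 2) x) := before_le_traverse _ _ _

lemma stateEnd_le_succ (m : ℕ) (x : Input) :
    (stateEnd own opp (m + 1) x).Le (stateEnd own opp (m + 2) x) := le_traverse _ _

/-- Indicator of a set of states. -/
def ind (good : Set (State n)) (s : State n) : ENNReal := good.indicator (fun _ => 1) s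

lemma ind_le_of_le {good : Set (State n)} (hgood : ∀ s t : State n, s.Le t → t ∈ good → s ∈ good)
    {s t : State n} (h : s.Le t) : ind good t ≤ ind good s := by
  by_cases ht : t ∈ good
  · simp [ind, ht, hgood s t h ht]
  · simp [ind, ht]

lemma ind_le_one (good : Set (State n)) (s : State n) : ind good s ≤ 1 := by
  by_cases hs : s ∈ good <;> simp [ind, hs]

variable {good : Set (State n)}

lemma lintegral_sum_le (hgood : ∀ s t : State n, s.Le t → t ∈ good → s ∈ good) {m : ℕ}
    {Q : Input → Finset (List ℕ)} (hQ : Predictable m Q) {φ : State n → ℝ → ℝ → ENNReal}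
    (hφ : ∀ s, Measurable fun z : ℝ × ℝ => φ s z.1 z.2) {b : ENNReal}
    (hb : ∀ s ∈ good, s.Valid opp → ∫⁻ a, ∫⁻ c, φ s a c ∂unif ∂unif ≤ b) :
    ∫⁻ x, ∑ i ∈ Q x, ind good (stateBefore own opp m i x) *
      φ (stateBefore own opp m i x) (x (Sum.inl i)) (x (Sum.inr i)) ∂inputLaw ≤
      b * ∫⁻ x, ind good (stateEnd own opp m x) * (Q x).card ∂inputLaw := by
  have h := lintegral_sum_ignores (Q := Q) (stateBefore own opp m)
    (fun i => hQ.measurable (.of_discrete (s := {A : Finset (List ℕ) | i ∈ A})))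
    (measurable_stateAt own opp m)
    (fun i x a c => by
      by_cases hi : i.length = m
      · exact congrArg (fun A => i ∈ A) (hQ.ignores hi.ge x a c)
      · exact propext ⟨fun h => absurd (hQ.length _ _ h) hi, fun h => absurd (hQ.length _ _ h) hi⟩)
    (fun i ⟨x, hx⟩ => ignores_stateBefore m (hQ.length x i hx))
    (φ := fun _ s a c => ind good s * φ s a c) (fun i s => (hφ s).const_mul _)
  rw [h, ← lintegral_const_mul]
  · refine lintegral_mono fun x => ?_
    dsimp only
    calc _ ≤ ∑ i ∈ Q x, b * ind good (stateEnd own opp m x) := by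
          refine Finset.sum_le_sum fun i _ => ?_
          by_cases hs : stateBefore own opp m i x ∈ good
          · have hs' := hgood _ _ (stateEnd_le_stateBefore m i x) hs
            simp only [ind, hs, hs', Set.indicator_of_mem, one_mul, mul_one]
            exact hb _ hs (valid_stateBefore m i x)
          · simp [ind, hs]
      _ = _ := by rw [Finset.sum_const, nsmul_eq_mul]; ring
  · exact ((measurable_of_countable (ind good)).comp (measurable_stateEnd m)).mul
      ((measurable_of_countable fun A : Finset (List ℕ) => (A.card : ENNReal)).comp hQ.measurable)

/-- Expected size of a random set of labels on the event that the state after step `m` is good. -/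
def meanCard (own opp : Fin n → ℕ) (good : Set (State n)) (m : ℕ)
    (Q : Input → Finset (List ℕ)) : ENNReal :=
  ∫⁻ x, ind good (stateEnd own opp m x) * (Q x).card ∂inputLaw

lemma measurable_ind_mul {m : ℕ} {Q : Input → Finset (List ℕ)} (hQ : Predictable m Q) :
    Measurable fun x => ind good (stateEnd own opp m x) * ((Q x).card : ENNReal) :=
  ((measurable_of_countable (ind good)).comp (measurable_stateEnd m)).mul
    ((measurable_of_countable fun A : Finset (List ℕ) => (A.card : ENNReal)).comp hQ.measurable)

lemma mem_graphAt_succ_succ (m : ℕ) (x : Input) (y : List ℕ) :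
    y ∈ graphAt own opp (m + 2) x ↔ ∃ i ∈ graphAt own opp (m + 1) x,
      y ∈ children i (found own opp (stateBefore own opp (m + 1) i x) (x (Sum.inl i))) :=
  mem_graphGen_succ_succ

lemma ne_nil_of_mem_treeAt {m : ℕ} {x : Input} {i : List ℕ} (hi : i ∈ treeAt g f (m + 1) x) :
    i ≠ [] := by
  rintro rfl
  simpa using length_of_mem_treeGen hi

/-- Number of offspring of an individual with number `a` that is not the root. -/
def offspring (f : PMF ℕ) (a : ℝ) : ℕ := pseudoInverse (fun t => (f t).toReal) a

lemma measurable_offspring (f : PMF ℕ) : Measurable (offspring f) := measurable_pseudoInverse _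

lemma mem_treeAt_succ_succ (m : ℕ) (x : Input) (y : List ℕ) :
    y ∈ treeAt g f (m + 2) x ↔ ∃ i ∈ treeAt g f (m + 1) x,
      y ∈ children i (offspring f (x (Sum.inl i))) := by
  unfold treeAt
  rw [mem_treeGen_succ]
  refine exists_congr fun i => and_congr_right fun hi => ?_
  rw [treeOffspring, if_neg (ne_nil_of_mem_treeAt hi)]
  rfl

lemma ind_mul_sum_le (hgood : ∀ s t : State n, s.Le t → t ∈ good → s ∈ good)
    (m : ℕ) (x : Input) (Q : Finset (List ℕ)) (F : List ℕ → ENNReal) :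
    ind good (stateEnd own opp (m + 2) x) * ∑ i ∈ Q, F i ≤
      ∑ i ∈ Q, ind good (stateBefore own opp (m + 1) i x) * F i := by
  rw [Finset.mul_sum]
  exact Finset.sum_le_sum fun i _ =>
    mul_le_mul_left (ind_le_of_le hgood (stateBefore_le_stateEnd m i x)) _

lemma meanCard_graphAt_succ (hgood : ∀ s t : State n, s.Le t → t ∈ good → s ∈ good)
    {ρ : ENNReal}
    (hρ : ∀ s ∈ good, s.Valid opp → ∫⁻ a, (found own opp s a : ENNReal) ∂unif ≤ ρ) (m : ℕ) :
    meanCard own opp good (m + 2) (graphAt own opp (m + 2)) ≤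
      ρ * meanCard own opp good (m + 1) (graphAt own opp (m + 1)) := by
  refine le_trans ?_ (lintegral_sum_le (φ := fun s a _ => (found own opp s a : ENNReal)) hgood
    (predictable_graphAt (m + 1)) (fun s => ?_) (b := ρ) (fun s hs hv => ?_))
  · refine lintegral_mono fun x => ?_
    dsimp only
    rw [card_le_of_children (mem_graphAt_succ_succ m x)]
    push_cast
    exact ind_mul_sum_le hgood m x _ _
  · exact (measurable_of_countable fun k : ℕ => (k : ENNReal)).comp
      ((measurable_found own opp s).comp measurable_fst)
  · simpa using hρ s hs hv

lemma meanCard_graph_sdiff_succ (hgood : ∀ s t : State n, s.Le t → t ∈ good → s ∈ good)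
    {ρ η : ENNReal}
    (hρ : ∀ s ∈ good, s.Valid opp → ∫⁻ a, (found own opp s a : ENNReal) ∂unif ≤ ρ)
    (hη : ∀ s ∈ good, s.Valid opp →
      ∫⁻ a, ((found own opp s a - offspring f a : ℕ) : ENNReal) ∂unif ≤ η) (m : ℕ) :
    meanCard own opp good (m + 2) (fun x => graphAt own opp (m + 2) x \ treeAt g f (m + 2) x) ≤
      ρ * meanCard own opp good (m + 1)
          (fun x => graphAt own opp (m + 1) x \ treeAt g f (m + 1) x) +
        η * ∫⁻ x, ((treeAt g f (m + 1) x).card : ENNReal) ∂inputLaw := by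
  have h1 := lintegral_sum_le (φ := fun s a _ => (found own opp s a : ENNReal)) hgood
    ((predictable_graphAt (own := own) (opp := opp) (m + 1)).sdiff
      (predictable_treeAt (g := g) (f := f) (m + 1))) (own := own) (opp := opp)
    (fun s => (measurable_of_countable fun k : ℕ => (k : ENNReal)).comp
      ((measurable_found own opp s).comp measurable_fst)) (b := ρ)
    (fun s hs hv => by simpa using hρ s hs hv)
  have h2 := lintegral_sum_le
    (φ := fun s a _ => ((found own opp s a - offspring f a : ℕ) : ENNReal)) hgood
    ((predictable_graphAt (own := own) (opp := opp) (m + 1)).inter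
      (predictable_treeAt (g := g) (f := f) (m + 1))) (own := own) (opp := opp)
    (fun s => (measurable_of_countable fun k : ℕ × ℕ => ((k.1 - k.2 : ℕ) : ENNReal)).comp
      (((measurable_found own opp s).comp measurable_fst).prodMk
        ((measurable_offspring f).comp measurable_fst))) (b := η)
    (fun s hs hv => by simpa using hη s hs hv)
  have h3 : ∫⁻ x, ind good (stateEnd own opp (m + 1) x) *
      ((graphAt own opp (m + 1) x ∩ treeAt g f (m + 1) x).card : ENNReal) ∂inputLaw ≤
      ∫⁻ x, ((treeAt g f (m + 1) x).card : ENNReal) ∂inputLaw := by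
    refine lintegral_mono fun x => ?_
    calc _ ≤ 1 * ((graphAt own opp (m + 1) x ∩ treeAt g f (m + 1) x).card : ENNReal) :=
          mul_le_mul_left (ind_le_one _ _) _
      _ ≤ _ := by
          rw [one_mul]
          exact_mod_cast Finset.card_le_card Finset.inter_subset_right
  refine le_trans ?_ (add_le_add h1 (h2.trans (mul_le_mul_right h3 _)))
  have hm : Measurable fun x : Input => ∑ i ∈ graphAt own opp (m + 1) x \ treeAt g f (m + 1) x,
      ind good (stateBefore own opp (m + 1) i x) *
        (found own opp (stateBefore own opp (m + 1) i x) (x (Sum.inl i)) : ENNReal) := by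
    refine measurable_of_countable_param (F := fun (x : Input) (A : Finset (List ℕ)) =>
      ∑ i ∈ A, ind good (stateBefore own opp (m + 1) i x) *
        (found own opp (stateBefore own opp (m + 1) i x) (x (Sum.inl i)) : ENNReal))
      (fun A => Finset.measurable_sum _ fun i _ => ?_)
      ((predictable_graphAt (m + 1)).sdiff (predictable_treeAt (m + 1))).measurable
    refine measurable_of_countable_param (F := fun (x : Input) (s : State n) =>
      ind good s * (found own opp s (x (Sum.inl i)) : ENNReal)) (fun s => ?_)
      (measurable_stateAt own opp (m + 1) i)
    exact ((measurable_of_countable fun k : ℕ => (k : ENNReal)).comp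
      ((measurable_found own opp s).comp (measurable_pi_apply _))).const_mul _
  rw [← lintegral_add_left hm]
  refine lintegral_mono fun x => ?_
  dsimp only
  have hc := card_sdiff_le (mem_graphAt_succ_succ (own := own) (opp := opp) m x)
    (mem_treeAt_succ_succ (g := g) (f := f) m x)
  calc _ ≤ ind good (stateEnd own opp (m + 2) x) * _ :=
        mul_le_mul_right (Nat.cast_le.2 hc) _
    _ ≤ _ := by
        push_cast only [Nat.cast_add, Nat.cast_sum]
        rw [mul_add]
        exact add_le_add (ind_mul_sum_le hgood m x _ _) (ind_mul_sum_le hgood m x _ _)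

lemma meanCard_tree_sdiff_succ (hgood : ∀ s t : State n, s.Le t → t ∈ good → s ∈ good)
    {ρ η : ENNReal}
    (hρ : ∫⁻ a, (offspring f a : ENNReal) ∂unif ≤ ρ)
    (hη : ∀ s ∈ good, s.Valid opp →
      ∫⁻ a, ((offspring f a - found own opp s a : ℕ) : ENNReal) ∂unif ≤ η) (m : ℕ) :
    meanCard own opp good (m + 2) (fun x => treeAt g f (m + 2) x \ graphAt own opp (m + 2) x) ≤
      ρ * meanCard own opp good (m + 1)
          (fun x => treeAt g f (m + 1) x \ graphAt own opp (m + 1) x) +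
        η * ∫⁻ x, ((treeAt g f (m + 1) x).card : ENNReal) ∂inputLaw := by
  have h1 := lintegral_sum_le (φ := fun _ a _ => (offspring f a : ENNReal)) hgood
    ((predictable_treeAt (g := g) (f := f) (m + 1)).sdiff
      (predictable_graphAt (own := own) (opp := opp) (m + 1))) (own := own) (opp := opp)
    (fun s => (measurable_of_countable fun k : ℕ => (k : ENNReal)).comp
      ((measurable_offspring f).comp measurable_fst)) (b := ρ)
    (fun s hs hv => by simpa using hρ)
  have h2 := lintegral_sum_le
    (φ := fun s a _ => ((offspring f a - found own opp s a : ℕ) : ENNReal)) hgood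
    ((predictable_treeAt (g := g) (f := f) (m + 1)).inter
      (predictable_graphAt (own := own) (opp := opp) (m + 1))) (own := own) (opp := opp)
    (fun s => (measurable_of_countable fun k : ℕ × ℕ => ((k.1 - k.2 : ℕ) : ENNReal)).comp
      (((measurable_offspring f).comp measurable_fst).prodMk
        ((measurable_found own opp s).comp measurable_fst))) (b := η)
    (fun s hs hv => by simpa using hη s hs hv)
  have h3 : ∫⁻ x, ind good (stateEnd own opp (m + 1) x) *
      ((treeAt g f (m + 1) x ∩ graphAt own opp (m + 1) x).card : ENNReal) ∂inputLaw ≤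
      ∫⁻ x, ((treeAt g f (m + 1) x).card : ENNReal) ∂inputLaw := by
    refine lintegral_mono fun x => ?_
    calc _ ≤ 1 * ((treeAt g f (m + 1) x ∩ graphAt own opp (m + 1) x).card : ENNReal) :=
          mul_le_mul_left (ind_le_one _ _) _
      _ ≤ _ := by
          rw [one_mul]
          exact_mod_cast Finset.card_le_card Finset.inter_subset_left
  refine le_trans ?_ (add_le_add h1 (h2.trans (mul_le_mul_right h3 _)))
  have hm : Measurable fun x : Input => ∑ i ∈ treeAt g f (m + 1) x \ graphAt own opp (m + 1) x,
      ind good (stateBefore own opp (m + 1) i x) * (offspring f (x (Sum.inl i)) : ENNReal) := by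
    refine measurable_of_countable_param (F := fun (x : Input) (A : Finset (List ℕ)) =>
      ∑ i ∈ A, ind good (stateBefore own opp (m + 1) i x) *
        (offspring f (x (Sum.inl i)) : ENNReal))
      (fun A => Finset.measurable_sum _ fun i _ => ?_)
      ((predictable_treeAt (m + 1)).sdiff (predictable_graphAt (m + 1))).measurable
    exact ((measurable_of_countable (ind good)).comp (measurable_stateAt own opp (m + 1) i)).mul
      ((measurable_of_countable fun k : ℕ => (k : ENNReal)).comp
        ((measurable_offspring f).comp (measurable_pi_apply _)))
  rw [← lintegral_add_left hm]
  refine lintegral_mono fun x => ?_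
  dsimp only
  have hc := card_sdiff_le (mem_treeAt_succ_succ (g := g) (f := f) m x)
    (mem_graphAt_succ_succ (own := own) (opp := opp) m x)
  calc _ ≤ ind good (stateEnd own opp (m + 2) x) * _ :=
        mul_le_mul_right (Nat.cast_le.2 hc) _
    _ ≤ _ := by
        push_cast only [Nat.cast_add, Nat.cast_sum]
        rw [mul_add]
        exact add_le_add (ind_mul_sum_le hgood m x _ _) (ind_mul_sum_le hgood m x _ _)

lemma lintegral_weight_succ (hgood : ∀ s t : State n, s.Le t → t ∈ good → s ∈ good)
    {w : Fin n → ℝ} {β : ENNReal}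
    (hβ : ∀ s ∈ good, s.Valid opp →
      ∫⁻ a, ∫⁻ b, newWeight w s (partner own opp s a b) ∂unif ∂unif ≤ β) (m : ℕ) :
    ∫⁻ x, ind good (stateEnd own opp (m + 2) x) * weight w (stateEnd own opp (m + 2) x) ∂inputLaw ≤
      ∫⁻ x, ind good (stateEnd own opp (m + 1) x) * weight w (stateEnd own opp (m + 1) x) ∂inputLaw
        + β * meanCard own opp good (m + 1) (graphAt own opp (m + 1)) := by
  have h1 := lintegral_sum_le (φ := fun s a b => newWeight w s (partner own opp s a b)) hgood
    (predictable_graphAt (own := own) (opp := opp) (m + 1)) (own := own) (opp := opp)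
    (fun s => (measurable_of_countable (newWeight w s)).comp (measurable_partner own opp s)) hβ
  refine le_trans ?_ (add_le_add_right h1 _)
  rw [← lintegral_add_left]
  · refine lintegral_mono fun x => ?_
    dsimp only
    have h := traverse_potential (own := own) (opp := opp) (u := fun i => x (Sum.inl i))
      (v := fun i => x (Sum.inr i)) (weight_update_le w)
      (nodup_explore (own := own) (opp := opp) (u := fun i => x (Sum.inl i))
        (v := fun i => x (Sum.inr i)) (m + 1)) (stateEnd own opp (m + 1) x)
    refine (mul_le_mul_right h _).trans ?_
    rw [mul_add]
    exact add_le_add (mul_le_mul_left (ind_le_of_le hgood (stateEnd_le_succ m x)) _)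
      (ind_mul_sum_le hgood m x _ _)
  · exact (measurable_of_countable fun s : State n => ind good s * weight w s).comp
      (measurable_stateEnd (m + 1))

lemma card_paired_succ_le (m : ℕ) (x : Input) :
    (stateEnd own opp (m + 2) x).paired.card ≤
      (stateEnd own opp (m + 1) x).paired.card + (graphAt own opp (m + 1) x).card := by
  have h := traverse_potential (own := own) (opp := opp) (u := fun i => x (Sum.inl i))
      (v := fun i => x (Sum.inr i)) (Y := fun s => (s.paired.card : ENNReal)) (w := fun _ _ => 1)
      (fun s o => by
        cases o with
        | none => simp [State.update]
        | some z =>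
          simp only [State.update]
          exact_mod_cast Finset.card_insert_le z s.paired)
      (nodup_explore (own := own) (opp := opp) (u := fun i => x (Sum.inl i))
        (v := fun i => x (Sum.inr i)) (m + 1)) (stateEnd own opp (m + 1) x)
  simp only [Finset.sum_const, nsmul_eq_mul, mul_one] at h
  exact_mod_cast h

lemma card_paired_one (x : Input) : (stateEnd own opp 1 x).paired.card = 0 := by
  simp [stateEnd, explore, startState]

lemma card_paired_le_sum (m : ℕ) (x : Input) :
    (stateEnd own opp (m + 1) x).paired.card ≤
      ∑ j ∈ Finset.range m, (graphAt own opp (j + 1) x).card := by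
  induction m with
  | zero => simp [card_paired_one]
  | succ m ih =>
    rw [Finset.sum_range_succ]
    exact (card_paired_succ_le m x).trans (by lia)

lemma lintegral_card_treeAt_succ {ρ : ENNReal}
    (hρ : ∫⁻ a, (offspring f a : ENNReal) ∂unif ≤ ρ) (m : ℕ) :
    ∫⁻ x, ((treeAt g f (m + 2) x).card : ENNReal) ∂inputLaw ≤
      ρ * ∫⁻ x, ((treeAt g f (m + 1) x).card : ENNReal) ∂inputLaw := by
  have h1 := lintegral_sum_le (n := 0) (own := fun _ => 0) (opp := fun _ => 0)
    (good := Set.univ) (φ := fun _ a _ => (offspring f a : ENNReal)) (fun _ _ _ _ => trivial)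
    (predictable_treeAt (g := g) (f := f) (m + 1))
    (fun s => (measurable_of_countable fun k : ℕ => (k : ENNReal)).comp
      ((measurable_offspring f).comp measurable_fst)) (b := ρ)
    (fun s hs hv => by simpa using hρ)
  simp only [ind, Set.indicator_univ, one_mul] at h1
  refine le_trans (lintegral_mono fun x => ?_) h1
  dsimp only
  rw [card_le_of_children (mem_treeAt_succ_succ m x)]
  push_cast
  exact le_rfl

/-! ### The first generation -/

lemma lintegral_eval {i : List ℕ} {φ : ℝ → ENNReal} (hφ : Measurable φ) :
    ∫⁻ x : Input, φ (x (Sum.inl i)) ∂inputLaw = ∫⁻ a, φ a ∂unif := by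
  rw [← lintegral_map hφ (measurable_pi_apply (Sum.inl i)), inputLaw,
    Measure.infinitePi_map_eval]

lemma mem_graphAt_one (x : Input) (y : List ℕ) : y ∈ graphAt own opp 1 x ↔
    ∃ i ∈ ({[]} : Finset (List ℕ)), y ∈ children i (pseudoInverse (empirical own) (x (Sum.inl i))) := by
  simp [graphAt, graphGen_one, rootDegree]

lemma mem_treeAt_one (x : Input) (y : List ℕ) : y ∈ treeAt g f 1 x ↔
    ∃ i ∈ ({[]} : Finset (List ℕ)), y ∈ children i (offspring g (x (Sum.inl i))) := by
  simp only [treeAt]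
  rw [mem_treeGen_succ]
  simp [treeGen, treeOffspring, offspring]

lemma lintegral_card_graphAt_one (hn : 0 < n) :
    ∫⁻ x, ((graphAt own opp 1 x).card : ENNReal) ∂inputLaw = ENNReal.ofReal (total own / n) := by
  simp_rw [card_le_of_children (mem_graphAt_one (own := own) (opp := opp) _), Finset.sum_singleton]
  rw [lintegral_eval (φ := fun a => (pseudoInverse (empirical own) a : ENNReal)),
    lintegral_pseudoInverse (isMass_empirical hn), tsum_one_sub_cum_empirical hn]
  exact (measurable_of_countable fun k : ℕ => (k : ENNReal)).comp (measurable_pseudoInverse _)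

lemma lintegral_card_treeAt_one :
    ∫⁻ x, ((treeAt g f 1 x).card : ENNReal) ∂inputLaw =
      ∫⁻ a, (offspring g a : ENNReal) ∂unif := by
  simp_rw [card_le_of_children (mem_treeAt_one (g := g) (f := f) _), Finset.sum_singleton]
  rw [lintegral_eval (φ := fun a => (offspring g a : ENNReal))]
  exact (measurable_of_countable fun k : ℕ => (k : ENNReal)).comp (measurable_offspring _)

lemma lintegral_card_graph_sdiff_one (hn : 0 < n) :
    ∫⁻ x, ((graphAt own opp 1 x \ treeAt g f 1 x).card : ENNReal) ∂inputLaw ≤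
      dist1 (empirical own) (fun t => (g t).toReal) := by
  refine le_trans ?_ (lintegral_pseudoInverse_sub (isMass_empirical hn) (isMass_toReal g))
  rw [← lintegral_eval (i := []) (φ := fun a => ((pseudoInverse (empirical own) a -
    pseudoInverse (fun t => (g t).toReal) a : ℕ) : ENNReal))]
  · refine lintegral_mono fun x => ?_
    have := card_sdiff_le (mem_graphAt_one (own := own) (opp := opp) x)
      (mem_treeAt_one (g := g) (f := f) x)
    simp only [Finset.sdiff_self, Finset.sum_empty, zero_add, Finset.inter_self,
      Finset.sum_singleton] at this
    exact Nat.cast_le.2 this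
  · exact (measurable_of_countable fun k : ℕ × ℕ => ((k.1 - k.2 : ℕ) : ENNReal)).comp
      ((measurable_pseudoInverse _).prodMk (measurable_pseudoInverse _))

lemma lintegral_card_tree_sdiff_one (hn : 0 < n) :
    ∫⁻ x, ((treeAt g f 1 x \ graphAt own opp 1 x).card : ENNReal) ∂inputLaw ≤
      dist1 (empirical own) (fun t => (g t).toReal) := by
  rw [dist1_comm]
  refine le_trans ?_ (lintegral_pseudoInverse_sub (isMass_toReal g) (isMass_empirical hn))
  rw [← lintegral_eval (i := []) (φ := fun a => ((pseudoInverse (fun t => (g t).toReal) a -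
    pseudoInverse (empirical own) a : ℕ) : ENNReal))]
  · refine lintegral_mono fun x => ?_
    have := card_sdiff_le (mem_treeAt_one (g := g) (f := f) x)
      (mem_graphAt_one (own := own) (opp := opp) x)
    simp only [Finset.sdiff_self, Finset.sum_empty, zero_add, Finset.inter_self,
      Finset.sum_singleton] at this
    exact Nat.cast_le.2 this
  · exact (measurable_of_countable fun k : ℕ × ℕ => ((k.1 - k.2 : ℕ) : ENNReal)).comp
      ((measurable_pseudoInverse _).prodMk (measurable_pseudoInverse _))

lemma lintegral_weight_stateEnd_one (hn : 0 < n) {w : Fin n → ℝ} (hw : ∀ r, 0 ≤ w r) :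
    ∫⁻ x, weight w (stateEnd own opp 1 x) ∂inputLaw ≤ ENNReal.ofReal ((1 / (n : ℝ)) * ∑ r, w r) := by
  refine le_trans (le_of_eq ?_) (lintegral_weight_root_le (own := own) hn hw)
  have := lintegral_ignores (S := fun _ => ()) measurable_const (i := []) (fun _ _ _ => rfl)
    (φ := fun _ a b => weight w (rootState own a b))
    (fun _ => (measurable_of_countable (weight w)).comp (measurable_rootState own))
  simp only [lintegral_const, measure_univ, mul_one] at this
  exact this

end

section

/-! ### Probability generating functions -/

/-- Probability generating function. -/
def pgf (f : PMF ℕ) (t : ℝ) : ℝ := ∑' j, (f j).toReal * t ^ j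

variable {f g : PMF ℕ} {μ ν : ℝ}

lemma summable_pgf (f : PMF ℕ) {t : ℝ} (ht : t ∈ Set.Icc (0 : ℝ) 1) :
    Summable fun j => (f j).toReal * t ^ j :=
  Summable.of_nonneg_of_le (fun _ => mul_nonneg ENNReal.toReal_nonneg (pow_nonneg ht.1 _))
    (fun _ => mul_le_of_le_one_right ENNReal.toReal_nonneg (pow_le_one₀ ht.1 ht.2))
    (isMass_toReal f).hasSum.summable

lemma pgf_nonneg {t : ℝ} (ht : 0 ≤ t) : 0 ≤ pgf f t :=
  tsum_nonneg fun _ => mul_nonneg ENNReal.toReal_nonneg (pow_nonneg ht _)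

lemma pgf_mono {s t : ℝ} (hs : 0 ≤ s) (hst : s ≤ t) (ht : t ≤ 1) : pgf f s ≤ pgf f t :=
  (summable_pgf f ⟨hs, hst.trans ht⟩).tsum_le_tsum
    (fun j => mul_le_mul_of_nonneg_left (pow_le_pow_left₀ hs hst j) ENNReal.toReal_nonneg)
    (summable_pgf f ⟨hs.trans hst, ht⟩)

lemma pgf_le_one {t : ℝ} (ht : t ∈ Set.Icc (0 : ℝ) 1) : pgf f t ≤ 1 := by
  rw [← (isMass_toReal f).hasSum.tsum_eq]
  exact (summable_pgf f ht).tsum_le_tsum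
    (fun _ => mul_le_of_le_one_right ENNReal.toReal_nonneg (pow_le_one₀ ht.1 ht.2))
    (isMass_toReal f).hasSum.summable

lemma pgf_mem_Icc {t : ℝ} (ht : t ∈ Set.Icc (0 : ℝ) 1) : pgf f t ∈ Set.Icc (0 : ℝ) 1 :=
  ⟨pgf_nonneg ht.1, pgf_le_one ht⟩

lemma iterate_pgf_mem_Icc {t : ℝ} (ht : t ∈ Set.Icc (0 : ℝ) 1) (k : ℕ) :
    (pgf f)^[k] t ∈ Set.Icc (0 : ℝ) 1 :=
  (show Set.MapsTo (pgf f) (Set.Icc 0 1) (Set.Icc 0 1) from fun _ h => pgf_mem_Icc h).iterate k ht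

lemma convexOn_pgf : ConvexOn ℝ (Set.Icc 0 1) (pgf f) := by
  refine ⟨convex_Icc 0 1, fun s hs t ht a b ha hb hab => ?_⟩
  have hst : a • s + b • t ∈ Set.Icc (0 : ℝ) 1 := convex_Icc 0 1 hs ht ha hb hab
  simp only [pgf, smul_eq_mul] at hst ⊢
  rw [← tsum_mul_left, ← tsum_mul_left,
    ← ((summable_pgf f hs).mul_left a).tsum_add ((summable_pgf f ht).mul_left b)]
  refine (summable_pgf f hst).tsum_le_tsum (fun j => ?_)
    (((summable_pgf f hs).mul_left a).add ((summable_pgf f ht).mul_left b))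
  have := (convexOn_pow j).2 (Set.mem_Ici.2 hs.1) (Set.mem_Ici.2 ht.1) ha hb hab
  simp only [smul_eq_mul] at this
  have hf : 0 ≤ (f j).toReal := ENNReal.toReal_nonneg
  nlinarith [mul_le_mul_of_nonneg_left this hf]

lemma continuousOn_pgf : ContinuousOn (pgf f) (Set.Icc 0 1) := by
  refine continuousOn_tsum (u := fun j => (f j).toReal) (fun j => by fun_prop)
    (isMass_toReal f).hasSum.summable fun j t ht => ?_
  rw [Real.norm_of_nonneg (mul_nonneg ENNReal.toReal_nonneg (pow_nonneg ht.1 _))]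
  exact mul_le_of_le_one_right ENNReal.toReal_nonneg (pow_le_one₀ ht.1 ht.2)

lemma pow_sub_pow_le {s t : ℝ} (hs : s ∈ Set.Icc (0 : ℝ) 1) (ht : t ∈ Set.Icc (0 : ℝ) 1) (j : ℕ) :
    t ^ j - s ^ j ≤ j * |t - s| := by
  induction j with
  | zero => simp
  | succ j ih =>
    have h1 : t ^ (j + 1) - s ^ (j + 1) = t * (t ^ j - s ^ j) + s ^ j * (t - s) := by ring
    have h2 : t * (t ^ j - s ^ j) ≤ t * (j * |t - s|) := mul_le_mul_of_nonneg_left ih ht.1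
    have h3 : t * (j * |t - s|) ≤ j * |t - s| :=
      mul_le_of_le_one_left (by positivity) ht.2
    have h4 : s ^ j * (t - s) ≤ s ^ j * |t - s| :=
      mul_le_mul_of_nonneg_left (le_abs_self _) (pow_nonneg hs.1 _)
    have h5 : s ^ j * |t - s| ≤ |t - s| :=
      mul_le_of_le_one_left (abs_nonneg _) (pow_le_one₀ hs.1 hs.2)
    rw [h1]
    push_cast
    linarith

lemma pgf_sub_le (hg : HasSum (fun j : ℕ => (j : ℝ) * (g j).toReal) ν) {s t : ℝ}
    (hs : s ∈ Set.Icc (0 : ℝ) 1) (ht : t ∈ Set.Icc (0 : ℝ) 1) :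
    pgf g t - pgf g s ≤ ν * |t - s| := by
  unfold pgf
  rw [← (summable_pgf g ht).tsum_sub (summable_pgf g hs), ← hg.tsum_eq, ← tsum_mul_right]
  refine ((summable_pgf g ht).sub (summable_pgf g hs)).tsum_le_tsum (fun j => ?_)
    (hg.summable.mul_right _)
  have := mul_le_mul_of_nonneg_left (pow_sub_pow_le hs ht j)
    (ENNReal.toReal_nonneg (a := g j))
  linarith

lemma mul_pow_mul_one_sub_le {t : ℝ} (ht : t ∈ Set.Icc (0 : ℝ) 1) (j : ℕ) :
    j * t ^ j * (1 - t) ≤ 1 - t ^ j := by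
  rw [← mul_neg_geom_sum, mul_comm]
  refine mul_le_mul_of_nonneg_left ?_ (by linarith [ht.2])
  have : (j : ℝ) * t ^ j = ∑ _i ∈ Finset.range j, t ^ j := by simp
  rw [this]
  exact Finset.sum_le_sum fun i hi =>
    pow_le_pow_of_le_one ht.1 ht.2 (Finset.mem_range.1 hi).le

/-- Near `1`, the generating function is steeper than any number below the mean. -/
lemma exists_le_one_sub_pgf (hf : HasSum (fun j : ℕ => (j : ℝ) * (f j).toReal) μ) {ρ : ℝ}
    (hρ : ρ < μ) : ∃ s ∈ Set.Ioo (0 : ℝ) 1, ∀ t ∈ Set.Icc s 1, ρ * (1 - t) ≤ 1 - pgf f t := by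
  obtain ⟨J, hJ⟩ := (hf.tendsto_sum_nat.eventually (lt_mem_nhds hρ)).exists
  have hcont : Continuous fun t : ℝ => ∑ j ∈ Finset.range J, (j : ℝ) * (f j).toReal * t ^ j := by
    fun_prop
  have h1 : ∀ᶠ t in nhdsWithin (1 : ℝ) (Set.Iio 1),
      ρ < ∑ j ∈ Finset.range J, (j : ℝ) * (f j).toReal * t ^ j := by
    refine (hcont.tendsto 1).eventually_const_lt (by simpa using hJ) |>.filter_mono
      nhdsWithin_le_nhds
  have h2 : ∀ᶠ t in nhdsWithin (1 : ℝ) (Set.Iio 1), t ∈ Set.Ioo (0 : ℝ) 1 :=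
    Ioo_mem_nhdsLT (by norm_num)
  obtain ⟨s, hs1, hs⟩ := (h1.and h2).exists
  refine ⟨s, hs, fun t ht => ?_⟩
  have ht' : t ∈ Set.Icc (0 : ℝ) 1 := ⟨hs.1.le.trans ht.1, ht.2⟩
  have h3 : ∑ j ∈ Finset.range J, (j : ℝ) * (f j).toReal * s ^ j ≤
      ∑ j ∈ Finset.range J, (j : ℝ) * (f j).toReal * t ^ j :=
    Finset.sum_le_sum fun j _ => mul_le_mul_of_nonneg_left (pow_le_pow_left₀ hs.1.le ht.1 j)
      (mul_nonneg (Nat.cast_nonneg _) ENNReal.toReal_nonneg)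
  have h4 : 1 - pgf f t = ∑' j, (f j).toReal * (1 - t ^ j) := by
    simp_rw [mul_sub, mul_one]
    rw [(isMass_toReal f).hasSum.summable.tsum_sub (summable_pgf f ht'),
      (isMass_toReal f).hasSum.tsum_eq]
    rfl
  have h5 : Summable fun j => (f j).toReal * (1 - t ^ j) := by
    simp_rw [mul_sub, mul_one]
    exact (isMass_toReal f).hasSum.summable.sub (summable_pgf f ht')
  have h0 : ∀ j, 0 ≤ (f j).toReal * (1 - t ^ j) := fun j =>
    mul_nonneg ENNReal.toReal_nonneg (sub_nonneg.2 (pow_le_one₀ ht'.1 ht'.2))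
  rw [h4]
  calc ρ * (1 - t) ≤ (∑ j ∈ Finset.range J, (j : ℝ) * (f j).toReal * t ^ j) * (1 - t) :=
        mul_le_mul_of_nonneg_right (hs1.le.trans h3) (by linarith [ht'.2])
    _ = ∑ j ∈ Finset.range J, (f j).toReal * (j * t ^ j * (1 - t)) := by
        rw [Finset.sum_mul]
        exact Finset.sum_congr rfl fun j _ => by ring
    _ ≤ ∑ j ∈ Finset.range J, (f j).toReal * (1 - t ^ j) :=
        Finset.sum_le_sum fun j _ =>
          mul_le_mul_of_nonneg_left (mul_pow_mul_one_sub_le ht' j) ENNReal.toReal_nonneg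
    _ ≤ _ := h5.sum_le_tsum _ fun j _ => h0 j

/-- The generating function of a supercritical distribution contracts an interval that is reached
from any starting point below `1` at a geometric rate as close to the mean as desired. -/
lemma exists_contraction (hf : HasSum (fun j : ℕ => (j : ℝ) * (f j).toReal) μ) {ρ : ℝ}
    (hρ1 : 1 < ρ) (hρ : ρ < μ) : ∃ s ∈ Set.Ioo (0 : ℝ) 1, ∃ q : ℝ, ∃ l ∈ Set.Ioo (0 : ℝ) 1,
      (∀ t ∈ Set.Icc 0 s, ∀ k, |(pgf f)^[k] t - q| ≤ l ^ k) ∧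
      ∀ j, ∀ t ∈ Set.Icc (0 : ℝ) 1, 1 - s ≤ ρ ^ j * (1 - t) → (pgf f)^[j] t ∈ Set.Icc 0 s := by
  obtain ⟨s, hs, hst⟩ := exists_le_one_sub_pgf hf hρ
  have hsI : s ∈ Set.Icc (0 : ℝ) 1 := ⟨hs.1.le, hs.2.le⟩
  have hfs : pgf f s < s := by
    have := hst s ⟨le_rfl, hs.2.le⟩
    nlinarith [hs.2]
  have hmaps : ∀ t ∈ Set.Icc 0 s, pgf f t ∈ Set.Icc 0 s := fun t ht =>
    ⟨pgf_nonneg ht.1, (pgf_mono ht.1 ht.2 hs.2.le).trans hfs.le⟩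
  obtain ⟨q, hq, hqf⟩ : ∃ q ∈ Set.Icc 0 s, q - pgf f q = 0 := by
    have hc : ContinuousOn (fun t => t - pgf f t) (Set.Icc 0 s) :=
      continuousOn_id.sub (continuousOn_pgf.mono (Set.Icc_subset_Icc_right hs.2.le))
    exact intermediate_value_Icc hs.1.le hc
      ⟨by simpa using pgf_nonneg (f := f) le_rfl, by linarith⟩
  have hqf' : pgf f q = q := by linarith
  have hqs : q < s := lt_of_le_of_ne hq.2 fun h => by rw [h] at hqf'; linarith
  have hqI : q ∈ Set.Icc (0 : ℝ) 1 := ⟨hq.1, hqs.le.trans hs.2.le⟩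
  set l₀ := (pgf f s - pgf f q) / (s - q) with hl₀
  have hl₀1 : l₀ < 1 := by
    rw [hl₀, div_lt_one (by linarith), hqf']; linarith
  have hl₀0 : 0 ≤ l₀ :=
    div_nonneg (by linarith [pgf_mono (f := f) hq.1 hqs.le hs.2.le]) (by linarith)
  have hcontr : ∀ t ∈ Set.Icc 0 s, |pgf f t - q| ≤ l₀ * |t - q| := by
    intro t ht
    have htI : t ∈ Set.Icc (0 : ℝ) 1 := ⟨ht.1, ht.2.trans hs.2.le⟩
    rcases lt_trichotomy t q with h | h | h
    · have hm := pgf_mono (f := f) ht.1 h.le hqI.2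
      have := convexOn_pgf.slope_mono_adjacent htI hsI h hqs (f := pgf f)
      rw [← hl₀, div_le_iff₀ (by linarith)] at this
      rw [abs_of_nonpos (by linarith), abs_of_nonpos (by linarith)]
      linarith
    · subst h; simp [hqf']
    · have hm := pgf_mono (f := f) hq.1 h.le htI.2
      rw [abs_of_nonneg (by linarith), abs_of_nonneg (by linarith)]
      rcases eq_or_lt_of_le ht.2 with h' | h'
      · rw [h', hl₀, hqf']
        rw [div_mul_cancel₀ _ (by linarith)]
      · have := convexOn_pgf.secant_mono hqI htI hsI h.ne' hqs.ne' h'.le (f := pgf f)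
        rw [← hl₀, div_le_iff₀ (by linarith)] at this
        linarith
  refine ⟨s, hs, q, max l₀ (1 / 2), ⟨by positivity, max_lt hl₀1 (by norm_num)⟩, ?_, ?_⟩
  · intro t ht k
    induction k generalizing t with
    | zero =>
      simp only [Function.iterate_zero, id_eq, pow_zero]
      rw [abs_le]
      constructor <;> linarith [ht.1, ht.2, hq.1, hq.2, hs.2]
    | succ k ih =>
      rw [Function.iterate_succ_apply']
      have hmem : (pgf f)^[k] t ∈ Set.Icc 0 s :=
        (show Set.MapsTo (pgf f) (Set.Icc 0 s) (Set.Icc 0 s) from hmaps).iterate k ht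
      refine (hcontr _ hmem).trans ?_
      rw [pow_succ']
      exact mul_le_mul (le_max_left _ _) (ih t ht) (abs_nonneg _) (by positivity)
  · intro j
    induction j with
    | zero =>
      intro t ht h
      simp only [pow_zero, one_mul] at h
      exact ⟨ht.1, by simp only [Function.iterate_zero, id_eq]; linarith⟩
    | succ j ih =>
      intro t ht h
      rcases le_or_gt t s with hts | hts
      · exact (show Set.MapsTo (pgf f) (Set.Icc 0 s) (Set.Icc 0 s) from hmaps).iterate (j + 1)
          ⟨ht.1, hts⟩
      · rw [Function.iterate_succ_apply]
        refine ih _ (pgf_mem_Icc ht) (h.trans ?_)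
        rw [pow_succ, mul_assoc]
        exact mul_le_mul_of_nonneg_left (hst t ⟨hts.le, ht.2⟩) (by positivity)

/-! ### The size of the generations of the tree -/

lemma lintegral_prod_predictable {m : ℕ} {Q : Input → Finset (List ℕ)} (hQ : Predictable m Q)
    {ψ : ℝ → ENNReal} (hψ : Measurable ψ) :
    ∫⁻ x, ∏ i ∈ Q x, ψ (x (Sum.inl i)) ∂inputLaw =
      ∫⁻ x, (∫⁻ a, ψ a ∂unif) ^ (Q x).card ∂inputLaw := by
  classical
  have hsplit : ∀ F : Input → Finset (List ℕ) → ENNReal, ∀ x, F x (Q x) =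
      ∑' q : Finset (List ℕ), (if Q x = q then 1 else 0) * F x q := by
    intro F x
    rw [tsum_eq_single (Q x) (fun q hq => by simp [hq.symm])]
    simp
  have hmeas : ∀ q, MeasurableSet {x | Q x = q} := fun q =>
    hQ.measurable (measurableSet_singleton q)
  have hX : ∀ q, Measurable fun x : Input => (if Q x = q then (1 : ENNReal) else 0) := fun q =>
    Measurable.ite (hmeas q) measurable_const measurable_const
  simp_rw [hsplit (fun x q => ∏ i ∈ q, ψ (x (Sum.inl i))),
    hsplit (fun _ q => (∫⁻ a, ψ a ∂unif) ^ q.card)]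
  have hψ' : ∀ q : Finset (List ℕ), Measurable fun x : Input =>
      (if Q x = q then (1 : ENNReal) else 0) * ∏ i ∈ q, ψ (x (Sum.inl i)) := fun q =>
    (hX q).mul (Finset.measurable_prod _ fun i _ => hψ.comp (measurable_pi_apply (Sum.inl i)))
  have hψ'' : ∀ q : Finset (List ℕ), Measurable fun x : Input =>
      (if Q x = q then (1 : ENNReal) else 0) * (∫⁻ a, ψ a ∂unif) ^ q.card := fun q =>
    (hX q).mul_const _
  rw [lintegral_tsum fun q => (hψ' q).aemeasurable, lintegral_tsum fun q => (hψ'' q).aemeasurable]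
  refine tsum_congr fun q => ?_
  rw [lintegral_mul_const _ (hX q)]
  by_cases hq : ∃ y, Q y = q
  · obtain ⟨y, rfl⟩ := hq
    refine lintegral_mul_prod (hX _) _ (fun i hi x a b => ?_) hψ
    have h : Q (Function.update (Function.update x (Sum.inl i) a) (Sum.inr i) b) = Q x :=
      hQ.ignores (hQ.length y i hi).ge x a b
    simp only [h]
  · push Not at hq
    simp [hq]

lemma lintegral_pow_offspring {t : ℝ} (ht : t ∈ Set.Icc (0 : ℝ) 1) :
    ∫⁻ a, ENNReal.ofReal t ^ offspring f a ∂unif = ENNReal.ofReal (pgf f t) := by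
  have h := lintegral_comp_pseudoInverse (isMass_toReal f) fun c => ENNReal.ofReal t ^ c
  unfold offspring
  rw [h, pgf, ENNReal.ofReal_tsum_of_nonneg
    (fun j => mul_nonneg ENNReal.toReal_nonneg (pow_nonneg ht.1 _)) (summable_pgf f ht)]
  refine tsum_congr fun c => ?_
  rw [ENNReal.ofReal_mul ENNReal.toReal_nonneg, ENNReal.ofReal_pow ht.1, mul_comm]

lemma lintegral_pow_card_treeAt (m : ℕ) {t : ℝ} (ht : t ∈ Set.Icc (0 : ℝ) 1) :
    ∫⁻ x, ENNReal.ofReal t ^ (treeAt g f (m + 1) x).card ∂inputLaw =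
      ENNReal.ofReal (pgf g ((pgf f)^[m] t)) := by
  induction m generalizing t with
  | zero =>
    simp_rw [card_le_of_children (mem_treeAt_one (g := g) (f := f) _), Finset.sum_singleton]
    rw [lintegral_eval (φ := fun a => ENNReal.ofReal t ^ offspring g a)]
    · exact lintegral_pow_offspring ht
    · exact (measurable_of_countable fun k : ℕ => ENNReal.ofReal t ^ k).comp
        (measurable_offspring _)
  | succ m ih =>
    have hψ : Measurable fun a => ENNReal.ofReal t ^ offspring f a :=
      (measurable_of_countable fun k : ℕ => ENNReal.ofReal t ^ k).comp (measurable_offspring f)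
    rw [Function.iterate_succ_apply, ← ih (pgf_mem_Icc ht), ← lintegral_pow_offspring ht,
      ← lintegral_prod_predictable (predictable_treeAt (m + 1)) hψ]
    refine lintegral_congr fun x => ?_
    rw [card_le_of_children (mem_treeAt_succ_succ m x), Finset.prod_pow_eq_pow_sum]

lemma treeAt_eq_empty {m k : ℕ} (hmk : m ≤ k) {x : Input} (h : treeAt g f m x = ∅) :
    treeAt g f k x = ∅ := by
  induction k, hmk using Nat.le_induction with
  | base => exact h
  | succ k _ ih =>
    rw [Finset.eq_empty_iff_forall_notMem]
    intro y hy
    obtain ⟨i, hi, -⟩ := mem_treeGen_succ.1 hy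
    change i ∈ treeAt g f k x at hi
    simp [ih] at hi

lemma measurableSet_treeAt (m : ℕ) (p : Finset (List ℕ) → Prop) :
    MeasurableSet {x : Input | p (treeAt g f m x)} :=
  (measurable_treeGen g f m) (.of_discrete (s := {A | p A}))

/-- Chernoff bound for the size of a generation of the tree, on the event that an earlier
generation is not empty. -/
lemma measure_card_treeAt_le {m₀ m : ℕ} (h : m₀ ≤ m) {y : ℝ} {t : ℝ}
    (ht : t ∈ Set.Ioc (0 : ℝ) 1) :
    inputLaw.real {x | (treeAt g f (m₀ + 1) x).Nonempty ∧
      ((treeAt g f (m + 1) x).card : ℝ) ≤ y} * t ^ y ≤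
      pgf g ((pgf f)^[m] t) - pgf g ((pgf f)^[m₀] 0) := by
  have htI : t ∈ Set.Icc (0 : ℝ) 1 := ⟨ht.1.le, ht.2⟩
  set E : Set Input := {x | (treeAt g f (m₀ + 1) x).Nonempty ∧
      ((treeAt g f (m + 1) x).card : ℝ) ≤ y} with hE
  have hEm : MeasurableSet E := by
    rw [hE]
    exact (measurableSet_treeAt _ fun A => A.Nonempty).inter
      (measurableSet_treeAt _ fun A => (A.card : ℝ) ≤ y)
  have h0 := lintegral_pow_card_treeAt (g := g) (f := f) m₀ (t := 0) ⟨le_rfl, zero_le_one⟩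
  have h1 := lintegral_pow_card_treeAt (g := g) (f := f) m htI
  have hty : 0 ≤ t ^ y := Real.rpow_nonneg ht.1.le _
  have h2 : ENNReal.ofReal (t ^ y) * inputLaw E + ENNReal.ofReal (pgf g ((pgf f)^[m₀] 0)) ≤
      ENNReal.ofReal (pgf g ((pgf f)^[m] t)) := by
    rw [← h0, ← h1, ← lintegral_indicator_const hEm, ← lintegral_add_left
      (measurable_const.indicator hEm)]
    refine lintegral_mono fun x => ?_
    by_cases hne : (treeAt g f (m₀ + 1) x).Nonempty
    · have : (treeAt g f (m₀ + 1) x).card ≠ 0 := hne.card_pos.ne'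
      simp only [ENNReal.ofReal_zero, ne_eq, this, not_false_eq_true, zero_pow, add_zero]
      by_cases hx : x ∈ E
      · rw [Set.indicator_of_mem hx, ← ENNReal.ofReal_pow ht.1.le]
        refine ENNReal.ofReal_le_ofReal ?_
        rw [← Real.rpow_natCast]
        exact Real.rpow_le_rpow_of_exponent_ge ht.1 ht.2 hx.2
      · rw [Set.indicator_of_notMem hx]; exact zero_le
    · have hx : x ∉ E := fun h => hne h.1
      rw [Finset.not_nonempty_iff_eq_empty] at hne
      rw [Set.indicator_of_notMem hx, hne, treeAt_eq_empty (by lia) hne]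
      simp
  have hfin : inputLaw E = ENNReal.ofReal (inputLaw.real E) := by
    rw [Measure.real, ENNReal.ofReal_toReal (measure_ne_top _ _)]
  have hp0 : 0 ≤ pgf g ((pgf f)^[m₀] 0) :=
    pgf_nonneg (iterate_pgf_mem_Icc ⟨le_rfl, zero_le_one⟩ _).1
  rw [hfin, ← ENNReal.ofReal_mul hty, ← ENNReal.ofReal_add (by positivity) hp0] at h2
  have := (ENNReal.ofReal_le_ofReal_iff (pgf_nonneg (iterate_pgf_mem_Icc htI _).1)).1 h2
  linarith

end

section

variable {f g : PMF ℕ} {μ ν : ℝ}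

lemma half_le_one_sub_exp {x : ℝ} (hx : 1 ≤ x) : 1 / (2 * x) ≤ 1 - Real.exp (-(1 / x)) := by
  have hx0 : 0 < x := by linarith
  have h1 : Real.exp (-(1 / x)) ≤ 1 / (1 + 1 / x) := by
    rw [Real.exp_neg, ← one_div]
    refine one_div_le_one_div_of_le (by positivity) ?_
    linarith [Real.add_one_le_exp (1 / x)]
  have h2 : 1 / (1 + 1 / x) = x / (x + 1) := by field_simp
  have h3 : 1 - x / (x + 1) = 1 / (x + 1) := by field_simp; ring
  have h4 : 1 / (2 * x) ≤ 1 / (x + 1) := one_div_le_one_div_of_le (by linarith) (by linarith)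
  rw [h2] at h1
  linarith

/-- A supercritical tree that survives the first `m₀ ≈ σ ℓ` generations is unlikely to be smaller
than its mean by a factor that is exponential in `ℓ`. -/
lemma exists_lower_tail (hg : HasSum (fun j : ℕ => (j : ℝ) * (g j).toReal) ν)
    (hf : HasSum (fun j : ℕ => (j : ℝ) * (f j).toReal) μ) (hμ : 1 < μ) {s σ : ℝ} (hs : 0 < s)
    (hs1 : s < 1) (hσ : 0 < σ) :
    ∃ K : ℝ, 0 < K ∧ ∃ b : ℝ, 0 < b ∧ ∀ ℓ : ℝ, ∀ m₀ m : ℕ, m₀ ≤ m → (m : ℝ) + 1 ≤ ℓ →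
      σ * ℓ - 2 ≤ m₀ → inputLaw.real {x | (treeAt g f (m₀ + 1) x).Nonempty ∧
        ((treeAt g f (m + 1) x).card : ℝ) ≤ μ ^ ((m : ℝ) + 1 - s * ℓ)} ≤ K * μ ^ (-b * ℓ) := by
  have hμ0 : 0 < μ := by linarith
  have hν : 0 ≤ ν := hg.nonneg fun j => mul_nonneg (Nat.cast_nonneg _) ENNReal.toReal_nonneg
  set ρ := μ ^ (1 - s / 4) with hρ
  have hρ1 : 1 < ρ := Real.one_lt_rpow hμ (by linarith)
  have hρμ : ρ < μ := by
    conv_rhs => rw [← Real.rpow_one μ]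
    exact Real.rpow_lt_rpow_of_exponent_lt hμ (by linarith)
  obtain ⟨S, hS, q, l, hl, hcontr, hreach⟩ := exists_contraction hf hρ1 hρμ
  set c := min s σ / 2 with hc
  have hmin : 0 < min s σ := lt_min hs hσ
  have hc0 : 0 < c := by positivity
  have hcs : 2 * c ≤ s := by rw [hc]; linarith [min_le_left s σ]
  have hcσ : 2 * c ≤ σ := by rw [hc]; linarith [min_le_right s σ]
  set b' := -Real.logb μ l with hb'
  have hb'0 : 0 < b' := neg_pos.2 (Real.logb_neg hμ hl.1 hl.2)
  have hlb : l = μ ^ (-b') := by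
    rw [hb', neg_neg, Real.rpow_logb hμ0 hμ.ne' hl.1]
  set A := Real.logb μ 2 with hA
  have hA0 : 0 < A := Real.logb_pos hμ (by norm_num)
  have hA2 : μ ^ A = 2 := Real.rpow_logb hμ0 hμ.ne' (by norm_num)
  set ℓ₀ := 2 * (A + 1) / c with hℓ₀
  refine ⟨Real.exp 1 * (2 * ν) / l + μ ^ (b' * c * ℓ₀), by have := hl.1; positivity, b' * c,
    by positivity, fun ℓ m₀ m hm hmℓ hm₀ => ?_⟩
  rcases lt_or_ge ℓ ℓ₀ with hℓ | hℓ
  · refine measureReal_le_one.trans ?_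
    have h1 : 1 ≤ μ ^ (b' * c * ℓ₀) * μ ^ (-(b' * c) * ℓ) := by
      rw [← Real.rpow_add hμ0]
      refine Real.one_le_rpow hμ.le ?_
      have : 0 ≤ b' * c * (ℓ₀ - ℓ) := mul_nonneg (by positivity) (by linarith)
      linarith
    have h2 : 0 ≤ Real.exp 1 * (2 * ν) / l * μ ^ (-(b' * c) * ℓ) := by
      have := hl.1; positivity
    linarith
  have hcℓ : 2 * (A + 1) ≤ c * ℓ := by
    rw [hℓ₀, div_le_iff₀ hc0] at hℓ; linarith
  have hℓ0 : 0 < ℓ := by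
    by_contra h
    nlinarith
  set x := max (μ ^ ((m : ℝ) + 1 - s * ℓ)) 1 with hx
  have hx1 : 1 ≤ x := le_max_right _ _
  have hx0 : 0 < x := by linarith
  set t := Real.exp (-(1 / x)) with ht
  have ht1 : t ≤ 1 := by rw [ht, Real.exp_le_one_iff]; simpa using hx0.le
  have htI : t ∈ Set.Icc (0 : ℝ) 1 := ⟨(Real.exp_pos _).le, ht1⟩
  have htx : t ^ x = Real.exp (-1) := by
    rw [ht, ← Real.exp_mul]
    congr 1
    field_simp
  have hch := measure_card_treeAt_le (g := g) (f := f) hm (y := x) (t := t) ⟨Real.exp_pos _, ht1⟩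
  rw [htx] at hch
  have hsub : inputLaw.real {x | (treeAt g f (m₀ + 1) x).Nonempty ∧
        ((treeAt g f (m + 1) x).card : ℝ) ≤ μ ^ ((m : ℝ) + 1 - s * ℓ)} ≤
      inputLaw.real {z | (treeAt g f (m₀ + 1) z).Nonempty ∧
        ((treeAt g f (m + 1) z).card : ℝ) ≤ x} :=
    measureReal_mono (fun z hz => ⟨hz.1, hz.2.trans (le_max_left _ _)⟩)
  set i := ⌊c * ℓ⌋₊ with hi
  have hi1 : (i : ℝ) ≤ c * ℓ := Nat.floor_le (by positivity)
  have hi2 : c * ℓ - 1 ≤ i := (Nat.sub_one_lt_floor _).le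
  have hσℓ : 2 * (c * ℓ) ≤ σ * ℓ := by nlinarith
  have hsℓ : 2 * (c * ℓ) ≤ s * ℓ := by nlinarith
  have hm' : (m₀ : ℝ) ≤ m := by exact_mod_cast hm
  have him₀ : i ≤ m₀ := by
    have : (i : ℝ) ≤ m₀ := by linarith
    exact_mod_cast this
  have hreach' : (pgf f)^[m - i] t ∈ Set.Icc 0 S := by
    refine hreach _ _ htI ?_
    have hj : ((m - i : ℕ) : ℝ) = (m : ℝ) - i := by
      rw [Nat.cast_sub (him₀.trans hm)]
    have h2x : 2 * x ≤ ρ ^ (m - i) := by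
      rw [hρ, ← Real.rpow_natCast, ← Real.rpow_mul hμ0.le, hj, hx,
        mul_max_of_nonneg _ _ (by norm_num : (0 : ℝ) ≤ 2), ← hA2, ← Real.rpow_add hμ0, mul_one]
      have hi0 : (0 : ℝ) ≤ i := Nat.cast_nonneg _
      refine max_le (Real.rpow_le_rpow_of_exponent_le hμ.le ?_)
        (Real.rpow_le_rpow_of_exponent_le hμ.le ?_)
      · have : s / 4 * ((m : ℝ) - i) ≤ s / 4 * ℓ :=
          mul_le_mul_of_nonneg_left (by linarith) (by linarith)
        linarith
      · have h1 : c * ℓ - 2 ≤ (m : ℝ) - i := by linarith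
        have h2 : 0 ≤ (m : ℝ) - i := by linarith
        have : s / 4 * ((m : ℝ) - i) ≤ 1 / 2 * ((m : ℝ) - i) :=
          mul_le_mul_of_nonneg_right (by linarith) h2
        linarith
    calc 1 - S ≤ 1 := by linarith [hS.1]
      _ = (2 * x) * (1 / (2 * x)) := by field_simp
      _ ≤ ρ ^ (m - i) * (1 - t) :=
        mul_le_mul h2x (half_le_one_sub_exp hx1) (by positivity) (by positivity)
  have hd1 : |(pgf f)^[m] t - q| ≤ l ^ i := by
    have := hcontr _ hreach' i
    rwa [← Function.iterate_add_apply, Nat.add_sub_cancel' (him₀.trans hm)] at this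
  have hd2 : |(pgf f)^[m₀] 0 - q| ≤ l ^ i :=
    (hcontr 0 ⟨le_rfl, hS.1.le⟩ m₀).trans (pow_le_pow_of_le_one hl.1.le hl.2.le him₀)
  have hd : |(pgf f)^[m] t - (pgf f)^[m₀] 0| ≤ 2 * l ^ i := by
    have := abs_sub_le ((pgf f)^[m] t) q ((pgf f)^[m₀] 0)
    rw [abs_sub_comm q] at this
    linarith
  have hdiff := pgf_sub_le hg (iterate_pgf_mem_Icc (f := f) ⟨le_rfl, zero_le_one⟩ m₀)
    (iterate_pgf_mem_Icc (f := f) htI m)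
  have hli : l ^ i ≤ l⁻¹ * μ ^ (-(b' * c) * ℓ) := by
    rw [← Real.rpow_natCast]
    refine (Real.rpow_le_rpow_of_exponent_ge hl.1 hl.2.le hi2).trans (le_of_eq ?_)
    rw [Real.rpow_sub hl.1, Real.rpow_one, hlb, ← Real.rpow_mul hμ0.le]
    rw [div_eq_inv_mul]
    congr 2
    ring
  refine hsub.trans ?_
  have hfin : inputLaw.real {z | (treeAt g f (m₀ + 1) z).Nonempty ∧
      ((treeAt g f (m + 1) z).card : ℝ) ≤ x} ≤
      Real.exp 1 * (2 * ν) / l * μ ^ (-(b' * c) * ℓ) := by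
    have h1 : inputLaw.real {z | (treeAt g f (m₀ + 1) z).Nonempty ∧
      ((treeAt g f (m + 1) z).card : ℝ) ≤ x} * Real.exp (-1) ≤
        ν * (2 * (l⁻¹ * μ ^ (-(b' * c) * ℓ))) := by
      refine hch.trans (hdiff.trans (mul_le_mul_of_nonneg_left ?_ hν))
      linarith
    rw [Real.exp_neg, ← div_eq_mul_inv, div_le_iff₀ (Real.exp_pos _)] at h1
    refine h1.trans (le_of_eq ?_)
    rw [div_eq_mul_inv]
    ring
  have : 0 ≤ μ ^ (b' * c * ℓ₀) * μ ^ (-(b' * c) * ℓ) := by positivity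
  linarith

end

section

variable {n : ℕ} {own opp : Fin n → ℕ} {g f : PMF ℕ}

/-! ### Probabilities of atypical explorations -/

/-- States with at most `N` traversed stubs. -/
def fewPaired (N : ℝ) : Set (State n) := {s | (s.paired.card : ℝ) ≤ N}

/-- States with at most `N` traversed stubs and active nodes of total weight at most `Y`. -/
def lightStates (w : Fin n → ℝ) (N Y : ℝ) : Set (State n) :=
  {s | (s.paired.card : ℝ) ≤ N ∧ weight w s ≤ ENNReal.ofReal Y}

lemma weight_mono (w : Fin n → ℝ) {s t : State n} (h : s.Le t) : weight w s ≤ weight w t :=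
  Finset.sum_le_sum_of_subset h.1

lemma card_paired_mono {s t : State n} (h : s.Le t) :
    (s.paired.card : ℝ) ≤ t.paired.card := by
  exact_mod_cast Finset.card_le_card h.2

lemma fewPaired_of_le (N : ℝ) (s t : State n) (h : s.Le t) (ht : t ∈ fewPaired N) :
    s ∈ fewPaired N := (card_paired_mono h).trans ht

lemma lightStates_of_le (w : Fin n → ℝ) (N Y : ℝ) (s t : State n) (h : s.Le t)
    (ht : t ∈ lightStates w N Y) : s ∈ lightStates w N Y :=
  ⟨(card_paired_mono h).trans ht.1, (weight_mono w h).trans ht.2⟩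

lemma stateEnd_mono {m k : ℕ} (h : m ≤ k) (x : Input) :
    (stateEnd own opp (m + 1) x).Le (stateEnd own opp (k + 1) x) := by
  induction k, h using Nat.le_induction with
  | base => exact .refl _
  | succ k _ ih => exact ih.trans (stateEnd_le_succ k x)

lemma measureReal_le_div {F : Input → ENNReal} (hF : Measurable F) {b y : ℝ} (hb : 0 ≤ b)
    (hy : 0 < y) (h : ∫⁻ x, F x ∂inputLaw ≤ ENNReal.ofReal b) {E : Set Input}
    (hE : ∀ x ∈ E, ENNReal.ofReal y ≤ F x) : inputLaw.real E ≤ b / y := by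
  have h1 := mul_meas_ge_le_lintegral hF (ENNReal.ofReal y) (μ := inputLaw)
  have h2 : ENNReal.ofReal y * inputLaw E ≤ ENNReal.ofReal b :=
    (mul_le_mul_right (measure_mono hE) _).trans (h1.trans h)
  rw [le_div_iff₀ hy, mul_comm]
  have h3 := ENNReal.toReal_mono ENNReal.ofReal_ne_top h2
  rwa [ENNReal.toReal_mul, ENNReal.toReal_ofReal hy.le, ENNReal.toReal_ofReal hb] at h3

section
variable {N ρ A : ℝ} (hn : 0 < n) (hA : total own / n ≤ A) (hρ1 : 1 ≤ ρ)
  (hρ : ∀ s : State n, s ∈ fewPaired N → s.Valid opp →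
    ∫⁻ a, (found own opp s a : ENNReal) ∂unif ≤ ENNReal.ofReal ρ)

lemma nonneg_of_total_le (hA : total own / n ≤ A) : 0 ≤ A :=
  le_trans (by unfold total; positivity) hA

include hn hA hρ1 hρ in
lemma meanCard_graphAt_le (m : ℕ) :
    meanCard own opp (fewPaired N) (m + 1) (graphAt own opp (m + 1)) ≤
      ENNReal.ofReal (ρ ^ m * A) := by
  induction m with
  | zero =>
    rw [pow_zero, one_mul]
    refine le_trans ?_ (ENNReal.ofReal_le_ofReal hA)
    rw [← lintegral_card_graphAt_one (opp := opp) hn]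
    refine lintegral_mono fun x => ?_
    exact (mul_le_mul_left (ind_le_one _ _) _).trans (one_mul _).le
  | succ m ih =>
    refine (meanCard_graphAt_succ (fewPaired_of_le N) hρ m).trans ?_
    rw [pow_succ', mul_assoc, ENNReal.ofReal_mul (by linarith)]
    exact mul_le_mul_right ih _

include hn hA hρ1 hρ in
lemma sum_meanCard_graphAt_le (K : ℕ) :
    ∑ j ∈ Finset.range K, meanCard own opp (fewPaired N) (j + 1) (graphAt own opp (j + 1)) ≤
      ENNReal.ofReal (K * ρ ^ K * A) := by
  have hA0 := nonneg_of_total_le hA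
  calc _ ≤ ∑ j ∈ Finset.range K, ENNReal.ofReal (ρ ^ K * A) :=
        Finset.sum_le_sum fun j hj => (meanCard_graphAt_le hn hA hρ1 hρ j).trans
          (ENNReal.ofReal_le_ofReal (mul_le_mul_of_nonneg_right
            (pow_le_pow_right₀ hρ1 (Finset.mem_range.1 hj).le) hA0))
    _ = _ := by
        rw [Finset.sum_const, Finset.card_range, nsmul_eq_mul, mul_assoc,
          ENNReal.ofReal_mul (Nat.cast_nonneg _), ENNReal.ofReal_natCast]

lemma paired_le_or_lt_sum (hN : 0 ≤ N) (m : ℕ) (x : Input) :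
    ((stateEnd own opp (m + 1) x).paired.card : ℝ) ≤ N ∨
      ENNReal.ofReal N ≤ ∑ j ∈ Finset.range m,
        ind (fewPaired N) (stateEnd own opp (j + 1) x) * (graphAt own opp (j + 1) x).card := by
  induction m with
  | zero => left; simpa [card_paired_one] using hN
  | succ m ih =>
    rcases ih with h | h
    · by_cases h2 : ((stateEnd own opp (m + 2) x).paired.card : ℝ) ≤ N
      · exact Or.inl h2
      · right
        push Not at h2
        have h3 := card_paired_le_sum (own := own) (opp := opp) (m + 1) x
        calc ENNReal.ofReal N ≤ ((stateEnd own opp (m + 2) x).paired.card : ENNReal) := by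
              rw [← ENNReal.ofReal_natCast]
              exact ENNReal.ofReal_le_ofReal h2.le
          _ ≤ ((∑ j ∈ Finset.range (m + 1), (graphAt own opp (j + 1) x).card : ℕ) : ENNReal) :=
              Nat.cast_le.2 h3
          _ = _ := by
              rw [Nat.cast_sum]
              refine Finset.sum_congr rfl fun j hj => ?_
              have : stateEnd own opp (j + 1) x ∈ fewPaired N :=
                fewPaired_of_le N _ _ (stateEnd_mono (by
                  have := Finset.mem_range.1 hj; lia) x) h
              simp [ind, this]
    · right
      rw [Finset.sum_range_succ]
      exact h.trans le_self_add

include hn hA hρ1 hρ in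
lemma measure_paired_gt_le (hN : 0 < N) (K : ℕ) :
    inputLaw.real {x | ¬ ((stateEnd own opp (K + 1) x).paired.card : ℝ) ≤ N} ≤
      K * ρ ^ K * A / N := by
  have hA0 := nonneg_of_total_le hA
  have hm : ∀ j, Measurable fun x => ind (fewPaired N) (stateEnd own opp (j + 1) x) *
      ((graphAt own opp (j + 1) x).card : ENNReal) := fun j =>
    measurable_ind_mul (predictable_graphAt (own := own) (opp := opp) (j + 1))
  refine measureReal_le_div (F := fun x => ∑ j ∈ Finset.range K,
    ind (fewPaired N) (stateEnd own opp (j + 1) x) * (graphAt own opp (j + 1) x).card)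
    (Finset.measurable_sum _ fun j _ => hm j) (by positivity) hN ?_ ?_
  · rw [lintegral_finsetSum _ fun j _ => hm j]
    exact sum_meanCard_graphAt_le hn hA hρ1 hρ K
  · intro x hx
    exact (paired_le_or_lt_sum hN.le K x).resolve_left hx

include hn hA hρ1 hρ in
lemma measure_weight_gt_le {w : Fin n → ℝ} (hw : ∀ r, 0 ≤ w r) {W β Y : ℝ} (hβ0 : 0 ≤ β)
    (hY : 0 < Y) (hW : (1 / (n : ℝ)) * ∑ r, w r ≤ W)
    (hβ : ∀ s : State n, s ∈ fewPaired N → s.Valid opp →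
      ∫⁻ a, ∫⁻ b, newWeight w s (partner own opp s a b) ∂unif ∂unif ≤ ENNReal.ofReal β) (K : ℕ) :
    inputLaw.real {x | ((stateEnd own opp (K + 1) x).paired.card : ℝ) ≤ N ∧
      ¬ weight w (stateEnd own opp (K + 1) x) ≤ ENNReal.ofReal Y} ≤
      (W + β * (K * ρ ^ K * A)) / Y := by
  have hA0 := nonneg_of_total_le hA
  have hW0 : 0 ≤ W := le_trans (mul_nonneg (by positivity) (Finset.sum_nonneg fun r _ => hw r)) hW
  refine measureReal_le_div (F := fun x => ind (fewPaired N) (stateEnd own opp (K + 1) x) *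
    weight w (stateEnd own opp (K + 1) x)) ?_ (by positivity) hY ?_ ?_
  · exact (measurable_of_countable fun s : State n => ind (fewPaired N) s * weight w s).comp
      (measurable_stateEnd (K + 1))
  · have hrec : ∀ m, ∫⁻ x, ind (fewPaired N) (stateEnd own opp (m + 1) x) *
        weight w (stateEnd own opp (m + 1) x) ∂inputLaw ≤ ENNReal.ofReal W +
        ENNReal.ofReal β * ∑ j ∈ Finset.range m,
          meanCard own opp (fewPaired N) (j + 1) (graphAt own opp (j + 1)) := by
      intro m
      induction m with
      | zero =>
        simp only [Finset.range_zero, Finset.sum_empty, mul_zero, add_zero]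
        refine le_trans (lintegral_mono fun x => ?_)
          ((lintegral_weight_stateEnd_one (own := own) (opp := opp) hn hw).trans (ENNReal.ofReal_le_ofReal hW))
        exact (mul_le_mul_left (ind_le_one _ _) _).trans (one_mul _).le
      | succ m ih =>
        refine (lintegral_weight_succ (fewPaired_of_le N) hβ m).trans ?_
        rw [Finset.sum_range_succ, mul_add, ← add_assoc]
        exact add_le_add_left ih _
    refine (hrec K).trans ?_
    rw [ENNReal.ofReal_add hW0 (by positivity), ENNReal.ofReal_mul hβ0]
    exact add_le_add_right (mul_le_mul_right (sum_meanCard_graphAt_le hn hA hρ1 hρ K) _) _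
  · intro x hx
    have : stateEnd own opp (K + 1) x ∈ fewPaired N := hx.1
    simp only [ind, this, Set.indicator_of_mem, one_mul]
    exact (not_le.1 hx.2).le

end

section
variable {good : Set (State n)} {ρ η ν : ℝ}

lemma lintegral_card_treeAt_le (hρ1 : 1 ≤ ρ)
    (hν : ∫⁻ a, (offspring g a : ENNReal) ∂unif ≤ ENNReal.ofReal ν)
    (hf : ∫⁻ a, (offspring f a : ENNReal) ∂unif ≤ ENNReal.ofReal ρ) (m : ℕ) :
    ∫⁻ x, ((treeAt g f (m + 1) x).card : ENNReal) ∂inputLaw ≤ ENNReal.ofReal (ρ ^ m * ν) := by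
  induction m with
  | zero =>
    rw [pow_zero, one_mul, lintegral_card_treeAt_one]
    exact hν
  | succ m ih =>
    refine (lintegral_card_treeAt_succ hf m).trans ?_
    rw [pow_succ', mul_assoc, ENNReal.ofReal_mul (by linarith)]
    exact mul_le_mul_right ih _

lemma linear_recursion_le (hρ1 : 1 ≤ ρ) (hη : 0 ≤ η) (hν : 0 ≤ ν) {F : ℕ → ENNReal}
    {Z : ℕ → ENNReal} (hZ : ∀ m, Z m ≤ ENNReal.ofReal (ρ ^ m * ν))
    (h0 : F 0 ≤ ENNReal.ofReal η)
    (hF : ∀ m, F (m + 1) ≤ ENNReal.ofReal ρ * F m + ENNReal.ofReal η * Z m) (m : ℕ) :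
    F m ≤ ENNReal.ofReal ((m + 1) * ρ ^ (m + 1) * (η * (1 + ν))) := by
  have hρ0 : 0 ≤ ρ := by linarith
  induction m with
  | zero =>
    refine h0.trans (ENNReal.ofReal_le_ofReal ?_)
    simp only [Nat.cast_zero, zero_add, pow_one, one_mul]
    calc η = 1 * (η * 1) := by ring
      _ ≤ ρ * (η * (1 + ν)) := by gcongr; linarith
  | succ m ih =>
    refine (hF m).trans ((add_le_add (mul_le_mul_right ih _) (mul_le_mul_right (hZ m) _)).trans ?_)
    rw [← ENNReal.ofReal_mul hρ0, ← ENNReal.ofReal_mul hη,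
      ← ENNReal.ofReal_add (by positivity) (by positivity)]
    refine ENNReal.ofReal_le_ofReal ?_
    have h1 : ρ ^ m ≤ ρ ^ (m + 2) := pow_le_pow_right₀ hρ1 (by lia)
    have h2 : η * (ρ ^ m * ν) ≤ ρ ^ (m + 2) * (η * (1 + ν)) := by
      calc η * (ρ ^ m * ν) = ρ ^ m * (η * ν) := by ring
        _ ≤ ρ ^ (m + 2) * (η * (1 + ν)) := by gcongr; linarith
    push_cast
    calc _ ≤ ρ * ((m + 1) * ρ ^ (m + 1) * (η * (1 + ν))) + ρ ^ (m + 2) * (η * (1 + ν)) := by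
          linarith
      _ = _ := by ring

/-- The probability that the graph and the tree differ much in generation `m + 1`. -/
lemma measure_sdiff_ge_le (hgood : ∀ s t : State n, s.Le t → t ∈ good → s ∈ good) (hn : 0 < n)
    (hρ1 : 1 ≤ ρ) (hη : 0 ≤ η) (hν0 : 0 ≤ ν)
    (hν : ∫⁻ a, (offspring g a : ENNReal) ∂unif ≤ ENNReal.ofReal ν)
    (hf : ∫⁻ a, (offspring f a : ENNReal) ∂unif ≤ ENNReal.ofReal ρ)
    (hρ : ∀ s ∈ good, s.Valid opp → ∫⁻ a, (found own opp s a : ENNReal) ∂unif ≤ ENNReal.ofReal ρ)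
    (hg : dist1 (empirical own) (fun t => (g t).toReal) ≤ ENNReal.ofReal η)
    (hd : ∀ s ∈ good, s.Valid opp → IsMass (nextPmf own opp s) ∧
      dist1 (nextPmf own opp s) (fun t => (f t).toReal) ≤ ENNReal.ofReal η)
    (m : ℕ) {y : ℝ} (hy : 0 < y) :
    inputLaw.real {x | stateEnd own opp (m + 1) x ∈ good ∧
      (y ≤ (treeAt g f (m + 1) x \ graphAt own opp (m + 1) x).card ∨
        y ≤ (graphAt own opp (m + 1) x \ treeAt g f (m + 1) x).card)} ≤
      2 * ((m + 1) * ρ ^ (m + 1) * (η * (1 + ν))) / y := by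
  have hρ0 : 0 ≤ ρ := by linarith
  have hZ := lintegral_card_treeAt_le (g := g) (f := f) hρ1 hν hf
  have hc := linear_recursion_le hρ1 hη hν0 hZ
    (F := fun m => meanCard own opp good (m + 1)
      (fun x => graphAt own opp (m + 1) x \ treeAt g f (m + 1) x))
    ((lintegral_mono fun x => (mul_le_mul_left (ind_le_one _ _) _).trans (one_mul _).le).trans
      ((lintegral_card_graph_sdiff_one hn).trans hg))
    (fun m => meanCard_graph_sdiff_succ hgood hρ (fun s hs hv =>
      (lintegral_pseudoInverse_sub (hd s hs hv).1 (isMass_toReal f)).trans (hd s hs hv).2) m) m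
  have hb := linear_recursion_le hρ1 hη hν0 hZ
    (F := fun m => meanCard own opp good (m + 1)
      (fun x => treeAt g f (m + 1) x \ graphAt own opp (m + 1) x))
    ((lintegral_mono fun x => (mul_le_mul_left (ind_le_one _ _) _).trans (one_mul _).le).trans
      ((lintegral_card_tree_sdiff_one hn).trans hg))
    (fun m => meanCard_tree_sdiff_succ hgood hf (fun s hs hv =>
      (lintegral_pseudoInverse_sub (isMass_toReal f) (hd s hs hv).1).trans
        ((dist1_comm _ _).le.trans (hd s hs hv).2)) m) m
  have hm1 := measurable_ind_mul (good := good) ((predictable_treeAt (g := g) (f := f) (m + 1)).sdiff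
    (predictable_graphAt (own := own) (opp := opp) (m + 1))) (own := own) (opp := opp)
  have hm2 := measurable_ind_mul (good := good)
    ((predictable_graphAt (own := own) (opp := opp) (m + 1)).sdiff
    (predictable_treeAt (g := g) (f := f) (m + 1))) (own := own) (opp := opp)
  refine measureReal_le_div (hm1.add hm2) (by positivity) hy ?_ ?_
  · simp only [Pi.add_apply]
    rw [lintegral_add_left hm1, two_mul, ENNReal.ofReal_add (by positivity) (by positivity)]
    exact add_le_add hb hc
  · rintro x ⟨hx, h⟩
    simp only [Pi.add_apply, ind, hx, Set.indicator_of_mem, one_mul]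
    rcases h with h | h
    · refine le_trans ?_ le_self_add
      rw [← ENNReal.ofReal_natCast]
      exact ENNReal.ofReal_le_ofReal h
    · refine le_trans ?_ le_add_self
      rw [← ENNReal.ofReal_natCast]
      exact ENNReal.ofReal_le_ofReal h

end

end

section

variable {n : ℕ} {own opp : Fin n → ℕ} {g f : PMF ℕ}

/-! ### Consequences of regularity -/

lemma lintegral_offspring {μ : ℝ} (hf : HasSum (fun j : ℕ => (j : ℝ) * (f j).toReal) μ) :
    ∫⁻ a, (offspring f a : ENNReal) ∂unif = ENNReal.ofReal μ := by
  unfold offspring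
  rw [lintegral_comp_pseudoInverse (isMass_toReal f) fun c => (c : ENNReal), ← hf.tsum_eq,
    ENNReal.ofReal_tsum_of_nonneg
      (fun j => mul_nonneg (Nat.cast_nonneg _) ENNReal.toReal_nonneg) hf.summable]
  refine tsum_congr fun c => ?_
  rw [ENNReal.ofReal_mul (Nat.cast_nonneg _), ENNReal.ofReal_natCast]

lemma tsum_one_sub_cum {μ : ℝ} (hf : HasSum (fun j : ℕ => (j : ℝ) * (f j).toReal) μ) :
    ∑' k, ENNReal.ofReal (1 - cum (fun t => (f t).toReal) k) = ENNReal.ofReal μ := by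
  rw [← lintegral_pseudoInverse (isMass_toReal f)]
  exact lintegral_offspring hf

lemma tsum_one_sub_cum_le (p q : ℕ → ℝ) :
    ∑' k, ENNReal.ofReal (1 - cum p k) ≤ ∑' k, ENNReal.ofReal (1 - cum q k) + dist1 p q := by
  rw [dist1_eq, ← ENNReal.tsum_add]
  refine ENNReal.tsum_le_tsum fun k => ?_
  refine (ENNReal.ofReal_le_ofReal ?_).trans ENNReal.ofReal_add_le
  have := neg_abs_le (cum p k - cum q k)
  linarith

lemma total_div_le {ν D : ℝ} (hn : 0 < n) (hν0 : 0 ≤ ν) (hD : 0 ≤ D)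
    (hg : HasSum (fun j : ℕ => (j : ℝ) * (g j).toReal) ν)
    (hd : dist1 (empirical own) (fun t => (g t).toReal) ≤ ENNReal.ofReal D) :
    total own / n ≤ ν + D := by
  have h := (tsum_one_sub_cum_le (empirical own) fun t => (g t).toReal).trans
    (add_le_add_right hd _)
  rw [tsum_one_sub_cum_empirical hn, tsum_one_sub_cum hg, ← ENNReal.ofReal_add hν0 hD] at h
  exact (ENNReal.ofReal_le_ofReal_iff (by positivity)).1 h

lemma le_total_div {ν D : ℝ} (hn : 0 < n) (hD : 0 ≤ D)
    (hg : HasSum (fun j : ℕ => (j : ℝ) * (g j).toReal) ν)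
    (hd : dist1 (empirical own) (fun t => (g t).toReal) ≤ ENNReal.ofReal D) :
    ν ≤ total own / n + D := by
  have hL : 0 ≤ total own / n := by unfold total; positivity
  have h := (tsum_one_sub_cum_le (fun t => (g t).toReal) (empirical own)).trans
    (add_le_add_right ((dist1_comm _ _).le.trans hd) _)
  rw [tsum_one_sub_cum_empirical hn, tsum_one_sub_cum hg, ← ENNReal.ofReal_add hL hD] at h
  exact (ENNReal.ofReal_le_ofReal_iff (by positivity)).1 h

lemma mean_sizeBiased_le {μ D : ℝ} (hL : 0 < total opp) (hμ0 : 0 ≤ μ) (hD : 0 ≤ D)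
    (hf : HasSum (fun j : ℕ => (j : ℝ) * (f j).toReal) μ)
    (hd : dist1 (sizeBiased own opp) (fun t => (f t).toReal) ≤ ENNReal.ofReal D) :
    (1 / total opp) * ∑ r, (own r : ℝ) * opp r ≤ μ + D := by
  have h := (tsum_one_sub_cum_le (sizeBiased own opp) fun t => (f t).toReal).trans
    (add_le_add_right hd _)
  rw [tsum_one_sub_cum_sizeBiased hL, tsum_one_sub_cum hf, ← ENNReal.ofReal_add hμ0 hD] at h
  exact (ENNReal.ofReal_le_ofReal_iff (by positivity)).1 h

/-- The product of the degrees of a node, if its `opp`-degree is at most `M`. -/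
def cutProduct (own opp : Fin n → ℕ) (M : ℝ) (r : Fin n) : ℝ :=
  if (opp r : ℝ) ≤ M then (own r : ℝ) * opp r else 0

lemma cutProduct_nonneg (M : ℝ) (r : Fin n) : 0 ≤ cutProduct own opp M r := by
  unfold cutProduct
  split_ifs <;> positivity

lemma cutProduct_eq_zero (M : ℝ) (r : Fin n) (h : own r = 0) : cutProduct own opp M r = 0 := by
  simp [cutProduct, h]

lemma le_rpow_mul_own_mul_opp {κ : ℝ} (hκ : 0 < κ) (r : Fin n) :
    (own r : ℝ) * opp r ≤ (opp r : ℝ) ^ κ * (own r * opp r) := by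
  rcases Nat.eq_zero_or_pos (opp r) with h | h
  · simp [h]
  · refine le_mul_of_one_le_left (by positivity) (Real.one_le_rpow ?_ hκ.le)
    exact_mod_cast h

section
variable {κ B : ℝ} (hκ : 0 < κ) (hmom : ∑ r, (opp r : ℝ) ^ κ * (own r * opp r) ≤ B)

include hmom in
lemma moment_nonneg : 0 ≤ B :=
  le_trans (Finset.sum_nonneg fun r _ => by positivity) hmom

include hκ hmom in
lemma sum_cutProduct_le (M : ℝ) : ∑ r, cutProduct own opp M r ≤ B := by
  refine le_trans (Finset.sum_le_sum fun r _ => ?_) hmom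
  unfold cutProduct
  split_ifs
  · exact le_rpow_mul_own_mul_opp hκ r
  · positivity

include hmom in
lemma sum_opp_mul_cutProduct_le (hκ1 : κ ≤ 1) {M : ℝ} (hM : 0 ≤ M) :
    ∑ r, (opp r : ℝ) * cutProduct own opp M r ≤ M ^ (1 - κ) * B := by
  refine le_trans ?_ (mul_le_mul_of_nonneg_left hmom (Real.rpow_nonneg hM _))
  rw [Finset.mul_sum]
  refine Finset.sum_le_sum fun r _ => ?_
  unfold cutProduct
  split_ifs with h
  · rcases Nat.eq_zero_or_pos (opp r) with h0 | h0
    · simp [h0]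
    · have h0' : (0 : ℝ) < opp r := by exact_mod_cast h0
      have h1 : (opp r : ℝ) = (opp r : ℝ) ^ (1 - κ) * (opp r : ℝ) ^ κ := by
        rw [← Real.rpow_add h0']; simp
      calc (opp r : ℝ) * (own r * opp r)
          = (opp r : ℝ) ^ (1 - κ) * ((opp r : ℝ) ^ κ * (own r * opp r)) := by
            rw [← mul_assoc ((opp r : ℝ) ^ (1 - κ)), ← h1]
        _ ≤ _ := mul_le_mul_of_nonneg_right
            (Real.rpow_le_rpow h0'.le h (by linarith)) (by positivity)
  · rw [mul_zero]; positivity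

include hκ hmom in
lemma sum_own_mul_opp_gt_le {M : ℝ} (hM : 0 < M) :
    ∑ r, (if (opp r : ℝ) ≤ M then 0 else (own r : ℝ) * opp r) ≤ M ^ (-κ) * B := by
  refine le_trans ?_ (mul_le_mul_of_nonneg_left hmom (Real.rpow_nonneg hM.le _))
  rw [Finset.mul_sum]
  refine Finset.sum_le_sum fun r _ => ?_
  split_ifs with h
  · positivity
  · rw [← mul_assoc]
    refine le_mul_of_one_le_left (by positivity) ?_
    rw [Real.rpow_neg hM.le, ← div_eq_inv_mul, one_le_div (Real.rpow_pos_of_pos hM _)]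
    exact Real.rpow_le_rpow hM.le (not_le.1 h).le hκ.le

include hκ hmom in
lemma sum_active_le {M Y : ℝ} (hM : 0 < M) (hY : 0 ≤ Y) {s : State n}
    (hs : weight (cutProduct own opp M) s ≤ ENNReal.ofReal Y) :
    ∑ r, (if r ∈ s.active then (own r : ℝ) * opp r else 0) ≤ Y + M ^ (-κ) * B := by
  have h1 : ∑ r ∈ s.active, cutProduct own opp M r ≤ Y := by
    rw [weight, ← ENNReal.ofReal_sum_of_nonneg fun r _ => cutProduct_nonneg M r] at hs
    exact (ENNReal.ofReal_le_ofReal_iff hY).1 hs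
  have h2 := sum_own_mul_opp_gt_le hκ hmom hM
  have h3 : ∑ r, (if r ∈ s.active then cutProduct own opp M r else 0) =
      ∑ r ∈ s.active, cutProduct own opp M r := by
    rw [Finset.sum_ite_mem, Finset.univ_inter]
  refine le_trans ?_ (add_le_add (h3.le.trans h1) h2)
  rw [← Finset.sum_add_distrib]
  refine Finset.sum_le_sum fun r _ => ?_
  unfold cutProduct
  have : (0 : ℝ) ≤ (own r : ℝ) * opp r := by positivity
  split_ifs <;> linarith

end

section
variable {N D μ : ℝ} (hN : N ≤ total opp / 2) (hL : 0 < total opp)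

include hN hL in
lemma paired_lt_total {s : State n} (hs : s ∈ fewPaired N) :
    (s.paired.card : ℝ) < total opp ∧ 1 / (total opp - s.paired.card) ≤ 1 / (total opp - N) ∧
      1 / (total opp - s.paired.card) ≤ 2 / total opp := by
  have hs' : (s.paired.card : ℝ) ≤ N := hs
  refine ⟨by linarith, one_div_le_one_div_of_le (by linarith) (by linarith), ?_⟩
  rw [div_le_div_iff₀ (by linarith) hL]
  linarith

include hN hL in
lemma lintegral_found_le_of_fewPaired (hμ : (1 / total opp) * ∑ r, (own r : ℝ) * opp r ≤ μ)
    {s : State n} (hs : s ∈ fewPaired N) (hv : s.Valid opp) :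
    ∫⁻ a, (found own opp s a : ENNReal) ∂unif ≤
      ENNReal.ofReal (total opp / (total opp - N) * μ) := by
  obtain ⟨h1, h2, -⟩ := paired_lt_total hN hL hs
  refine (lintegral_found_le hv h1).trans (ENNReal.ofReal_le_ofReal ?_)
  have h0 : 0 ≤ ∑ r, (own r : ℝ) * opp r := Finset.sum_nonneg fun r _ => by positivity
  have hLN : 0 < total opp - N := by linarith
  calc _ ≤ 1 / (total opp - N) * ∑ r, (own r : ℝ) * opp r := mul_le_mul_of_nonneg_right h2 h0
    _ = total opp / (total opp - N) * ((1 / total opp) * ∑ r, (own r : ℝ) * opp r) := by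
        field_simp
    _ ≤ _ := mul_le_mul_of_nonneg_left hμ (by positivity)

include hN hL in
lemma lintegral_newWeight_le_of_fewPaired {κ B M : ℝ} (hκ1 : κ ≤ 1) (hM : 0 ≤ M)
    (hmom : ∑ r, (opp r : ℝ) ^ κ * (own r * opp r) ≤ B)
    {s : State n} (hs : s ∈ fewPaired N) (hv : s.Valid opp) :
    ∫⁻ a, ∫⁻ b, newWeight (cutProduct own opp M) s (partner own opp s a b) ∂unif ∂unif ≤
      ENNReal.ofReal (2 / total opp * (M ^ (1 - κ) * B)) := by
  obtain ⟨h1, -, h2⟩ := paired_lt_total hN hL hs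
  refine (lintegral_newWeight_le hv h1 (cutProduct_nonneg M) (cutProduct_eq_zero M)).trans
    (ENNReal.ofReal_le_ofReal ?_)
  exact mul_le_mul h2 (sum_opp_mul_cutProduct_le hmom hκ1 hM)
    (Finset.sum_nonneg fun r _ => mul_nonneg (Nat.cast_nonneg _) (cutProduct_nonneg M r))
    (by positivity)

include hN hL in
lemma dist1_nextPmf_le_of_lightStates {κ B M Y : ℝ} (hκ : 0 < κ) (hM : 0 < M) (hY : 0 ≤ Y)
    (hmom : ∑ r, (opp r : ℝ) ^ κ * (own r * opp r) ≤ B)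
    (hμ : (1 / total opp) * ∑ r, (own r : ℝ) * opp r ≤ μ) (hN0 : 0 ≤ N) (hD : 0 ≤ D)
    (hd : dist1 (sizeBiased own opp) (fun t => (f t).toReal) ≤ ENNReal.ofReal D)
    {s : State n} (hs : s ∈ lightStates (cutProduct own opp M) N Y) :
    dist1 (nextPmf own opp s) (fun t => (f t).toReal) ≤
      ENNReal.ofReal (2 * N / total opp * μ + 1 / total opp * (Y + M ^ (-κ) * B) + D) := by
  obtain ⟨h1, -, h2⟩ := paired_lt_total hN hL (hs.1 : s ∈ fewPaired N)
  have hT : (s.paired.card : ℝ) ≤ N := hs.1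
  have hT0 : (0 : ℝ) ≤ s.paired.card := Nat.cast_nonneg _
  have hB := moment_nonneg hmom
  have hμ0 : 0 ≤ (1 / total opp) * ∑ r, (own r : ℝ) * opp r :=
    mul_nonneg (by positivity) (Finset.sum_nonneg fun r _ => by positivity)
  have hact := sum_active_le hκ hmom hM hY hs.2
  refine (dist1_triangle _ (sizeBiased own opp) _).trans
    ((add_le_add (dist1_nextPmf_sizeBiased h1) hd).trans ?_)
  have hpos : 0 < total opp - s.paired.card := by linarith
  have hfrac : (s.paired.card : ℝ) / (total opp - s.paired.card) ≤ 2 * N / total opp := by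
    calc (s.paired.card : ℝ) / (total opp - s.paired.card)
        = s.paired.card * (1 / (total opp - s.paired.card)) := by ring
      _ ≤ N * (2 / total opp) := mul_le_mul hT h2 (by positivity) hN0
      _ = _ := by ring
  have hfr0 : 0 ≤ 2 * N / total opp := by positivity
  rw [← ENNReal.ofReal_add _ hD]
  · refine ENNReal.ofReal_le_ofReal ?_
    gcongr
  · refine add_nonneg (mul_nonneg (by positivity) hμ0) (mul_nonneg (by positivity)
      (Finset.sum_nonneg fun r _ => ?_))
    split_ifs <;> positivity

end

end

section

variable {n : ℕ} {own opp : Fin n → ℕ} {g f : PMF ℕ}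

/-! ### Comparison of all generations -/

lemma graphAt_eq_empty {m k : ℕ} (hmk : m ≤ k) {x : Input}
    (h : graphAt own opp (m + 1) x = ∅) : graphAt own opp (k + 1) x = ∅ := by
  induction k, hmk using Nat.le_induction with
  | base => exact h
  | succ k _ ih =>
    rw [Finset.eq_empty_iff_forall_notMem]
    intro y hy
    obtain ⟨i, hi, -⟩ := (mem_graphAt_succ_succ k x y).1 hy
    simp [ih] at hi

/-- The tree and the graph are close if no generation differs too much: not at all up to generation
`m₀ + 1`, and after that by less than a small fraction of a lower bound for the tree. -/
lemma isClose_of_bounds {good : Set (State n)}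
    (hgood : ∀ s t : State n, s.Le t → t ∈ good → s ∈ good) {γ : ℝ} {K m₀ : ℕ} {y z : ℕ → ℝ}
    {x : Input} (hend : stateEnd own opp (K + 1) x ∈ good)
    (hlt : ∀ m ≤ K, ¬ (stateEnd own opp (m + 1) x ∈ good ∧
      (y m ≤ (treeAt g f (m + 1) x \ graphAt own opp (m + 1) x).card ∨
        y m ≤ (graphAt own opp (m + 1) x \ treeAt g f (m + 1) x).card)))
    (hy : ∀ m ≤ m₀, y m ≤ 1)
    (htail : ∀ m ≤ K, m₀ ≤ m → ¬ ((treeAt g f (m₀ + 1) x).Nonempty ∧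
      ((treeAt g f (m + 1) x).card : ℝ) ≤ z m))
    (hyz : ∀ m, m₀ < m → y m ≤ z m * (n : ℝ) ^ (-γ)) :
    IsClose own opp g f γ (K + 1) (fun i => x (Sum.inl i)) (fun i => x (Sum.inr i)) := by
  have hX : 0 ≤ (n : ℝ) ^ (-γ) := Real.rpow_nonneg (Nat.cast_nonneg _) _
  have hlt' : ∀ m ≤ K, ((treeAt g f (m + 1) x \ graphAt own opp (m + 1) x).card : ℝ) < y m ∧
      ((graphAt own opp (m + 1) x \ treeAt g f (m + 1) x).card : ℝ) < y m := by
    intro m hm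
    have h1 := hlt m hm
    have h2 : stateEnd own opp (m + 1) x ∈ good := hgood _ _ (stateEnd_mono hm x) hend
    push Not at h1
    exact h1 h2
  have hzero : ∀ m ≤ K, m ≤ m₀ → (treeAt g f (m + 1) x \ graphAt own opp (m + 1) x).card = 0 ∧
      (graphAt own opp (m + 1) x \ treeAt g f (m + 1) x).card = 0 := by
    intro m hm hm0
    have h1 := hlt' m hm
    have h2 := hy m hm0
    constructor
    · have : ((treeAt g f (m + 1) x \ graphAt own opp (m + 1) x).card : ℝ) < 1 := by linarith
      have : (treeAt g f (m + 1) x \ graphAt own opp (m + 1) x).card < 1 := by exact_mod_cast this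
      lia
    · have : ((graphAt own opp (m + 1) x \ treeAt g f (m + 1) x).card : ℝ) < 1 := by linarith
      have : (graphAt own opp (m + 1) x \ treeAt g f (m + 1) x).card < 1 := by exact_mod_cast this
      lia
  intro m' hm'
  obtain ⟨m, rfl⟩ : ∃ m, m' = m + 1 := ⟨m' - 1, by have := (Finset.mem_Icc.1 hm').1; lia⟩
  have hmK : m ≤ K := by have := (Finset.mem_Icc.1 hm').2; lia
  change ((treeAt g f (m + 1) x \ graphAt own opp (m + 1) x).card : ℝ) ≤
    ((treeAt g f (m + 1) x).card : ℝ) * (n : ℝ) ^ (-γ) ∧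
    ((graphAt own opp (m + 1) x \ treeAt g f (m + 1) x).card : ℝ) ≤
    ((treeAt g f (m + 1) x).card : ℝ) * (n : ℝ) ^ (-γ)
  rcases le_or_gt m m₀ with hm | hm
  · obtain ⟨h1, h2⟩ := hzero m hmK hm
    rw [h1, h2, Nat.cast_zero]
    exact ⟨by positivity, by positivity⟩
  by_cases hne : (treeAt g f (m₀ + 1) x).Nonempty
  · have h1 : z m < (treeAt g f (m + 1) x).card := by
      by_contra hcon
      exact htail m hmK hm.le ⟨hne, not_lt.1 hcon⟩
    have h2 : y m ≤ ((treeAt g f (m + 1) x).card : ℝ) * (n : ℝ) ^ (-γ) :=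
      (hyz m hm).trans (mul_le_mul_of_nonneg_right h1.le hX)
    exact ⟨(hlt' m hmK).1.le.trans h2, (hlt' m hmK).2.le.trans h2⟩
  · rw [Finset.not_nonempty_iff_eq_empty] at hne
    have h1 := (hzero m₀ (by lia) le_rfl).2
    rw [hne, Finset.sdiff_empty, Finset.card_eq_zero] at h1
    rw [treeAt_eq_empty (by lia) hne, graphAt_eq_empty hm.le h1]
    simp

lemma one_sub_le_measure_isClose {w : Fin n → ℝ} {N Y γ : ℝ} {K m₀ : ℕ} {y z : ℕ → ℝ}
    {p₁ p₂ q r : ℝ}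
    (h₁ : inputLaw.real {x | ¬ ((stateEnd own opp (K + 1) x).paired.card : ℝ) ≤ N} ≤ p₁)
    (h₂ : inputLaw.real {x | ((stateEnd own opp (K + 1) x).paired.card : ℝ) ≤ N ∧
      ¬ weight w (stateEnd own opp (K + 1) x) ≤ ENNReal.ofReal Y} ≤ p₂)
    (hq : ∀ m ≤ K, inputLaw.real {x | stateEnd own opp (m + 1) x ∈ lightStates w N Y ∧
      (y m ≤ (treeAt g f (m + 1) x \ graphAt own opp (m + 1) x).card ∨
        y m ≤ (graphAt own opp (m + 1) x \ treeAt g f (m + 1) x).card)} ≤ q)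
    (hr : ∀ m ≤ K, m₀ ≤ m → inputLaw.real {x | (treeAt g f (m₀ + 1) x).Nonempty ∧
      ((treeAt g f (m + 1) x).card : ℝ) ≤ z m} ≤ r) (hr0 : 0 ≤ r)
    (hy : ∀ m ≤ m₀, y m ≤ 1) (hyz : ∀ m, m₀ < m → y m ≤ z m * (n : ℝ) ^ (-γ)) :
    1 - (p₁ + p₂ + (K + 1) * q + (K + 1) * r) ≤ inputLaw.real {x | IsClose own opp g f γ (K + 1)
      (fun i => x (Sum.inl i)) (fun i => x (Sum.inr i))} := by
  set E₁ : Set Input := {x | ¬ ((stateEnd own opp (K + 1) x).paired.card : ℝ) ≤ N}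
  set E₂ : Set Input := {x | ((stateEnd own opp (K + 1) x).paired.card : ℝ) ≤ N ∧
      ¬ weight w (stateEnd own opp (K + 1) x) ≤ ENNReal.ofReal Y}
  set Q : ℕ → Set Input := fun m => {x | stateEnd own opp (m + 1) x ∈ lightStates w N Y ∧
      (y m ≤ (treeAt g f (m + 1) x \ graphAt own opp (m + 1) x).card ∨
        y m ≤ (graphAt own opp (m + 1) x \ treeAt g f (m + 1) x).card)} with hQ
  set R : ℕ → Set Input := fun m => {x | m₀ ≤ m ∧ (treeAt g f (m₀ + 1) x).Nonempty ∧
      ((treeAt g f (m + 1) x).card : ℝ) ≤ z m} with hR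
  set S : Set Input := {x | IsClose own opp g f γ (K + 1)
      (fun i => x (Sum.inl i)) (fun i => x (Sum.inr i))}
  have hcover : (Set.univ : Set Input) ⊆ E₁ ∪ E₂ ∪ (⋃ m ∈ Finset.range (K + 1), Q m) ∪
      (⋃ m ∈ Finset.range (K + 1), R m) ∪ S := by
    intro x _
    by_contra hx
    simp only [Set.mem_union, Set.mem_iUnion, Finset.mem_range, not_or, not_exists] at hx
    obtain ⟨⟨⟨⟨hx1, hx2⟩, hx3⟩, hx4⟩, hx5⟩ := hx
    have hT : ((stateEnd own opp (K + 1) x).paired.card : ℝ) ≤ N := not_not.1 hx1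
    have hW : weight w (stateEnd own opp (K + 1) x) ≤ ENNReal.ofReal Y := by
      by_contra h
      exact hx2 ⟨hT, h⟩
    exact hx5 (isClose_of_bounds (lightStates_of_le w N Y) ⟨hT, hW⟩
      (fun m hm => hx3 m (by lia)) hy (fun m hm hm0 h => hx4 m (by lia) ⟨hm0, h⟩) hyz)
  have h1 : (1 : ℝ) ≤ inputLaw.real (E₁ ∪ E₂ ∪ (⋃ m ∈ Finset.range (K + 1), Q m) ∪
      (⋃ m ∈ Finset.range (K + 1), R m) ∪ S) := by
    rw [← probReal_univ (μ := inputLaw)]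
    exact measureReal_mono hcover
  have h3 : inputLaw.real (⋃ m ∈ Finset.range (K + 1), Q m) ≤ (K + 1) * q := by
    refine (measureReal_biUnion_finset_le _ _).trans ?_
    refine (Finset.sum_le_sum (g := fun _ => q) fun m hm => hq m ?_).trans ?_
    · have := Finset.mem_range.1 hm; lia
    · simp
  have h4 : inputLaw.real (⋃ m ∈ Finset.range (K + 1), R m) ≤ (K + 1) * r := by
    refine (measureReal_biUnion_finset_le _ _).trans ?_
    refine (Finset.sum_le_sum (g := fun _ => r) fun m hm => ?_).trans ?_
    · by_cases hm0 : m₀ ≤ m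
      · simp only [hR, hm0, true_and]
        exact hr m (by have := Finset.mem_range.1 hm; lia) hm0
      · simp only [hR, hm0, false_and]
        simpa using hr0
    · simp
  have h5 := measureReal_union_le (μ := inputLaw) (E₁ ∪ E₂ ∪ (⋃ m ∈ Finset.range (K + 1), Q m) ∪
      (⋃ m ∈ Finset.range (K + 1), R m)) S
  have h6 := measureReal_union_le (μ := inputLaw) (E₁ ∪ E₂ ∪ (⋃ m ∈ Finset.range (K + 1), Q m))
      (⋃ m ∈ Finset.range (K + 1), R m)
  have h7 := measureReal_union_le (μ := inputLaw) (E₁ ∪ E₂) (⋃ m ∈ Finset.range (K + 1), Q m)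
  have h8 := measureReal_union_le (μ := inputLaw) E₁ E₂
  linarith

/-- The case of a vanishing mean: the tree consists of its root. -/
lemma one_sub_le_measure_isClose_of_mean_eq_zero (hn : 0 < n)
    (hg : HasSum (fun j : ℕ => (j : ℝ) * (g j).toReal) 0) {D : ℝ} (hD : 0 ≤ D)
    (hd : dist1 (empirical own) (fun t => (g t).toReal) ≤ ENNReal.ofReal D) (γ : ℝ) (K : ℕ) :
    1 - D ≤ inputLaw.real {x | IsClose own opp g f γ (K + 1)
      (fun i => x (Sum.inl i)) (fun i => x (Sum.inr i))} := by
  have hA := total_div_le hn le_rfl hD hg hd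
  rw [zero_add] at hA
  have hm₁ : Measurable fun x : Input => ((graphAt own opp 1 x).card : ENNReal) :=
    (measurable_of_countable fun A : Finset (List ℕ) => (A.card : ENNReal)).comp
      (measurable_graphGen own opp 1)
  have h1 : ∫⁻ x, (((graphAt own opp 1 x).card : ENNReal) + (treeAt g f 1 x).card) ∂inputLaw ≤
      ENNReal.ofReal D := by
    rw [lintegral_add_left hm₁,
      lintegral_card_graphAt_one hn, lintegral_card_treeAt_one, lintegral_offspring hg]
    simpa using ENNReal.ofReal_le_ofReal hA
  have hm : Measurable fun x : Input =>
      ((graphAt own opp 1 x).card : ENNReal) + (treeAt g f 1 x).card :=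
    hm₁.add ((measurable_of_countable
      fun A : Finset (List ℕ) => (A.card : ENNReal)).comp (measurable_treeGen g f 1))
  have h2 := measureReal_le_div hm hD one_pos h1
    (E := {x | graphAt own opp 1 x ≠ ∅ ∨ treeAt g f 1 x ≠ ∅}) (fun x hx => by
      rw [ENNReal.ofReal_one]
      rcases hx with hx | hx
      · have : 1 ≤ (graphAt own opp 1 x).card := (Finset.nonempty_iff_ne_empty.2 hx).card_pos
        exact le_trans (by exact_mod_cast this) le_self_add
      · have : 1 ≤ (treeAt g f 1 x).card := (Finset.nonempty_iff_ne_empty.2 hx).card_pos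
        exact le_trans (by exact_mod_cast this) le_add_self)
  rw [div_one] at h2
  have hcover : (Set.univ : Set Input) ⊆
      {x | graphAt own opp 1 x ≠ ∅ ∨ treeAt g f 1 x ≠ ∅} ∪ {x | IsClose own opp g f γ (K + 1)
      (fun i => x (Sum.inl i)) (fun i => x (Sum.inr i))} := by
    intro x _
    by_cases hx : graphAt own opp 1 x ≠ ∅ ∨ treeAt g f 1 x ≠ ∅
    · exact Or.inl hx
    · push Not at hx
      refine Or.inr fun m hm => ?_
      obtain ⟨m, rfl⟩ : ∃ j, m = j + 1 := ⟨m - 1, by have := (Finset.mem_Icc.1 hm).1; lia⟩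
      have h3 : treeAt g f (m + 1) x = ∅ := treeAt_eq_empty (by lia) hx.2
      have h4 : graphAt own opp (m + 1) x = ∅ := graphAt_eq_empty (Nat.zero_le m) hx.1
      simp only [treeAt] at h3
      simp only [graphAt] at h4
      rw [h3, h4]
      simp
  have h3 := measureReal_mono (μ := inputLaw) hcover
  rw [probReal_univ] at h3
  have h4 := measureReal_union_le (μ := inputLaw)
    {x | graphAt own opp 1 x ≠ ∅ ∨ treeAt g f 1 x ≠ ∅} {x | IsClose own opp g f γ (K + 1)
      (fun i => x (Sum.inl i)) (fun i => x (Sum.inr i))}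
  linarith

end

section

variable {g f : PMF ℕ}

/-! ### Asymptotics -/

lemma logb_le_rpow {μ X a : ℝ} (hμ : 1 < μ) (hX : 0 ≤ X) (ha : 0 < a) :
    Real.logb μ X ≤ 1 / (a * Real.log μ) * X ^ a := by
  have hlog : 0 < Real.log μ := Real.log_pos hμ
  rw [Real.logb, div_le_iff₀ hlog]
  refine (Real.log_le_rpow_div hX ha).trans (le_of_eq ?_)
  field_simp

/-- All that is needed of a large number of nodes. -/
lemma exists_forall_large {μ ν ε d θ σ : ℝ} (hμ : 1 < μ) (hν : 0 < ν) (hε : 0 < ε) (hd : 0 < d)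
    (hθ : 0 < θ) (hσ : 0 < σ) : ∃ X₀ : ℝ, 1 < X₀ ∧ ∀ X ≥ X₀, X ^ (-ε) ≤ ν / 2 ∧ X ^ (-ε) ≤ 1 ∧
      X ^ (-d) ≤ ν / 4 ∧ μ + X ^ (-ε) ≤ μ ^ (1 + θ) * (1 - 2 / ν * X ^ (-d)) ∧
      1 ≤ σ * Real.logb μ X := by
  have t1 := tendsto_rpow_neg_atTop hε
  have t2 := tendsto_rpow_neg_atTop hd
  have t3 : Filter.Tendsto (fun X : ℝ => μ + X ^ (-ε) - μ ^ (1 + θ) * (1 - 2 / ν * X ^ (-d)))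
      Filter.atTop (nhds (μ + 0 - μ ^ (1 + θ) * (1 - 2 / ν * 0))) :=
    (t1.const_add μ).sub (((t2.const_mul (2 / ν)).const_sub 1).const_mul _)
  have hlt : μ + 0 - μ ^ (1 + θ) * (1 - 2 / ν * 0) < 0 := by
    have : μ ^ (1 : ℝ) < μ ^ (1 + θ) := Real.rpow_lt_rpow_of_exponent_lt hμ (by linarith)
    rw [Real.rpow_one] at this
    linarith
  have t4 : Filter.Tendsto (fun X => σ * Real.logb μ X) Filter.atTop Filter.atTop :=
    (Real.tendsto_logb_atTop hμ).const_mul_atTop hσ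
  have h := (t1.eventually_le_const (show (0 : ℝ) < ν / 2 by positivity)).and
    ((t1.eventually_le_const one_pos).and
      ((t2.eventually_le_const (show (0 : ℝ) < ν / 4 by positivity)).and
        ((t3.eventually_lt_const hlt).and (t4.eventually_ge_atTop 1))))
  obtain ⟨X₀, hX₀⟩ := Filter.eventually_atTop.1 h
  refine ⟨max X₀ 2, lt_of_lt_of_le one_lt_two (le_max_right _ _), fun X hX => ?_⟩
  obtain ⟨h1, h2, h3, h4, h5⟩ := hX₀ X ((le_max_left _ _).trans hX)
  exact ⟨h1, h2, h3, by linarith, h5⟩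

section
variable {μ ν ε κ C δ γ : ℝ}

set_option maxHeartbeats 2000000 in
/-- The main estimate for a large number of nodes. The constants are collected in `c`. -/
lemma measure_isClose_large (hg : HasSum (fun j : ℕ => (j : ℝ) * (g j).toReal) ν)
    (hf : HasSum (fun j : ℕ => (j : ℝ) * (f j).toReal) μ) (hμ : 1 < μ) (hν : 0 < ν)
    (hκ : 0 < κ) (hκ1 : κ ≤ 1) (hδ : 0 < δ) (hδ1 : δ < 1) (hγ : 0 < γ) {τ θ s : ℝ}
    (hτκ : τ ≤ δ * κ) (hτε : τ ≤ ε) (hγτ : γ < τ) (hθ : θ = (τ - γ) / 24) (hs : s = (τ - γ) / 2)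
    {K₂ b X₀ : ℝ} (hb : 0 < b) (hK₂ : 0 < K₂)
    (htail : ∀ ℓ : ℝ, ∀ m₀ m : ℕ, m₀ ≤ m → (m : ℝ) + 1 ≤ ℓ →
      τ / 2 * ℓ - 2 ≤ m₀ → inputLaw.real {x | (treeAt g f (m₀ + 1) x).Nonempty ∧
        ((treeAt g f (m + 1) x).card : ℝ) ≤ μ ^ ((m : ℝ) + 1 - s * ℓ)} ≤ K₂ * μ ^ (-b * ℓ))
    (hX₀1 : 1 < X₀) (hX₀ : ∀ X ≥ X₀, X ^ (-ε) ≤ ν / 2 ∧ X ^ (-ε) ≤ 1 ∧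
      X ^ (-(δ - 3 * θ)) ≤ ν / 4 ∧
      μ + X ^ (-ε) ≤ μ ^ (1 + θ) * (1 - 2 / ν * X ^ (-(δ - 3 * θ))) ∧
      1 ≤ τ / 2 * Real.logb μ X) :
    ∃ c : ℝ, 0 ≤ c ∧ ∀ (n : ℕ) (own opp : Fin n → ℕ), X₀ ≤ n → total own = total opp →
      dist1 (empirical own) (fun t => (g t).toReal) ≤ ENNReal.ofReal ((n : ℝ) ^ (-ε)) →
      dist1 (sizeBiased own opp) (fun t => (f t).toReal) ≤ ENNReal.ofReal ((n : ℝ) ^ (-ε)) →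
      ∑ r, (opp r : ℝ) ^ κ * (own r * opp r) ≤ C * n →
      ∀ K : ℕ, (K : ℝ) + 1 ≤ (1 - δ) * Real.logb μ n →
        1 - c * (n : ℝ) ^ (-(min θ (b / 2))) ≤ inputLaw.real {x | IsClose own opp g f γ (K + 1)
          (fun i => x (Sum.inl i)) (fun i => x (Sum.inr i))} := by
  have hμ0 : 0 < μ := by linarith
  have hlogμ : 0 < Real.log μ := Real.log_pos hμ
  have hθ0 : 0 < θ := by rw [hθ]; linarith
  set cl := 1 / (θ * Real.log μ) with hcl
  set cb := 1 / (b / 2 * Real.log μ) with hcb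
  have hcl0 : 0 < cl := by positivity
  have hcb0 : 0 < cb := by positivity
  set A := ν + 1 with hA
  have hA0 : 0 < A := by positivity
  set cη := 4 / ν * (μ + 1) + 2 / ν * (1 + |C|) + 1 with hcη
  have hcη0 : 0 < cη := by positivity
  set cQ := 2 * (cl * (cη * (1 + ν))) with hcQ
  have hcQ0 : 0 < cQ := by positivity
  clear_value cl cb A cη cQ
  refine ⟨cl * A + (|C| + 4 / ν * |C| * (cl * A)) + cl * cQ + cb * K₂, by positivity, ?_⟩
  intro n own opp hnX hLL hdg hdf hmom K hK
  set X : ℝ := (n : ℝ) with hXdef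
  have hX1 : 1 < X := by linarith
  have hX0 : 0 < X := by linarith
  have hn : 0 < n := Nat.cast_pos.1 hX0
  obtain ⟨hD1, hD2, hd1, hρX, hσ⟩ := hX₀ X hnX
  have hD0 : 0 ≤ X ^ (-ε) := by positivity
  set L := total opp with hL
  set ℓ := Real.logb μ X with hℓ
  have hℓ0 : 0 < ℓ := Real.logb_pos hμ hX1
  have hμℓ : μ ^ ℓ = X := Real.rpow_logb hμ0 hμ.ne' hX0
  have hpow : ∀ t : ℝ, μ ^ (t * ℓ) = X ^ t := fun t => by
    rw [mul_comm, Real.rpow_mul hμ0.le, hμℓ]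
  have hadd : ∀ s t : ℝ, X ^ s * X ^ t = X ^ (s + t) := fun s t => (Real.rpow_add hX0 s t).symm
  have hle : ∀ {s t : ℝ}, s ≤ t → X ^ s ≤ X ^ t := fun h =>
    Real.rpow_le_rpow_of_exponent_le hX1.le h
  have hτ0 : 0 < τ := by linarith
  have hδκ : δ * κ ≤ δ := mul_le_of_le_one_right hδ.le hκ1
  have hθτ : 24 * θ ≤ τ := by rw [hθ]; linarith
  have hC : 0 ≤ C := by
    have := moment_nonneg hmom
    by_contra h
    nlinarith
  have hCabs : |C| = C := abs_of_nonneg hC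
  have hLlow : ν / 2 * X ≤ L := by
    have h := le_total_div hn hD0 hg hdg
    rw [hLL] at h
    have h2 : ν / 2 ≤ L / X := by linarith
    rwa [le_div_iff₀ hX0] at h2
  have hLup : total own / n ≤ A := (total_div_le hn hν.le hD0 hg hdg).trans (by rw [hA]; linarith)
  have hLpos : 0 < L := lt_of_lt_of_le (by positivity) hLlow
  have hinvL : 1 / L ≤ 2 / ν * X⁻¹ := by
    calc 1 / L ≤ 1 / (ν / 2 * X) := one_div_le_one_div_of_le (by positivity) hLlow
      _ = _ := by field_simp
  have hmean := mean_sizeBiased_le hLpos hμ0.le hD0 hf hdf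
  -- the parameters
  set N := X ^ (1 - δ + 3 * θ) with hN
  have hN0 : 0 < N := by positivity
  set Y := X ^ (1 - δ * κ + 3 * θ) with hY
  have hY0 : 0 < Y := by positivity
  set M := X ^ δ with hM
  have hM0 : 0 < M := by positivity
  have hNX : N = X * X ^ (-(δ - 3 * θ)) := by
    rw [hN]
    nth_rewrite 2 [← Real.rpow_one X]
    rw [hadd]
    congr 1
    ring
  have hNL : N ≤ L / 2 := by
    have : N ≤ X * (ν / 4) := by
      rw [hNX]
      exact mul_le_mul_of_nonneg_left hd1 hX0.le
    linarith
  have hNdivL : N / L ≤ 2 / ν * X ^ (-(δ - 3 * θ)) := by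
    calc N / L = N * (1 / L) := by ring
      _ ≤ (X * X ^ (-(δ - 3 * θ))) * (2 / ν * X⁻¹) := by
        rw [← hNX]; exact mul_le_mul_of_nonneg_left hinvL hN0.le
      _ = _ := by field_simp
  set ρ := μ ^ (1 + θ) with hρ
  have hρ0 : 0 < ρ := by positivity
  have hμρ : μ ≤ ρ := by
    conv_lhs => rw [← Real.rpow_one μ]
    exact Real.rpow_le_rpow_of_exponent_le hμ.le (by linarith)
  have hρ1 : 1 ≤ ρ := hμ.le.trans hμρ
  clear_value N Y M ρ
  have hLN : 0 < L - N := by linarith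
  have hρL : L / (L - N) * (μ + X ^ (-ε)) ≤ ρ := by
    have h1 : μ + X ^ (-ε) ≤ ρ * (1 - N / L) :=
      hρX.trans (mul_le_mul_of_nonneg_left (by linarith) hρ0.le)
    calc L / (L - N) * (μ + X ^ (-ε)) ≤ L / (L - N) * (ρ * (1 - N / L)) :=
          mul_le_mul_of_nonneg_left h1 (by positivity)
      _ = ρ := by field_simp
  set B := C * X with hB
  set w := cutProduct own opp M with hw
  have hfound : ∀ s : State n, s ∈ fewPaired N → s.Valid opp →
      ∫⁻ a, (found own opp s a : ENNReal) ∂unif ≤ ENNReal.ofReal ρ := fun s hs hv =>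
    (lintegral_found_le_of_fewPaired hNL hLpos hmean hs hv).trans (ENNReal.ofReal_le_ofReal hρL)
  -- growth of the powers
  have hℓθ : ℓ ≤ cl * X ^ θ := by
    rw [hcl]; exact logb_le_rpow hμ hX0.le hθ0
  have hℓb : ℓ ≤ cb * X ^ (b / 2) := by
    rw [hcb]; exact logb_le_rpow hμ hX0.le (by linarith)
  have hKℓ : (K : ℝ) + 1 ≤ ℓ := hK.trans (mul_le_of_le_one_left hℓ0.le (by linarith))
  have hρpow : ∀ j : ℕ, (j : ℝ) ≤ ℓ → ρ ^ j ≤ μ ^ (j : ℝ) * X ^ θ := by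
    intro j hj
    rw [hρ, ← Real.rpow_natCast, ← Real.rpow_mul hμ0.le, ← hpow, ← Real.rpow_add hμ0]
    refine Real.rpow_le_rpow_of_exponent_le hμ.le ?_
    nlinarith [mul_le_mul_of_nonneg_left hj hθ0.le]
  set P := (K : ℝ) * ρ ^ K * A with hP
  have hPle : P ≤ cl * A * X ^ (1 - δ + 2 * θ) := by
    have h1 : μ ^ (K : ℝ) ≤ X ^ (1 - δ) := by
      rw [← hpow]
      exact Real.rpow_le_rpow_of_exponent_le hμ.le (by linarith)
    have h2 : ρ ^ K ≤ X ^ (1 - δ) * X ^ θ :=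
      (hρpow K (by linarith)).trans (mul_le_mul_of_nonneg_right h1 (by positivity))
    have h3 : (K : ℝ) ≤ cl * X ^ θ := by linarith
    calc P ≤ (cl * X ^ θ) * (X ^ (1 - δ) * X ^ θ) * A := by
          rw [hP]; gcongr
      _ = cl * A * (X ^ θ * (X ^ (1 - δ) * X ^ θ)) := by ring
      _ = _ := by rw [hadd, hadd]; congr 2; ring
  have hP0 : 0 ≤ P := by positivity
  have hp₁ : inputLaw.real {x | ¬ ((stateEnd own opp (K + 1) x).paired.card : ℝ) ≤ N} ≤
      cl * A * X ^ (-θ) := by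
    refine (measure_paired_gt_le hn hLup hρ1 hfound hN0 K).trans ?_
    rw [div_le_iff₀ hN0]
    refine hPle.trans (le_of_eq ?_)
    rw [hN, mul_assoc (cl * A), hadd]
    congr 2
    ring
  -- the active nodes are light
  have hp₂ : inputLaw.real {x | ((stateEnd own opp (K + 1) x).paired.card : ℝ) ≤ N ∧
      ¬ weight w (stateEnd own opp (K + 1) x) ≤ ENNReal.ofReal Y} ≤
      (C + 4 / ν * C * (cl * A)) * X ^ (-θ) := by
    have hW : (1 / (n : ℝ)) * ∑ r, w r ≤ C := by
      rw [one_div, ← div_eq_inv_mul, div_le_iff₀ hX0]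
      exact sum_cutProduct_le hκ hmom M
    set β := 2 / L * (M ^ (1 - κ) * B) with hβ
    have hβ0 : 0 ≤ β := by positivity
    have hβle : β ≤ 4 / ν * C * X ^ (δ * (1 - κ)) := by
      have : M ^ (1 - κ) = X ^ (δ * (1 - κ)) := by rw [hM, ← Real.rpow_mul hX0.le]
      rw [hβ, this, hB]
      calc 2 / L * (X ^ (δ * (1 - κ)) * (C * X))
          = (1 / L) * (2 * (X ^ (δ * (1 - κ)) * (C * X))) := by ring
        _ ≤ (2 / ν * X⁻¹) * (2 * (X ^ (δ * (1 - κ)) * (C * X))) :=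
          mul_le_mul_of_nonneg_right hinvL (by positivity)
        _ = _ := by field_simp; ring
    refine (measure_weight_gt_le hn hLup hρ1 hfound (cutProduct_nonneg M) hβ0 hY0 hW
      (fun s hs hv => lintegral_newWeight_le_of_fewPaired hNL hLpos hκ1 hM0.le hmom hs hv)
      K).trans ?_
    rw [div_le_iff₀ hY0]
    have h1 : X ^ (-θ) * Y = X ^ (1 - δ * κ + 2 * θ) := by
      rw [hY, hadd]; congr 1; ring
    have h2 : 1 ≤ X ^ (1 - δ * κ + 2 * θ) :=
      Real.one_le_rpow hX1.le (by linarith)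
    have h3 : β * P ≤ 4 / ν * C * (cl * A) * X ^ (1 - δ * κ + 2 * θ) := by
      calc β * P ≤ (4 / ν * C * X ^ (δ * (1 - κ))) * (cl * A * X ^ (1 - δ + 2 * θ)) :=
            mul_le_mul hβle hPle hP0 (by positivity)
        _ = 4 / ν * C * (cl * A) * (X ^ (δ * (1 - κ)) * X ^ (1 - δ + 2 * θ)) := by ring
        _ = _ := by rw [hadd]; congr 2; ring
    rw [mul_assoc _ (X ^ (-θ)) Y, h1, add_mul]
    exact add_le_add (le_mul_of_one_le_right hC h2) h3
  set η := cη * X ^ (3 * θ - τ) with hη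
  have hη0 : 0 ≤ η := by positivity
  have hDη : X ^ (-ε) ≤ X ^ (3 * θ - τ) := hle (by linarith)
  have hdist : 2 * N / L * (μ + X ^ (-ε)) + 1 / L * (Y + M ^ (-κ) * B) + X ^ (-ε) ≤ η := by
    have h1 : 2 * N / L * (μ + X ^ (-ε)) ≤ 4 / ν * (μ + 1) * X ^ (3 * θ - τ) := by
      calc 2 * N / L * (μ + X ^ (-ε)) = 2 * (N / L) * (μ + X ^ (-ε)) := by ring
        _ ≤ 2 * (2 / ν * X ^ (3 * θ - τ)) * (μ + 1) := by
          have h : X ^ (-(δ - 3 * θ)) ≤ X ^ (3 * θ - τ) := hle (by linarith)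
          have h' : N / L ≤ 2 / ν * X ^ (3 * θ - τ) :=
            hNdivL.trans (mul_le_mul_of_nonneg_left h (by positivity))
          gcongr
        _ = _ := by ring
    have h2 : 1 / L * (Y + M ^ (-κ) * B) ≤ 2 / ν * (1 + C) * X ^ (3 * θ - τ) := by
      have hMκ : M ^ (-κ) = X ^ (-(δ * κ)) := by
        rw [hM, ← Real.rpow_mul hX0.le]; congr 1; ring
      have hYX : Y = X * X ^ (3 * θ - δ * κ) := by
        rw [hY]
        nth_rewrite 2 [← Real.rpow_one X]
        rw [hadd]
        congr 1
        ring
      calc 1 / L * (Y + M ^ (-κ) * B) ≤ (2 / ν * X⁻¹) * (Y + M ^ (-κ) * B) :=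
            mul_le_mul_of_nonneg_right hinvL (by positivity)
        _ = 2 / ν * (X ^ (3 * θ - δ * κ) + C * X ^ (-(δ * κ))) := by
            rw [hYX, hMκ, hB]; field_simp
        _ ≤ 2 / ν * (X ^ (3 * θ - τ) + C * X ^ (3 * θ - τ)) := by
            have h3 : X ^ (3 * θ - δ * κ) ≤ X ^ (3 * θ - τ) := hle (by linarith)
            have h4 : X ^ (-(δ * κ)) ≤ X ^ (3 * θ - τ) := hle (by linarith)
            gcongr
        _ = _ := by ring
    rw [hη, hcη, hCabs]
    linarith
  have hgη : dist1 (empirical own) (fun t => (g t).toReal) ≤ ENNReal.ofReal η := by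
    refine hdg.trans (ENNReal.ofReal_le_ofReal (hDη.trans ?_))
    refine le_mul_of_one_le_left (by positivity) ?_
    rw [hcη]
    have : 0 ≤ 4 / ν * (μ + 1) + 2 / ν * (1 + |C|) := by positivity
    linarith
  -- the generations
  set m₀ := ⌊τ / 2 * ℓ⌋₊ - 1 with hm₀
  have hfl : 1 ≤ ⌊τ / 2 * ℓ⌋₊ := Nat.one_le_floor_iff _ |>.2 hσ
  have hm₀1 : (m₀ : ℝ) + 1 ≤ τ / 2 * ℓ := by
    have h1 : (⌊τ / 2 * ℓ⌋₊ : ℝ) ≤ τ / 2 * ℓ := Nat.floor_le (by positivity)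
    have h2 : (m₀ : ℝ) = ⌊τ / 2 * ℓ⌋₊ - 1 := by rw [hm₀, Nat.cast_sub hfl, Nat.cast_one]
    linarith
  have hm₀2 : τ / 2 * ℓ - 2 ≤ m₀ := by
    have h1 := Nat.sub_one_lt_floor (τ / 2 * ℓ)
    have h2 : (m₀ : ℝ) = ⌊τ / 2 * ℓ⌋₊ - 1 := by rw [hm₀, Nat.cast_sub hfl, Nat.cast_one]
    linarith
  set y : ℕ → ℝ := fun m => if m ≤ m₀ then 1 else μ ^ ((m : ℝ) + 1) * X ^ (-s - γ) with hy
  set z : ℕ → ℝ := fun m => μ ^ ((m : ℝ) + 1 - s * ℓ) with hz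
  have hy0 : ∀ m, 0 < y m := by
    intro m
    simp only [hy]
    split_ifs <;> positivity
  have hq : ∀ m ≤ K, inputLaw.real {x | stateEnd own opp (m + 1) x ∈ lightStates w N Y ∧
      (y m ≤ (treeAt g f (m + 1) x \ graphAt own opp (m + 1) x).card ∨
        y m ≤ (graphAt own opp (m + 1) x \ treeAt g f (m + 1) x).card)} ≤
      cQ * X ^ (-(2 * θ)) := by
    intro m hm
    have hmℓ : (m : ℝ) + 1 ≤ ℓ := by
      have : (m : ℝ) ≤ K := by exact_mod_cast hm
      linarith
    refine (measure_sdiff_ge_le (lightStates_of_le w N Y) hn hρ1 hη0 hν.le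
      (lintegral_offspring hg).le ((lintegral_offspring hf).le.trans
        (ENNReal.ofReal_le_ofReal hμρ)) (fun s hs hv => hfound s hs.1 hv) hgη
      (fun s hs hv => ⟨isMass_nextPmf hv (paired_lt_total hNL hLpos hs.1).1,
        (dist1_nextPmf_le_of_lightStates hNL hLpos hκ hM0 hY0.le hmom hmean hN0.le hD0 hdf
          hs).trans (ENNReal.ofReal_le_ofReal hdist)⟩) m (hy0 m)).trans ?_
    rw [div_le_iff₀ (hy0 m)]
    have h1 : ρ ^ (m + 1) ≤ μ ^ ((m : ℝ) + 1) * X ^ θ := by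
      have := hρpow (m + 1) (by push_cast; exact hmℓ)
      push_cast at this
      exact this
    have h2 : 2 * (((m : ℝ) + 1) * ρ ^ (m + 1) * (η * (1 + ν))) ≤
        cQ * (μ ^ ((m : ℝ) + 1) * X ^ (5 * θ - τ)) := by
      calc 2 * (((m : ℝ) + 1) * ρ ^ (m + 1) * (η * (1 + ν)))
          ≤ 2 * ((cl * X ^ θ) * (μ ^ ((m : ℝ) + 1) * X ^ θ) * (η * (1 + ν))) := by
            have := hmℓ.trans hℓθ
            gcongr
        _ = cQ * (μ ^ ((m : ℝ) + 1) * (X ^ θ * (X ^ θ * X ^ (3 * θ - τ)))) := by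
            rw [hη, hcQ]; ring
        _ = _ := by rw [hadd, hadd]; congr 3; ring
    refine h2.trans ?_
    rw [mul_assoc cQ (X ^ (-(2 * θ)))]
    refine mul_le_mul_of_nonneg_left ?_ hcQ0.le
    simp only [hy]
    split_ifs with hmm
    · have h3 : μ ^ ((m : ℝ) + 1) ≤ X ^ (τ / 2) := by
        rw [← hpow]
        refine Real.rpow_le_rpow_of_exponent_le hμ.le ?_
        have : (m : ℝ) ≤ m₀ := by exact_mod_cast hmm
        linarith
      calc μ ^ ((m : ℝ) + 1) * X ^ (5 * θ - τ) ≤ X ^ (τ / 2) * X ^ (5 * θ - τ) :=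
            mul_le_mul_of_nonneg_right h3 (by positivity)
        _ = X ^ (τ / 2 + (5 * θ - τ)) := hadd _ _
        _ ≤ X ^ (-(2 * θ)) := hle (by linarith)
        _ = _ := (mul_one _).symm
    · rw [mul_left_comm, hadd]
      refine mul_le_mul_of_nonneg_left (hle ?_) (by positivity)
      linarith
  have hr : ∀ m ≤ K, m₀ ≤ m → inputLaw.real {x | (treeAt g f (m₀ + 1) x).Nonempty ∧
      ((treeAt g f (m + 1) x).card : ℝ) ≤ z m} ≤ K₂ * X ^ (-b) := by
    intro m hm hm0
    rw [← hpow]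
    refine htail ℓ m₀ m hm0 ?_ hm₀2
    have : (m : ℝ) ≤ K := by exact_mod_cast hm
    linarith
  have hfin := one_sub_le_measure_isClose (γ := γ) hp₁ hp₂ hq hr (by positivity)
    (fun m hm => by simp only [hy, hm, if_true, le_refl])
    (fun m hm => by
      simp only [hy, hz, not_le.2 hm, if_false]
      rw [Real.rpow_sub hμ0, hpow, div_eq_mul_inv, ← Real.rpow_neg hX0.le, mul_assoc]
      rw [show X ^ (-s) * (n : ℝ) ^ (-γ) = X ^ (-s + -γ) from hadd _ _]
      exact le_of_eq (by rw [sub_eq_add_neg]))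
  refine le_trans ?_ hfin
  have ha1 : X ^ (-θ) ≤ X ^ (-(min θ (b / 2))) := hle (neg_le_neg (min_le_left _ _))
  have ha2 : X ^ (-(b / 2)) ≤ X ^ (-(min θ (b / 2))) := hle (neg_le_neg (min_le_right _ _))
  have hs1 : ((K : ℝ) + 1) * (cQ * X ^ (-(2 * θ))) ≤ cl * cQ * X ^ (-θ) := by
    calc ((K : ℝ) + 1) * (cQ * X ^ (-(2 * θ))) ≤ (cl * X ^ θ) * (cQ * X ^ (-(2 * θ))) :=
          mul_le_mul_of_nonneg_right (hKℓ.trans hℓθ) (by positivity)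
      _ = cl * cQ * (X ^ θ * X ^ (-(2 * θ))) := by ring
      _ = _ := by rw [hadd]; congr 2; ring
  have hs2 : ((K : ℝ) + 1) * (K₂ * X ^ (-b)) ≤ cb * K₂ * X ^ (-(b / 2)) := by
    calc ((K : ℝ) + 1) * (K₂ * X ^ (-b)) ≤ (cb * X ^ (b / 2)) * (K₂ * X ^ (-b)) :=
          mul_le_mul_of_nonneg_right (hKℓ.trans hℓb) (by positivity)
      _ = cb * K₂ * (X ^ (b / 2) * X ^ (-b)) := by ring
      _ = _ := by rw [hadd]; congr 2; ring
  have hs3 := mul_le_mul_of_nonneg_left ha1 (show 0 ≤ cl * A by positivity)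
  have hs4 := mul_le_mul_of_nonneg_left ha1 (show 0 ≤ C + 4 / ν * C * (cl * A) by positivity)
  have hs5 := mul_le_mul_of_nonneg_left ha1 (show 0 ≤ cl * cQ by positivity)
  have hs6 := mul_le_mul_of_nonneg_left ha2 (show 0 ≤ cb * K₂ by positivity)
  rw [hCabs]
  linarith

/-- The coupling theorem for a deterministic bi-degree sequence. -/
theorem exists_measure_isClose (hg : HasSum (fun j : ℕ => (j : ℝ) * (g j).toReal) ν)
    (hf : HasSum (fun j : ℕ => (j : ℝ) * (f j).toReal) μ) (hμ : 1 < μ) (hε : 0 < ε)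
    (hκ : 0 < κ) (hκ1 : κ ≤ 1) (hδ : 0 < δ) (hδ1 : δ < 1) (hγ : 0 < γ)
    (hγ1 : γ < min (δ * κ) ε) :
    ∃ K a : ℝ, 0 < K ∧ 0 < a ∧ ∀ (n : ℕ) (own opp : Fin n → ℕ), total own = total opp →
      dist1 (empirical own) (fun t => (g t).toReal) ≤ ENNReal.ofReal ((n : ℝ) ^ (-ε)) →
      dist1 (sizeBiased own opp) (fun t => (f t).toReal) ≤ ENNReal.ofReal ((n : ℝ) ^ (-ε)) →
      ∑ r, (opp r : ℝ) ^ κ * (own r * opp r) ≤ C * n →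
      ∀ k : ℕ, 1 ≤ k → (k : ℝ) ≤ (1 - δ) * Real.logb μ n →
        1 - K * (n : ℝ) ^ (-a) ≤ inputLaw.real {x | IsClose own opp g f γ k
          (fun i => x (Sum.inl i)) (fun i => x (Sum.inr i))} := by
  have hpos : ∀ (n k : ℕ), 1 ≤ k → (k : ℝ) ≤ (1 - δ) * Real.logb μ n → (1 : ℝ) < n := by
    intro n k hk hkn
    have hk' : (1 : ℝ) ≤ k := by exact_mod_cast hk
    by_contra hcon
    have hn : n = 0 ∨ n = 1 := by
      have : n ≤ 1 := by exact_mod_cast not_lt.1 hcon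
      lia
    have : Real.logb μ n = 0 := by
      rcases hn with rfl | rfl <;> simp
    rw [this, mul_zero] at hkn
    linarith
  have hν0 : 0 ≤ ν := hg.nonneg fun j => mul_nonneg (Nat.cast_nonneg _) ENNReal.toReal_nonneg
  rcases hν0.eq_or_lt with hν | hν
  · refine ⟨1, ε, one_pos, hε, fun n own opp _ hdg _ _ k hk hkn => ?_⟩
    have hn := hpos n k hk hkn
    obtain ⟨K, rfl⟩ : ∃ j, k = j + 1 := ⟨k - 1, by lia⟩
    rw [one_mul]
    rw [← hν] at hg
    exact one_sub_le_measure_isClose_of_mean_eq_zero (by exact_mod_cast zero_lt_one.trans hn) hg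
      (Real.rpow_nonneg (Nat.cast_nonneg _) _) hdg γ K
  set τ := min (δ * κ) ε with hτ
  have hτκ : τ ≤ δ * κ := min_le_left _ _
  have hτε : τ ≤ ε := min_le_right _ _
  have hδκ : δ * κ ≤ δ := mul_le_of_le_one_right hδ.le hκ1
  set θ := (τ - γ) / 24 with hθ
  set s := (τ - γ) / 2 with hs
  obtain ⟨K₂, hK₂, b, hb, htail⟩ := exists_lower_tail hg hf hμ (s := s) (σ := τ / 2)
    (by rw [hs]; linarith) (by rw [hs]; linarith) (by linarith)
  obtain ⟨X₀, hX₀1, hX₀⟩ := exists_forall_large (ε := ε) (d := δ - 3 * θ) (θ := θ) (σ := τ / 2)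
    hμ hν hε (by rw [hθ]; linarith) (by rw [hθ]; linarith) (by linarith)
  obtain ⟨c, hc, hlarge⟩ := measure_isClose_large (C := C) (ε := ε) hg hf hμ hν hκ hκ1 hδ hδ1 hγ hτκ hτε
    hγ1 hθ hs hb hK₂ htail hX₀1 hX₀
  set a := min θ (b / 2) with ha
  have ha0 : 0 < a := lt_min (by rw [hθ]; linarith) (by linarith)
  have hX₀0 : 0 < X₀ := by linarith
  refine ⟨c + X₀ ^ a, a, by positivity, ha0, fun n own opp hLL hdg hdf hmom k hk hkn => ?_⟩
  have hn := hpos n k hk hkn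
  have hn0 : (0 : ℝ) < n := by linarith
  rcases le_or_gt X₀ (n : ℝ) with hX | hX
  · obtain ⟨K, rfl⟩ : ∃ j, k = j + 1 := ⟨k - 1, by lia⟩
    have := hlarge n own opp hX hLL hdg hdf hmom K (by push_cast at hkn; exact hkn)
    have h2 : 0 ≤ X₀ ^ a * (n : ℝ) ^ (-a) := by positivity
    linarith
  · have h1 : 1 ≤ X₀ ^ a * (n : ℝ) ^ (-a) := by
      rw [Real.rpow_neg hn0.le, ← div_eq_mul_inv, one_le_div (by positivity)]
      exact Real.rpow_le_rpow hn0.le hX.le ha0.le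
    have h2 : 0 ≤ c * (n : ℝ) ^ (-a) := by positivity
    have h3 : (0 : ℝ) ≤ inputLaw.real {x | IsClose own opp g f γ k
          (fun i => x (Sum.inl i)) (fun i => x (Sum.inr i))} := measureReal_nonneg
    linarith

end

end

variable {n : ℕ} {Ω : Type*} [mΩ : MeasurableSpace Ω] {P : Measure Ω}

/-! ### Conditioning on the bi-degree sequence -/

/-- The conditional probability, given a discrete random variable `D`, of an event that involves `D`
and an independent random variable `W`. -/
lemma condProb_of_indepFun [IsProbabilityMeasure P] {α β : Type*} [MeasurableSpace α] [Countable α]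
    [MeasurableSingletonClass α] [MeasurableSpace β] {D : Ω → α} {W : Ω → β} (hD : Measurable D)
    (hW : Measurable W) (hDW : IndepFun D W P) {S : α → Set β} (hS : ∀ d, MeasurableSet (S d)) :
    P⟦{ω | W ω ∈ S (D ω)} | MeasurableSpace.comap D inferInstance⟧ =ᵐ[P]
      fun ω => (P.map W).real (S (D ω)) := by
  have hle : MeasurableSpace.comap D inferInstance ≤ mΩ := hD.comap_le
  have _ : IsProbabilityMeasure (P.map W) := Measure.isProbabilityMeasure_map hW.aemeasurable
  have _ : IsProbabilityMeasure (P.map D) := Measure.isProbabilityMeasure_map hD.aemeasurable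
  have hG : Measurable fun d => (P.map W).real (S d) := measurable_of_countable _
  have hSm : MeasurableSet {z : α × β | z.2 ∈ S z.1} := by
    have : {z : α × β | z.2 ∈ S z.1} = ⋃ d, {d} ×ˢ S d := by
      ext ⟨d, w⟩
      simp
    rw [this]
    exact MeasurableSet.iUnion fun d => (measurableSet_singleton d).prod (hS d)
  have hEm : MeasurableSet {ω | W ω ∈ S (D ω)} := (hD.prodMk hW) hSm
  have hint : Integrable (fun ω => (P.map W).real (S (D ω))) P := by
    refine Integrable.of_bound (hG.comp hD).aestronglyMeasurable 1 (.of_forall fun ω => ?_)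
    rw [Real.norm_of_nonneg measureReal_nonneg]
    exact measureReal_le_one
  refine (ae_eq_condExp_of_forall_setIntegral_eq hle
    ((integrable_const (1 : ℝ)).indicator hEm) (fun _ _ _ => hint.integrableOn) ?_ ?_).symm
  · rintro s ⟨T, hT, rfl⟩ -
    rw [setIntegral_indicator hEm, setIntegral_const, smul_eq_mul, mul_one]
    have h1 : D ⁻¹' T ∩ {ω | W ω ∈ S (D ω)} =
        (fun ω => (D ω, W ω)) ⁻¹' ((T ×ˢ Set.univ) ∩ {z : α × β | z.2 ∈ S z.1}) := by
      ext ω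
      simp
    rw [measureReal_def, h1, ← Measure.map_apply (hD.prodMk hW) ((hT.prod .univ).inter hSm),
      (indepFun_iff_map_prod_eq_prod_map_map hD.aemeasurable hW.aemeasurable).1 hDW,
      Measure.prod_apply ((hT.prod .univ).inter hSm)]
    have h2 : ∀ d, (P.map W) (Prod.mk d ⁻¹' ((T ×ˢ Set.univ) ∩ {z : α × β | z.2 ∈ S z.1})) =
        T.indicator (fun d => (P.map W) (S d)) d := by
      intro d
      by_cases hd : d ∈ T
      · rw [Set.indicator_of_mem hd]
        congr 1
        ext w
        simp [hd]
      · rw [Set.indicator_of_notMem hd]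
        convert measure_empty (μ := P.map W)
        ext w
        simp [hd]
    simp_rw [h2]
    rw [lintegral_indicator hT, setLIntegral_map hT (measurable_of_countable _) hD,
      integral_eq_lintegral_of_nonneg_ae (.of_forall fun _ => measureReal_nonneg)
        (hG.comp hD).aestronglyMeasurable]
    congr 1
    refine lintegral_congr fun ω => ?_
    rw [measureReal_def, ENNReal.ofReal_toReal (measure_ne_top _ _)]
  · exact (hG.comp (comap_measurable D)).aestronglyMeasurable

variable {DIn DOut : Ω → Fin n → ℕ} {U V : List ℕ → Ω → ℝ}

lemma map_input [IsProbabilityMeasure P] (h : IsInput P DIn DOut U V) :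
    P.map (fun ω j => Sum.elim U V j ω) = inputLaw := by
  have hm : ∀ j, Measurable (Sum.elim U V j) := by
    rintro (i | i)
    · exact h.measurable_U i
    · exact h.measurable_V i
  have hunif : ProbabilityTheory.cond (volume : Measure ℝ) (Set.Ioo 0 1) = unif := by
    simp [ProbabilityTheory.cond, unif]
  rw [(iIndepFun_iff_map_fun_eq_infinitePi_map hm).1 h.iIndep, inputLaw]
  congr 1
  funext j
  rcases j with i | i
  · exact (h.uniform_U i).trans hunif
  · exact (h.uniform_V i).trans hunif

lemma condProb_isClose [IsProbabilityMeasure P] (h : IsInput P DIn DOut U V) {o : Ω → Fin n → ℕ}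
    {q : Ω → Fin n → ℕ} {φ : (Fin n → ℕ) × (Fin n → ℕ) → (Fin n → ℕ) × (Fin n → ℕ)}
    (hφ : ∀ ω, φ (DIn ω, DOut ω) = (o ω, q ω)) (g f : PMF ℕ) (γ : ℝ) (k : ℕ) :
    P⟦{ω | IsClose (o ω) (q ω) g f γ k (fun i => U i ω) (fun i => V i ω)} |
      degreeSigma DIn DOut⟧ =ᵐ[P] fun ω => inputLaw.real {x | IsClose (o ω) (q ω) g f γ k
        (fun i => x (Sum.inl i)) (fun i => x (Sum.inr i))} := by
  have hm : Measurable fun (ω : Ω) (j : List ℕ ⊕ List ℕ) => Sum.elim U V j ω := by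
    rw [measurable_pi_iff]
    rintro (i | i)
    · exact h.measurable_U i
    · exact h.measurable_V i
  have := condProb_of_indepFun (S := fun d => {x : Input | IsClose (φ d).1 (φ d).2 g f γ k
    (fun i => x (Sum.inl i)) (fun i => x (Sum.inr i))})
    (h.measurable_in.prodMk h.measurable_out) hm h.indep
    (fun d => measurableSet_isClose (φ d).1 (φ d).2 g f γ k)
  simp only [hφ, map_input h] at this
  exact this

lemma IsRegular.moment_out {gOut gIn fOut fIn : PMF ℕ} {ε κ C : ℝ} {dIn dOut : Fin n → ℕ}
    (h : IsRegular gOut gIn fOut fIn ε κ C dIn dOut) :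
    ∑ r, (dIn r : ℝ) ^ κ * (dOut r * dIn r) ≤ C * n := by
  refine le_trans (Finset.sum_le_sum fun r _ => ?_) h.moment
  have : 0 ≤ (dOut r : ℝ) ^ κ * dOut r * dIn r := by positivity
  linarith

lemma IsRegular.moment_in {gOut gIn fOut fIn : PMF ℕ} {ε κ C : ℝ} {dIn dOut : Fin n → ℕ}
    (h : IsRegular gOut gIn fOut fIn ε κ C dIn dOut) :
    ∑ r, (dOut r : ℝ) ^ κ * (dIn r * dOut r) ≤ C * n := by
  refine le_trans (Finset.sum_le_sum fun r _ => ?_) h.moment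
  have : 0 ≤ (dIn r : ℝ) ^ κ * dOut r * dIn r := by positivity
  linarith

end DCM

end

theorem theorem4p1 (gOut gIn fOut fIn : PMF ℕ) (ν μ : ℝ)
    (hlim : DCM.IsLimit gOut gIn fOut fIn ν μ)
    (ε κ C : ℝ) (hε : 0 < ε) (hκ : 0 < κ) (hκ1 : κ ≤ 1)
    (δ γ : ℝ) (hδ : 0 < δ) (hδ1 : δ < 1) (hγ : 0 < γ) (hγ1 : γ < min (δ * κ) ε) :
    ∃ K a : ℝ, 0 < K ∧ 0 < a ∧
      ∀ (n : ℕ) (Ω : Type*) (_ : MeasurableSpace Ω) (P : Measure Ω) (_ : IsProbabilityMeasure P)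
        (DIn DOut : Ω → Fin n → ℕ) (U V : List ℕ → Ω → ℝ),
        DCM.IsInput P DIn DOut U V →
        ∀ᵐ ω ∂P, DCM.IsRegular gOut gIn fOut fIn ε κ C (DIn ω) (DOut ω) →
          ∀ k : ℕ, 1 ≤ k → (k : ℝ) ≤ (1 - δ) * Real.logb μ n →
            1 - K * (n : ℝ) ^ (-a) ≤
                (P⟦{ω' | DCM.IsClose (DOut ω') (DIn ω') gOut fOut γ k
                  (fun i => U i ω') (fun i => V i ω')} | DCM.degreeSigma DIn DOut⟧) ω ∧
              1 - K * (n : ℝ) ^ (-a) ≤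
                (P⟦{ω' | DCM.IsClose (DIn ω') (DOut ω') gIn fIn γ k
                  (fun i => U i ω') (fun i => V i ω')} | DCM.degreeSigma DIn DOut⟧) ω := by
  obtain ⟨K₁, a₁, hK₁, ha₁, h₁⟩ := DCM.exists_measure_isClose (C := C) hlim.mean_gOut
    hlim.mean_fOut hlim.one_lt hε hκ hκ1 hδ hδ1 hγ hγ1
  obtain ⟨K₂, a₂, hK₂, ha₂, h₂⟩ := DCM.exists_measure_isClose (C := C) hlim.mean_gIn
    hlim.mean_fIn hlim.one_lt hε hκ hκ1 hδ hδ1 hγ hγ1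
  refine ⟨max K₁ K₂, min a₁ a₂, lt_max_of_lt_left hK₁, lt_min ha₁ ha₂, ?_⟩
  intro n Ω _ P _ DIn DOut U V hin
  have hout : ∀ᵐ ω ∂P, ∀ k, _ := ae_all_iff.2 fun k => DCM.condProb_isClose hin
    (φ := Prod.swap) (o := DOut) (q := DIn) (fun _ => rfl) gOut fOut γ k
  have hinn : ∀ᵐ ω ∂P, ∀ k, _ := ae_all_iff.2 fun k => DCM.condProb_isClose hin
    (φ := id) (o := DIn) (q := DOut) (fun _ => rfl) gIn fIn γ k
  filter_upwards [hout, hinn] with ω ho hi hreg k hk hkn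
  have hk' : (1 : ℝ) ≤ k := by exact_mod_cast hk
  have hn : (1 : ℝ) ≤ n := by
    by_contra hcon
    have : n = 0 := by
      have : n < 1 := by exact_mod_cast not_le.1 hcon
      lia
    subst this
    simp at hkn
    linarith
  have hsum : DCM.total (DOut ω) = DCM.total (DIn ω) := by
    rw [DCM.total, DCM.total, hin.sum_eq ω]
  have hconst : ∀ K a : ℝ, K ≤ max K₁ K₂ → 0 ≤ K → min a₁ a₂ ≤ a →
      1 - max K₁ K₂ * (n : ℝ) ^ (-(min a₁ a₂)) ≤ 1 - K * (n : ℝ) ^ (-a) := by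
    intro K a hK hK0 ha
    have := mul_le_mul hK (Real.rpow_le_rpow_of_exponent_le hn (neg_le_neg ha))
      (by positivity) (hK0.trans hK)
    linarith
  rw [ho k, hi k]
  exact ⟨(hconst K₁ a₁ (le_max_left _ _) hK₁.le (min_le_left _ _)).trans
      (h₁ n (DOut ω) (DIn ω) hsum hreg.dist_gOut hreg.dist_fOut hreg.moment_out k hk hkn),
    (hconst K₂ a₂ (le_max_right _ _) hK₂.le (min_le_right _ _)).trans
      (h₂ n (DIn ω) (DOut ω) hsum.symm hreg.dist_gIn hreg.dist_fIn hreg.moment_in k hk hkn)⟩
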